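/- Consider regions $\Omega\subset\mathbb C$ that are bounded, open, simply connected, contain $0$, are symmetric about the real axis, and are bounded by a closed Jordan curve $\Gamma=\partial\Omega$ which meets the closed negative half-axis $(-\infty,0]$ at exactly one point and is of class $C^2$ away from that point. Say that $\Omega$ solves the self-similar Hele-Shaw problem with a point source at the origin and the killing (Dirichlet) condition on the negative half-axis if there is a function $\Phi$, harmonic in $\Omega\setminus(-\infty,0]$, such that (a) $\Phi\to 0$ at every point of $\Gamma$ and at every point of $\Omega\cap(-\infty,0)$, and $\Phi\sim-\mathrm{Re}\,(z^{-1/2})$ (principal branch) as $z\to0$; (b) the infinitesimal deformation of the boundary with outward normal velocity $\partial\Phi/\partial n$ is homothetic: $\nabla\Phi$ extends continuously to $\Gamma\setminus(-\infty,0]$, and there is a real constant $\mu$ such that $\partial\Phi/\partial n(p)=\mu\,\langle p,n_p\rangle$ for every $p\in\Gamma\setminus(-\infty,0]$, where $n_p$ is the outward unit normal to $\Gamma$ at $p$. Let $D$ be the open unit disk and let $$f(\zeta)=\frac{15}{32}(1+\zeta)^2\Bigl(\zeta^{-1}-(1-\zeta)\,\zeta^{-3/2}\arctan\zeta^{1/2}\Bigr)-\frac58,\qquad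 f(0)=0,$$ (principal branches; the value $0$ fills in the removable singularity at $\zeta=0$). Then: 1. $\Omega$ solves the problem if and only if $\Omega=c\,f(D)$ for some real $c>0$; that is, the solution is $f(D)$, uniquely up to scaling. 2. $f$ is holomorphic and injective on $D$, with $f(0)=0$ and $f'(0)=1$, and $$f(\zeta)=\frac{15}{16}\sum_{k\ge1}\frac{k}{(k^2-\frac14)(k^2-\frac94)}(-\zeta)^k\qquad(|\zeta|<1).$$ 3. $f$ has a logarithmic cusp at $\zeta=-1$: $$f(-1+u)-f(-1)\sim-\frac{15}{32}\,u^2\log u\qquad\text{as } u\to0,\ |-1+u|\le1 .$$ -/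

import Mathlib

open scoped Topology Asymptotics

namespace HeleShaw

/-- `ρ` is a local `C²` defining function of `Ω` at the boundary point `p`: near `p` the set `Ω` is
`{ρ < 0}`, with `ρ p = 0` and `∇ρ p ≠ 0`. Its existence says that `∂Ω` is a `C²` curve near `p`
with `Ω` on one side of it. -/
structure IsDefiningFunctionAt (Ω : Set ℂ) (p : ℂ) (ρ : ℂ → ℝ) : Prop where
  contDiffAt : ContDiffAt ℝ 2 ρ p
  eq_zero : ρ p = 0
  gradient_ne_zero : gradient ρ p ≠ 0
  mem_iff : ∀ᶠ z in 𝓝 p, z ∈ Ω ↔ ρ z < 0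

/-- `n` is the outward unit normal to `∂Ω` at `p`. -/
def IsOutwardUnitNormal (Ω : Set ℂ) (p n : ℂ) : Prop :=
  ∃ ρ : ℂ → ℝ, IsDefiningFunctionAt Ω p ρ ∧ n = ‖gradient ρ p‖⁻¹ • gradient ρ p

/-- The class of regions: bounded simply connected plane domains that contain the origin, are
symmetric about the real axis, and are bounded by a closed Jordan curve which crosses the closed
negative half-axis at a single point `-a` and is of class `C²` away from that point.
Here `Complex.slitPlane` is the plane with the closed negative half-axis deleted. -/
structure IsRegion (Ω : Set ℂ) : Prop where
  isOpen : IsOpen Ω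
  isBounded : Bornology.IsBounded Ω
  isSimplyConnected : IsSimplyConnected Ω
  zero_mem : (0 : ℂ) ∈ Ω
  conj_mem : ∀ z ∈ Ω, (starRingEnd ℂ) z ∈ Ω
  jordan : ∃ γ : Circle → ℂ, Continuous γ ∧ Function.Injective γ ∧ Set.range γ = frontier Ω
  tip : ∃ a : ℝ, 0 < a ∧ frontier Ω \ Complex.slitPlane = {-(a : ℂ)}
  smooth : ∀ p ∈ frontier Ω ∩ Complex.slitPlane, ∃ ρ : ℂ → ℝ, IsDefiningFunctionAt Ω p ρ

/-- `Φ` is the potential of a point source at the origin with the killing condition on the negative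
half-axis: it is harmonic in `Ω` with the negative half-axis deleted, vanishes on `∂Ω` and on the
part of the negative half-axis in `Ω`, and `Φ ∼ -Re (z ^ (-1/2))` at the origin. -/
structure IsPotential (Ω : Set ℂ) (Φ : ℂ → ℝ) : Prop where
  harmonic : InnerProductSpace.HarmonicOnNhd Φ (Ω ∩ Complex.slitPlane)
  zero_on_boundary : ∀ p ∈ frontier Ω,
    Filter.Tendsto Φ (𝓝[Ω ∩ Complex.slitPlane] p) (𝓝 0)
  zero_on_axis : ∀ p ∈ Ω \ Complex.slitPlane, p ≠ 0 →
    Filter.Tendsto Φ (𝓝[Ω ∩ Complex.slitPlane] p) (𝓝 0)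
  at_zero : Φ ~[𝓝[Ω ∩ Complex.slitPlane] 0] fun z : ℂ ↦ -(z ^ (-(1 / 2) : ℂ)).re

/-- `Φ` has normal derivative `d` at the boundary point `p`, in the direction `n`, in the classical
sense: `∇Φ` extends continuously to `p` from inside `Ω`, and the extended gradient has inner
product `d` with `n`. -/
def HasNormalDeriv (Ω : Set ℂ) (Φ : ℂ → ℝ) (p n : ℂ) (d : ℝ) : Prop :=
  ∃ g : ℂ, Filter.Tendsto (fun z ↦ gradient Φ z) (𝓝[Ω] p) (𝓝 g) ∧ inner ℝ g n = d

/-- The infinitesimal deformation of `∂Ω` with outward normal velocity `∂Φ/∂n` is homothetic (about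
the origin): at every boundary point off the negative half-axis it is the normal component
`⟪μ p, n⟫` of the velocity field of a dilation, with one constant `μ` for the whole boundary. -/
def DeformsHomothetically (Ω : Set ℂ) (Φ : ℂ → ℝ) : Prop :=
  ∃ μ : ℝ, ∀ p ∈ frontier Ω ∩ Complex.slitPlane, ∀ n : ℂ, IsOutwardUnitNormal Ω p n →
    HasNormalDeriv Ω Φ p n (μ * inner ℝ p n)

/-- `Ω` solves the self-similar Hele-Shaw problem with a point source at the origin and the killing
condition on the negative half-axis. -/
def IsSolution (Ω : Set ℂ) : Prop :=
  IsRegion Ω ∧ ∃ Φ : ℂ → ℝ, IsPotential Ω Φ ∧ DeformsHomothetically Ω Φ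

/-- The map `(15/32) (1+ζ)² (ζ⁻¹ - (1-ζ) ζ^(-3/2) arctan ζ^(1/2)) - 5/8`, with principal branches
(the expression is even in `ζ^(1/2)`), and with its removable singularity at `0` filled in. -/
noncomputable def killingMap (ζ : ℂ) : ℂ :=
  if ζ = 0 then 0 else
    15 / 32 * (1 + ζ) ^ 2 *
      (ζ⁻¹ - (1 - ζ) * ζ ^ (-(3 / 2) : ℂ) * Complex.arctan (ζ ^ (1 / 2 : ℂ))) - 5 / 8

end HeleShaw

/-! Let `F` map the disk conformally onto `Ω`, with `F 0 = 0`, `F' 0 > 0` and real symmetry, and let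
`w` be the root of `F⁻¹` with positive real part. It carries the slit domain to the right half disk.
The maximum principle leaves only the potential `-c Re (w⁻¹ - w)`, which vanishes both on `Re w = 0`
and on `|w| = 1`. For a smooth boundary the homothety condition reads `Re (conj F · ζ F') = k Re w`
at `ζ = w²`, `|w| = 1`.

Existence. On `w = x + iy`, `|w| = 1`, `x > 0`, the arctangent has constant real part `π/4`. Hence
the explicit map `f` has `Im f = (15π/16) x² y`, the logarithm sits in `Re f` alone, and it cancels
in `Re (conj f · ζ f') = (75π/128) x` (`re_conj_killingMap_mul_killingEuler`). This is the free
boundary condition. It is also starlikeness, so `f` is univalent (`injOn_of_re_euler_pos`).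
Monotonicity of the argument on the half circle gives injectivity up to the boundary
(`killingMap_injOn_closedBall`), and `IsJordanConformal.isSolution` concludes.

Uniqueness. Put `W = w⁻¹ - w`. Along the boundary `dp = i n ds`, so `dW = i ν Re (conj p n) ds`
while `d (conj p / p) = -2 i Re (conj p n) ds / p²`. Thus `conj p / p` is, up to a constant, the
primitive `P` of `-(2/ν) dW / z²`. As `F` is a function of `w²`, `P` is an odd meromorphic function
of `w` with its only pole at `0`. Symmetry and the tip fix the constant (`tendsto_sub_conj_div`):
the boundary values of `F P` are `conj p - p`, which is imaginary. Subtracting `α (w⁻³ - w³) + β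
(w⁻¹ - w)`, imaginary on `|w| = 1`, leaves a holomorphic function with vanishing real part on the
whole boundary, hence zero (`regular_eq_zero`). So `Im p = y (4 α x² + β - α)`. Its vanishing at the
tip gives `β = α`, and then `Im F` is a multiple of `Im f` on the boundary, so `F` is a multiple of
`f`.

No continuous extension of `F` to the circle is used. Limits of `w` at boundary points are taken
from the `Ω` side: `∇Φ` extends, so `W` has limits, and `W` together with `|w| → 1` determines `w`.
The Hopf lemma keeps these limits off `±i`. The tip is neutralised by the barrier `-log |F + a|`,
and `not_forall_tendsto_zero_on_arc` shows that `w` does approach `±i` along some boundary points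
tending to the tip. -/

namespace HeleShaw
open Filter Set Metric InnerProductSpace

/-! ### The maximum principle with a barrier -/

/-- Locally `u = Re F` with `F` holomorphic and `|exp F| = exp u`, so this is the local maximum
modulus principle for `exp F`. -/
theorem harmonic_eventually_eq_of_isLocalMax {u : ℂ → ℝ} {z : ℂ} (hu : HarmonicAt u z)
    (hmax : IsLocalMax u z) : ∀ᶠ w in 𝓝 z, u w = u z := by
  obtain ⟨r, hr, hball⟩ := Metric.isOpen_iff.1 (isOpen_setOfPred_harmonicAt u) z hu
  obtain ⟨F, hF, hFu⟩ := HarmonicOnNhd.exists_analyticOnNhd_ball_re_eq (f := u) (z := z) (R := r)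
    (fun w hw ↦ hball hw)
  have hmem : ball z r ∈ 𝓝 z := ball_mem_nhds z hr
  have hn : ∀ w ∈ ball z r, ‖Complex.exp (F w)‖ = Real.exp (u w) := fun w hw ↦ by
    rw [Complex.norm_exp, ← hFu hw]
  have hd : ∀ᶠ w in 𝓝 z, DifferentiableAt ℂ (fun w ↦ Complex.exp (F w)) w := by
    filter_upwards [hmem] with w hw
    exact (hF w hw).differentiableAt.cexp
  have hm : IsLocalMax (norm ∘ fun w ↦ Complex.exp (F w)) z := by
    filter_upwards [hmem, hmax] with w hw hle
    simp only [Function.comp_apply]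
    rw [hn w hw, hn z (mem_ball_self hr)]
    exact Real.exp_le_exp.2 hle
  filter_upwards [hmem, Complex.norm_eventually_eq_of_isLocalMax hd hm] with w hw heq
  rw [hn w hw, hn z (mem_ball_self hr)] at heq
  exact Real.exp_injective heq

/-- The boundary hypothesis makes superlevel sets at positive heights compact, so a positive value
would give a maximum. The set of maximum points is open by the local principle and closed in `ℂ`,
hence all of `ℂ`, although `V` is bounded. Connectedness of `V` plays no role. -/
theorem harmonic_nonpos_of_frontier {V : Set ℂ} (hV : IsOpen V) (hb : Bornology.IsBounded V)
    {u : ℂ → ℝ} (hu : HarmonicOnNhd u V)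
    (h : ∀ w₀ ∈ frontier V, ∀ ε > 0, ∀ᶠ w in 𝓝[V] w₀, u w ≤ ε) : ∀ w ∈ V, u w ≤ 0 := by
  by_contra! hcon
  obtain ⟨z₀, hz₀, hpos⟩ := hcon
  have hclosed : ∀ c, 0 < c → IsClosed {z ∈ V | c ≤ u z} := by
    intro c hc
    refine isClosed_of_closure_subset fun z hz ↦ ?_
    have hzc : z ∈ closure V := closure_mono (fun _ h ↦ h.1) hz
    rw [mem_closure_iff_frequently] at hz
    by_cases hzV : z ∈ V
    · refine ⟨hzV, ?_⟩
      by_contra! hlt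
      have hcont : ContinuousAt u z := hu.continuousOn.continuousAt (hV.mem_nhds hzV)
      obtain ⟨w, hw, hw'⟩ := (hz.and_eventually (hcont.eventually (gt_mem_nhds hlt))).exists
      exact absurd hw' (not_lt.2 hw.2)
    · have hfr : z ∈ frontier V := by rw [hV.frontier_eq]; exact ⟨hzc, hzV⟩
      have := eventually_nhdsWithin_iff.1 (h z hfr (c / 2) (by positivity))
      obtain ⟨w, hw, hw'⟩ := (hz.and_eventually this).exists
      have := hw' hw.1
      linarith [hw.2]
  have hcpt : ∀ c, 0 < c → IsCompact {z ∈ V | c ≤ u z} := fun c hc ↦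
    Metric.isCompact_of_isClosed_isBounded (hclosed c hc) (hb.subset fun _ h ↦ h.1)
  obtain ⟨z₁, hz₁, hmax⟩ := (hcpt _ hpos).exists_isMaxOn ⟨z₀, hz₀, le_rfl⟩
    (hu.continuousOn.mono fun _ h ↦ h.1)
  have hmaxV : ∀ z ∈ V, u z ≤ u z₁ := fun z hz ↦ by
    by_cases hc : u z₀ ≤ u z
    · exact hmax ⟨hz, hc⟩
    · exact (not_le.1 hc).le.trans hz₁.2
  set M := {z ∈ V | u z₁ ≤ u z} with hM
  have hMo : IsOpen M := by
    rw [isOpen_iff_mem_nhds]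
    rintro z ⟨hzV, hz⟩
    have hloc : IsLocalMax u z := by
      filter_upwards [hV.mem_nhds hzV] with w hw
      exact (hmaxV w hw).trans hz
    filter_upwards [hV.mem_nhds hzV, harmonic_eventually_eq_of_isLocalMax (hu z hzV) hloc]
      with w hw heq
    exact ⟨hw, hz.trans heq.ge⟩
  have hMc : IsClosed M := hclosed _ (hpos.trans_le hz₁.2)
  have hclopen : IsClopen M := ⟨hMc, hMo⟩
  have huniv : M = univ := hclopen.eq_univ ⟨z₁, hz₁.1, le_rfl⟩
  have hbu : Bornology.IsBounded (univ : Set ℂ) := huniv ▸ hb.subset (fun _ h ↦ h.1)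
  exact NormedSpace.unbounded_univ ℂ ℂ hbu

/-- Apply the maximum principle to `u - η B` and let `η → 0`: exceptional boundary points, where `B`
blows up, cost nothing. -/
theorem harmonic_nonpos_of_barrier {V : Set ℂ} (hV : IsOpen V) (hb : Bornology.IsBounded V)
    {u B : ℂ → ℝ} (hu : HarmonicOnNhd u V) (hB : HarmonicOnNhd B V)
    (h : ∀ w₀ ∈ frontier V, ∀ ε > 0, ∀ η > 0, ∀ᶠ w in 𝓝[V] w₀, u w ≤ ε + η * B w) :
    ∀ w ∈ V, u w ≤ 0 := by
  intro w hw
  have key : ∀ η > 0, u w ≤ η * B w := by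
    intro η hη
    have := harmonic_nonpos_of_frontier hV hb (u := u - η • B) (hu.sub hB.const_smul)
      (fun w₀ hw₀ ε hε ↦ by
        filter_upwards [h w₀ hw₀ ε hε η hη] with w hw
        simp only [Pi.sub_apply, Pi.smul_apply, smul_eq_mul]
        linarith) w hw
    simp only [Pi.sub_apply, Pi.smul_apply, smul_eq_mul] at this
    linarith
  have ht : Tendsto (fun η : ℝ ↦ η * B w) (𝓝[>] 0) (𝓝 0) := by
    have : Tendsto (fun η : ℝ ↦ η * B w) (𝓝 0) (𝓝 (0 * B w)) :=
      (continuous_id.mul continuous_const).tendsto 0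
    rw [zero_mul] at this
    exact this.mono_left nhdsWithin_le_nhds
  exact ge_of_tendsto ht (eventually_mem_nhdsWithin.mono key)

/-- A function `u` which is bounded above and has nonpositive upper boundary limits along `h`, except
at the boundary point `t`, is dominated by small multiples of a barrier at `t`. -/
theorem eventually_le_barrier {l : Filter ℂ} {h : ℂ → ℂ} {u B : ℂ → ℝ} {Ω : Set ℂ} {t : ℂ} {M : ℝ}
    (hΩ : IsOpen Ω) (hb : Bornology.IsBounded Ω) (h₁ : ∀ᶠ w in l, h w ∈ Ω)
    (h₂ : ∀ K ⊆ Ω, IsCompact K → ∀ᶠ w in l, h w ∉ K) (hu : ∀ᶠ w in l, u w ≤ M)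
    (hbv : ∀ p ∈ frontier Ω, p ≠ t → ∀ ε > 0, ∀ᶠ w in l ⊓ comap h (𝓝 p), u w ≤ ε)
    (hB₀ : ∀ᶠ w in l, 0 ≤ B w) (hB : Tendsto B (l ⊓ comap h (𝓝 t)) atTop)
    {ε η : ℝ} (hε : 0 < ε) (hη : 0 < η) : ∀ᶠ w in l, u w ≤ ε + η * B w := by
  -- Along an ultrafilter finer than `l`, `h w` converges to some `p` in the compact closure, and
  -- `h₂` forces `p` onto the boundary. Then either `p ≠ t` and the boundary values decide, or `p =
  -- t` and the barrier outgrows `M`.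
  refine mem_iff_ultrafilter.2 fun 𝒰 h𝒰 ↦ ?_
  have hcl : closure Ω ∈ (𝒰.map h : Ultrafilter ℂ) := by
    rw [Ultrafilter.mem_map]
    exact h𝒰 (h₁.mono fun w hw ↦ subset_closure hw)
  obtain ⟨p, hp, hle⟩ := (hb.isCompact_closure).ultrafilter_le_nhds' _ hcl
  have hle' : (𝒰 : Filter ℂ) ≤ l ⊓ comap h (𝓝 p) :=
    le_inf h𝒰 (tendsto_iff_comap.1 hle)
  have hpΩ : p ∉ Ω := by
    intro hpΩ
    obtain ⟨K, hK, hKΩ, hKc⟩ := local_compact_nhds (hΩ.mem_nhds hpΩ)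
    have h1 : ∀ᶠ w in (𝒰 : Filter ℂ), h w ∉ K := h𝒰 (h₂ K hKΩ hKc)
    have h2 : ∀ᶠ w in (𝒰 : Filter ℂ), h w ∈ K := hle hK
    obtain ⟨w, hw1, hw2⟩ := (h1.and h2).exists
    exact hw1 hw2
  have hfr : p ∈ frontier Ω := by rw [hΩ.frontier_eq]; exact ⟨hp, hpΩ⟩
  have hB₀' : ∀ᶠ w in (𝒰 : Filter ℂ), 0 ≤ B w := h𝒰 hB₀
  by_cases hpt : p = t
  · subst hpt
    have h1 : ∀ᶠ w in (𝒰 : Filter ℂ), M / η ≤ B w := hle' (hB.eventually_ge_atTop (M / η))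
    have h2 : ∀ᶠ w in (𝒰 : Filter ℂ), u w ≤ M := h𝒰 hu
    filter_upwards [h1, h2] with w hw1 hw2
    have := (div_le_iff₀ hη).1 hw1
    show u w ≤ ε + η * B w
    linarith
  · have h1 : ∀ᶠ w in (𝒰 : Filter ℂ), u w ≤ ε := hle' (hbv p hfr hpt ε hε)
    filter_upwards [h1, hB₀'] with w hw1 hw2
    show u w ≤ ε + η * B w
    have := mul_nonneg hη.le hw2
    linarith

end HeleShaw

namespace HeleShaw
open Filter Set Metric

/-! ### The Riemann mapping theorem for bounded domains -/

/-- Holomorphic injections of `Ω` into the unit disk, vanishing at the origin. -/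
structure IsDiskInjection (Ω : Set ℂ) (g : ℂ → ℂ) : Prop where
  diff : DifferentiableOn ℂ g Ω
  inj : InjOn g Ω
  maps : MapsTo g Ω (ball 0 1)
  zero : g 0 = 0
  deriv_ne_zero : ∀ z ∈ Ω, deriv g z ≠ 0

/-- A zero-free family of holomorphic functions converging locally uniformly cannot acquire an
isolated zero in the limit. -/
theorem ne_zero_of_tendstoLocallyUniformlyOn {ι : Type*} {l : Filter ι} [l.NeBot]
    {h : ι → ℂ → ℂ} {H : ℂ → ℂ} {U : Set ℂ} {z : ℂ} (hU : IsOpen U) (hz : z ∈ U)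
    (hd : ∀ i, DifferentiableOn ℂ (h i) U) (hlim : TendstoLocallyUniformlyOn h H l U)
    (hne : ∀ i, ∀ w ∈ U, h i w ≠ 0) (hiso : ∀ᶠ w in 𝓝[≠] z, H w ≠ 0) : H z ≠ 0 := by
  intro hHz
  have hHd : DifferentiableOn ℂ H U := hlim.differentiableOn (.of_forall hd) hU
  obtain ⟨r₁, hr₁, hr₁U⟩ := Metric.isOpen_iff.1 hU z hz
  obtain ⟨r₂, hr₂, hr₂H⟩ := Metric.mem_nhdsWithin_iff.1 hiso
  set r := min r₁ r₂ / 2 with hr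
  have hrpos : 0 < r := by positivity
  have hrr₁ : r < r₁ := by have := min_le_left r₁ r₂; have := lt_min hr₁ hr₂; linarith
  have hrr₂ : r < r₂ := by have := min_le_right r₁ r₂; have := lt_min hr₁ hr₂; linarith
  have hcb : closedBall z r ⊆ U := (closedBall_subset_ball hrr₁).trans hr₁U
  have hsph : ∀ w ∈ sphere z r, H w ≠ 0 := fun w hw ↦ hr₂H ⟨by
    rw [mem_ball, mem_sphere.1 hw]; exact hrr₂, by
    rintro rfl; simp at hw; linarith⟩
  obtain ⟨w₀, hw₀, hmin⟩ := (isCompact_sphere z r).exists_isMinOn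
    (NormedSpace.sphere_nonempty.2 hrpos.le)
    ((hHd.continuousOn.mono (sphere_subset_closedBall.trans hcb)).norm)
  set m := ‖H w₀‖ with hm
  have hmpos : 0 < m := norm_pos_iff.2 (hsph w₀ hw₀)
  have hunif : TendstoUniformlyOn h H l (closedBall z r) :=
    (tendstoLocallyUniformlyOn_iff_forall_isCompact hU).1 hlim _ hcb (isCompact_closedBall z r)
  obtain ⟨i, hi⟩ := (Metric.tendstoUniformlyOn_iff.1 hunif (m / 2) (by positivity)).exists
  have hz' : ‖h i z‖ < m / 2 := by
    have := hi z (mem_closedBall_self hrpos.le)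
    rwa [hHz, dist_comm, dist_zero_right] at this
  have hdc : DiffContOnCl ℂ (fun w ↦ (h i w)⁻¹) (ball z r) := by
    apply DifferentiableOn.diffContOnCl
    rw [closure_ball z hrpos.ne']
    exact ((hd i).mono hcb).inv fun w hw ↦ hne i w (hcb hw)
  -- Maximum modulus for `1 / h i`: on the circle `‖h i‖ ≥ m / 2` because `‖H‖ ≥ m` there. This
  -- contradicts `h i z` being close to `H z = 0`.
  have hle : ‖(h i z)⁻¹‖ ≤ (m / 2)⁻¹ := by
    refine Complex.norm_le_of_forall_mem_frontier_norm_le isBounded_ball hdc (C := (m / 2)⁻¹)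
      (fun w hw ↦ ?_) (subset_closure (mem_ball_self hrpos))
    rw [frontier_ball z hrpos.ne'] at hw
    rw [norm_inv]
    apply inv_anti₀ (by positivity)
    have h1 := hi w (sphere_subset_closedBall hw)
    have h2 : m ≤ ‖H w‖ := hmin hw
    rw [dist_eq_norm] at h1
    have h3 := norm_sub_norm_le (H w) (h i w)
    linarith
  rw [norm_inv] at hle
  have hpos : 0 < ‖h i z‖ := norm_pos_iff.2 (hne i z hz)
  have := (inv_le_inv₀ hpos (by positivity)).1 hle
  linarith

/-- The Schwarz lemma gives all maps into the unit disk a common Lipschitz constant `2 / r` near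
`z`, and equicontinuity turns pointwise into locally uniform convergence. It does the work of
Montel's theorem. -/
theorem tendstoLocallyUniformlyOn_of_mapsTo_ball {ι : Type*} {l : Filter ι} {h : ι → ℂ → ℂ}
    {H : ℂ → ℂ} {U : Set ℂ} (hU : IsOpen U) (hd : ∀ i, DifferentiableOn ℂ (h i) U)
    (hm : ∀ i, MapsTo (h i) U (ball 0 1)) (hH : ∀ z ∈ U, Tendsto (fun i ↦ h i z) l (𝓝 (H z)))
    [l.NeBot] : TendstoLocallyUniformlyOn h H l U := by
  rw [Metric.tendstoLocallyUniformlyOn_iff]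
  intro ε hε z hz
  obtain ⟨r, hr, hrU⟩ := Metric.isOpen_iff.1 hU z hz
  have hlip : ∀ i, ∀ y ∈ ball z r, dist (h i y) (h i z) ≤ 2 / r * dist y z := by
    intro i y hy
    refine Complex.dist_le_div_mul_dist_of_mapsTo_ball ((hd i).mono hrU) (fun w hw ↦ ?_) hy
    have h1 := hm i (hrU hw)
    have h2 := hm i hz
    rw [mem_ball_zero_iff] at h1 h2
    rw [mem_closedBall, dist_eq_norm]
    linarith [norm_sub_le (h i w) (h i z)]
  have hlip' : ∀ y ∈ ball z r, dist (H y) (H z) ≤ 2 / r * dist y z := by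
    intro y hy
    exact le_of_tendsto ((hH y (hrU hy)).dist (hH z hz)) (.of_forall fun i ↦ hlip i y hy)
  set δ := min r (ε * r / 8) with hδ
  have hδpos : 0 < δ := lt_min hr (by positivity)
  refine ⟨ball z δ, mem_nhdsWithin_of_mem_nhds (ball_mem_nhds z hδpos), ?_⟩
  filter_upwards [Metric.tendsto_nhds.1 (hH z hz) (ε / 4) (by positivity)] with i hi y hy
  have hy' : y ∈ ball z r := ball_subset_ball (min_le_left _ _) hy
  have hd' : 2 / r * dist y z ≤ ε / 4 := by
    have : dist y z ≤ ε * r / 8 := (mem_ball.1 hy).le.trans (min_le_right _ _)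
    calc 2 / r * dist y z ≤ 2 / r * (ε * r / 8) := by gcongr
      _ = ε / 4 := by field_simp; norm_num
  have h1 := hlip i y hy'
  have h2 := hlip' y hy'
  have h3 := dist_triangle4 (H y) (H z) (h i z) (h i y)
  rw [dist_comm (H z), dist_comm (h i z) (h i y)] at h3
  linarith

theorem IsDiskInjection.norm_deriv_le {Ω : Set ℂ} {g : ℂ → ℂ} (hg : IsDiskInjection Ω g) {r : ℝ}
    (hr : 0 < r) (hrΩ : ball 0 r ⊆ Ω) : ‖deriv g 0‖ ≤ 1 / r := by
  refine Complex.norm_deriv_le_div_of_mapsTo_ball (hg.diff.mono hrΩ) (fun w hw ↦ ?_) hr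
  rw [hg.zero]
  exact ball_subset_closedBall (hg.maps (hrΩ hw))

/-- An extremal disk injection exists. -/
theorem exists_extremal_diskInjection {Ω : Set ℂ} (hΩ : IsOpen Ω) (hc : IsPreconnected Ω)
    (hb : Bornology.IsBounded Ω) (h0 : (0 : ℂ) ∈ Ω) :
    ∃ g, IsDiskInjection Ω g ∧ deriv g 0 ≠ 0 ∧
      ∀ k, IsDiskInjection Ω k → ‖deriv k 0‖ ≤ ‖deriv g 0‖ := by
  obtain ⟨r, hr, hrΩ⟩ := Metric.isOpen_iff.1 hΩ 0 h0
  obtain ⟨R, hR, hRΩ⟩ := hb.subset_ball_lt 0 0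
  set S := {x : ℝ | ∃ g, IsDiskInjection Ω g ∧ x = ‖deriv g 0‖} with hS
  have hbdd : BddAbove S := ⟨1 / r, by rintro _ ⟨g, hg, rfl⟩; exact hg.norm_deriv_le hr hrΩ⟩
  have hlin : IsDiskInjection Ω (fun z ↦ z / R) := by
    refine ⟨by fun_prop, fun x _ y _ h ↦ ?_, fun z hz ↦ ?_, by simp, fun z _ ↦ by simp [hR.ne']⟩
    · have : (R : ℂ) ≠ 0 := by exact_mod_cast hR.ne'
      exact (div_left_inj' this).1 h
    · rw [mem_ball_zero_iff, norm_div, Complex.norm_real, Real.norm_of_nonneg hR.le, div_lt_one hR]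
      exact mem_ball_zero_iff.1 (hRΩ hz)
  have hlinS : 1 / R ∈ S := ⟨_, hlin, by
    simp [abs_of_pos hR]⟩
  obtain ⟨x, -, hxlim, hxS⟩ := exists_seq_tendsto_sSup ⟨_, hlinS⟩ hbdd
  choose g hg hgx using hxS
  -- Along an ultrafilter every sequence in the closed unit disk converges, so the limit map is
  -- defined pointwise with no extraction of subsequences.
  set l : Filter ℕ := ((hyperfilter ℕ : Ultrafilter ℕ) : Filter ℕ) with hl
  have hlle : l ≤ atTop := by
    rw [← Nat.cofinite_eq_atTop]; exact hyperfilter_le_cofinite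
  have hex : ∀ z : ℂ, ∃ y : ℂ, z ∈ Ω → Tendsto (fun i ↦ g i z) l (𝓝 y) := by
    intro z
    by_cases hz : z ∈ Ω
    · have : closedBall (0 : ℂ) 1 ∈ ((hyperfilter ℕ).map fun i ↦ g i z : Ultrafilter ℂ) := by
        rw [Ultrafilter.mem_map]
        exact Filter.univ_mem' fun i ↦ ball_subset_closedBall ((hg i).maps hz)
      obtain ⟨y, -, hy⟩ := (isCompact_closedBall (0 : ℂ) 1).ultrafilter_le_nhds' _ this
      exact ⟨y, fun _ ↦ hy⟩
    · exact ⟨0, fun h ↦ absurd h hz⟩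
  choose G hG using hex
  have hunif : TendstoLocallyUniformlyOn g G l Ω :=
    tendstoLocallyUniformlyOn_of_mapsTo_ball hΩ (fun i ↦ (hg i).diff) (fun i ↦ (hg i).maps)
      (fun z hz ↦ hG z hz)
  have hGd : DifferentiableOn ℂ G Ω := hunif.differentiableOn (.of_forall fun i ↦ (hg i).diff) hΩ
  have hG0 : G 0 = 0 := by
    refine tendsto_nhds_unique (hG 0 h0) ?_
    simp only [fun i ↦ (hg i).zero]
    exact tendsto_const_nhds
  have hderiv : ‖deriv G 0‖ = sSup S := by
    have h1 := (hunif.deriv (.of_forall fun i ↦ (hg i).diff) hΩ).tendsto_at h0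
    refine tendsto_nhds_unique h1.norm ?_
    simp only [Function.comp_apply, ← hgx]
    exact hxlim.mono_left hlle
  have hpos : 0 < ‖deriv G 0‖ := by
    rw [hderiv]
    exact (by positivity : (0 : ℝ) < 1 / R).trans_le (le_csSup hbdd hlinS)
  have hGan : AnalyticOnNhd ℂ G Ω := hGd.analyticOnNhd hΩ
  have hnc : ∀ c : ℂ, ∀ z ∈ Ω, ∀ᶠ w in 𝓝[≠] z, G w - c ≠ 0 := by
    intro c z hz
    rcases ((hGan.sub analyticOnNhd_const) z hz : AnalyticAt ℂ (fun w ↦ G w - c)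
      z).eventually_eq_zero_or_eventually_ne_zero with h | h
    · exfalso
      have := (hGan.sub (analyticOnNhd_const (v := c))).eqOn_zero_of_preconnected_of_eventuallyEq_zero
        hc hz h
      have hev : G =ᶠ[𝓝 0] fun _ ↦ c := by
        filter_upwards [hΩ.mem_nhds h0] with w hw
        have := this hw
        simpa [sub_eq_zero] using this
      rw [hev.deriv_eq] at hpos
      simp at hpos
    · exact h
  have hGcb : ∀ z ∈ Ω, ‖G z‖ ≤ 1 := fun z hz ↦
    le_of_tendsto (hG z hz).norm (.of_forall fun i ↦ (mem_ball_zero_iff.1 ((hg i).maps hz)).le)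
  refine ⟨G, ⟨hGd, fun z₁ hz₁ z₂ hz₂ heq ↦ ?_, fun z hz ↦ ?_, hG0, fun z hz ↦ ?_⟩,
    norm_pos_iff.1 hpos, fun k hk ↦ ?_⟩
  · by_contra hne
    have hU : IsOpen (Ω \ {z₁}) := hΩ.sdiff isClosed_singleton
    have hsub : TendstoLocallyUniformlyOn (fun i w ↦ g i w - g i z₁) (fun w ↦ G w - G z₁) l
        (Ω \ {z₁}) := by
      rw [Metric.tendstoLocallyUniformlyOn_iff]
      intro ε hε z hz
      obtain ⟨t, ht, h1⟩ := Metric.tendstoLocallyUniformlyOn_iff.1 hunif (ε / 2) (by positivity) z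
        hz.1
      refine ⟨t, nhdsWithin_mono _ sdiff_subset ht, ?_⟩
      filter_upwards [h1, Metric.tendsto_nhds.1 (hG z₁ hz₁) (ε / 2) (by positivity)]
        with i hi hi' y hy
      have := hi y hy
      have h4 : dist (G y - G z₁) (g i y - g i z₁) ≤ dist (G y) (g i y) + dist (G z₁) (g i z₁) :=
        dist_sub_sub_le _ _ _ _
      rw [dist_comm (G z₁)] at h4
      linarith
    -- Hurwitz for `g i - g i z₁`, which has no zero on `Ω \ {z₁}` by injectivity. The derivatives
    -- are treated in the same way below.
    refine ne_zero_of_tendstoLocallyUniformlyOn hU (z := z₂) ⟨hz₂, fun h ↦ hne h.symm⟩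
      (fun i ↦ ((hg i).diff.mono sdiff_subset).sub_const _) hsub (fun i w hw h ↦ ?_)
      (hnc (G z₁) z₂ hz₂) (by rw [heq, sub_self])
    exact hw.2 ((hg i).inj hw.1 hz₁ (sub_eq_zero.1 h))
  · rw [mem_ball_zero_iff]
    refine lt_of_le_of_ne (hGcb z hz) fun h1 ↦ ?_
    have hmax : IsMaxOn (norm ∘ G) Ω z := fun w hw ↦ by
      simp only [mem_ofPred_eq, Function.comp_apply, h1]
      exact hGcb w hw
    have := Complex.eqOn_of_isPreconnected_of_isMaxOn_norm hc hΩ hGd hz hmax h0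
    simp only [Function.const_apply] at this
    rw [hG0] at this
    rw [← this] at h1
    simp at h1
  · refine ne_zero_of_tendstoLocallyUniformlyOn hΩ hz (fun i ↦ (hg i).diff.deriv hΩ)
      (hunif.deriv (.of_forall fun i ↦ (hg i).diff) hΩ) (fun i ↦ (hg i).deriv_ne_zero) ?_
    rcases (hGan.deriv z hz).eventually_eq_zero_or_eventually_ne_zero with h | h
    · exfalso
      exact norm_pos_iff.1 hpos (hGan.deriv.eqOn_zero_of_preconnected_of_eventuallyEq_zero hc hz h h0)
    · exact h
  · rw [hderiv]
    exact le_csSup hbdd ⟨k, hk, rfl⟩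

end HeleShaw

/-! ### Disk automorphisms, the square-root trick and inverse maps -/

namespace HeleShaw
open Filter Set Metric ComplexConjugate

/-- The disk automorphism sending `ω` to the origin. -/
noncomputable def diskAut (ω z : ℂ) : ℂ := (z - ω) / (1 - conj ω * z)

theorem one_sub_conj_mul_ne_zero {ω z : ℂ} (hω : ‖ω‖ < 1) (hz : ‖z‖ < 1) :
    1 - conj ω * z ≠ 0 := by
  intro h
  have h1 : ‖conj ω * z‖ = 1 := by rw [← sub_eq_zero.1 h]; simp
  rw [norm_mul, Complex.norm_conj] at h1
  nlinarith [norm_nonneg ω, norm_nonneg z]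

theorem norm_diskAut_lt_one {ω z : ℂ} (hω : ‖ω‖ < 1) (hz : ‖z‖ < 1) : ‖diskAut ω z‖ < 1 := by
  have hne := one_sub_conj_mul_ne_zero hω hz
  rw [diskAut, norm_div, div_lt_one (norm_pos_iff.2 hne)]
  rw [← sq_lt_sq₀ (norm_nonneg _) (norm_nonneg _), ← Complex.normSq_eq_norm_sq,
    ← Complex.normSq_eq_norm_sq]
  have h1 : Complex.normSq ω < 1 := by rw [Complex.normSq_eq_norm_sq]; nlinarith [norm_nonneg ω]
  have h2 : Complex.normSq z < 1 := by rw [Complex.normSq_eq_norm_sq]; nlinarith [norm_nonneg z]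
  have h3 : 0 < (1 - Complex.normSq ω) * (1 - Complex.normSq z) :=
    mul_pos (by linarith) (by linarith)
  simp only [Complex.normSq_apply, Complex.sub_re, Complex.sub_im, Complex.mul_re, Complex.mul_im,
    Complex.conj_re, Complex.conj_im, Complex.one_re, Complex.one_im] at h3 ⊢
  nlinarith

theorem hasDerivAt_diskAut {ω z : ℂ} (hω : ‖ω‖ < 1) (hz : ‖z‖ < 1) :
    HasDerivAt (diskAut ω) ((1 - conj ω * ω) / (1 - conj ω * z) ^ 2) z := by
  have hne := one_sub_conj_mul_ne_zero hω hz
  have h := ((hasDerivAt_id z).sub_const ω).div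
    (((hasDerivAt_id z).const_mul (conj ω)).const_sub 1) hne
  convert! h using 1
  simp only [id]
  ring

theorem diskAut_deriv_ne_zero {ω z : ℂ} (hω : ‖ω‖ < 1) (hz : ‖z‖ < 1) :
    (1 - conj ω * ω) / (1 - conj ω * z) ^ 2 ≠ 0 :=
  div_ne_zero (one_sub_conj_mul_ne_zero hω hω) (pow_ne_zero _ (one_sub_conj_mul_ne_zero hω hz))

theorem diskAut_injOn {ω : ℂ} (hω : ‖ω‖ < 1) : InjOn (diskAut ω) (ball 0 1) := by
  intro x hx y hy h
  rw [mem_ball_zero_iff] at hx hy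
  rw [diskAut, diskAut, div_eq_div_iff (one_sub_conj_mul_ne_zero hω hx)
    (one_sub_conj_mul_ne_zero hω hy)] at h
  have h2 : (x - y) * (1 - conj ω * ω) = 0 := by linear_combination h
  rcases mul_eq_zero.1 h2 with h3 | h3
  · exact sub_eq_zero.1 h3
  · exact absurd h3 (one_sub_conj_mul_ne_zero hω hω)

/-- The slope of `q = f²` is the slope of `f` times `f x + f z`, which stays away from zero. Only
continuity of the root matters, not its branch. -/
theorem hasDerivAt_of_sq_eq {f q : ℂ → ℂ} {q' z : ℂ} (hf : ContinuousAt f z)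
    (hfq : ∀ x, f x ^ 2 = q x) (hq : HasDerivAt q q' z) (hz : f z ≠ 0) :
    HasDerivAt f (q' / (2 * f z)) z := by
  rw [hasDerivAt_iff_tendsto_slope] at hq ⊢
  have hne : ∀ᶠ x in 𝓝[≠] z, f x + f z ≠ 0 := by
    have : ContinuousAt (fun x ↦ f x + f z) z := hf.add continuousAt_const
    refine (this.eventually_ne ?_).filter_mono nhdsWithin_le_nhds
    rw [← two_mul]
    exact mul_ne_zero two_ne_zero hz
  have hlim : Tendsto (fun x ↦ slope q z x / (f x + f z)) (𝓝[≠] z) (𝓝 (q' / (2 * f z))) := by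
    refine hq.div ?_ (mul_ne_zero two_ne_zero hz)
    rw [two_mul]
    exact ((hf.tendsto.mono_left nhdsWithin_le_nhds).add tendsto_const_nhds)
  refine hlim.congr' ?_
  filter_upwards [hne, self_mem_nhdsWithin] with x hx hxz
  rw [slope_def_field, slope_def_field, ← hfq, ← hfq]
  have : x - z ≠ 0 := sub_ne_zero.2 hxz
  field_simp
  ring

/-- Koebe's argument: move the omitted value to `0`, take a square root (possible as `Ω` is simply
connected), and move the image `b` of the origin back to `0`. The derivative at `0` gains the factor
`(1 + ‖b‖²) / (2 ‖b‖) > 1`, where `‖b‖² = ‖ω‖`. -/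
theorem IsDiskInjection.exists_larger {Ω : Set ℂ} (hΩ : IsOpen Ω) (hsc : IsSimplyConnected Ω)
    (h0 : (0 : ℂ) ∈ Ω) {g : ℂ → ℂ} (hg : IsDiskInjection Ω g) {ω : ℂ} (hω : ‖ω‖ < 1)
    (hωg : ω ∉ g '' Ω) : ∃ k, IsDiskInjection Ω k ∧ ‖deriv g 0‖ < ‖deriv k 0‖ := by
  have hgn : ∀ z ∈ Ω, ‖g z‖ < 1 := fun z hz ↦ mem_ball_zero_iff.1 (hg.maps hz)
  have hgd : ∀ z ∈ Ω, HasDerivAt g (deriv g z) z := fun z hz ↦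
    (hg.diff.differentiableAt (hΩ.mem_nhds hz)).hasDerivAt
  have hqd : ∀ z ∈ Ω, HasDerivAt (diskAut ω ∘ g)
      ((1 - conj ω * ω) / (1 - conj ω * g z) ^ 2 * deriv g z) z := fun z hz ↦
    (hasDerivAt_diskAut hω (hgn z hz)).comp z (hgd z hz)
  have hq0 : ∀ z ∈ Ω, diskAut ω (g z) ≠ 0 := fun z hz h ↦ by
    rcases div_eq_zero_iff.1 h with h | h
    · exact hωg ⟨z, hz, sub_eq_zero.1 h⟩
    · exact one_sub_conj_mul_ne_zero hω (hgn z hz) h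
  obtain ⟨f, hfc, hf⟩ := Complex.exists_continuousOn_pow_eq hsc hΩ (g := diskAut ω ∘ g)
    (fun z hz ↦ (hqd z hz).continuousAt.continuousWithinAt)
    (by rintro ⟨z, hz, h⟩; exact hq0 z hz h) two_ne_zero
  have hf0 : ∀ z ∈ Ω, f z ≠ 0 := fun z hz h ↦ hq0 z hz (by
    have := hf z
    rw [h] at this
    simpa using this.symm)
  have hfn : ∀ z ∈ Ω, ‖f z‖ < 1 := fun z hz ↦ by
    have h1 := norm_diskAut_lt_one hω (hgn z hz)
    have h2 : ‖f z‖ ^ 2 = ‖diskAut ω (g z)‖ := by rw [← norm_pow, hf z]; rfl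
    nlinarith [norm_nonneg (f z)]
  have hfd : ∀ z ∈ Ω, HasDerivAt f
      ((1 - conj ω * ω) / (1 - conj ω * g z) ^ 2 * deriv g z / (2 * f z)) z := fun z hz ↦
    hasDerivAt_of_sq_eq (hfc.continuousAt (hΩ.mem_nhds hz)) hf (hqd z hz) (hf0 z hz)
  have hfinj : InjOn f Ω := fun x hx y hy h ↦ by
    have h1 : diskAut ω (g x) = diskAut ω (g y) := by
      have hx := hf x; have hy := hf y
      simp only [Function.comp_apply] at hx hy
      rw [← hx, ← hy, h]
    exact hg.inj hx hy (diskAut_injOn hω (hg.maps hx) (hg.maps hy) h1)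
  set b := f 0 with hb
  have hbn : ‖b‖ < 1 := hfn 0 h0
  have hkd : ∀ z ∈ Ω, HasDerivAt (fun z ↦ diskAut b (f z)) ((1 - conj b * b) /
      (1 - conj b * f z) ^ 2 * ((1 - conj ω * ω) / (1 - conj ω * g z) ^ 2 * deriv g z /
      (2 * f z))) z := fun z hz ↦
    (hasDerivAt_diskAut hbn (hfn z hz)).comp z (hfd z hz)
  refine ⟨fun z ↦ diskAut b (f z), ⟨fun z hz ↦
    (hkd z hz).differentiableAt.differentiableWithinAt, fun x hx y hy h ↦ ?_, fun z hz ↦ ?_, ?_,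
    fun z hz ↦ ?_⟩, ?_⟩
  · exact hfinj hx hy (diskAut_injOn hbn (mem_ball_zero_iff.2 (hfn x hx))
      (mem_ball_zero_iff.2 (hfn y hy)) h)
  · exact mem_ball_zero_iff.2 (norm_diskAut_lt_one hbn (hfn z hz))
  · simp [diskAut, ← hb]
  · rw [(hkd z hz).deriv]
    exact mul_ne_zero (diskAut_deriv_ne_zero hbn (hfn z hz))
      (div_ne_zero (mul_ne_zero (diskAut_deriv_ne_zero hω (hgn z hz)) (hg.deriv_ne_zero z hz))
        (mul_ne_zero two_ne_zero (hf0 z hz)))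
  · rw [(hkd 0 h0).deriv, ← hb, hg.zero]
    have hbne : b ≠ 0 := hf0 0 h0
    have hbω : ‖b‖ ^ 2 = ‖ω‖ := by
      rw [← norm_pow, hb, hf 0]
      simp [diskAut, hg.zero]
    have hbpos : 0 < ‖b‖ := norm_pos_iff.2 hbne
    have hcc : ∀ x : ℂ, conj x * x = ((‖x‖ ^ 2 : ℝ) : ℂ) := fun x ↦ by
      rw [mul_comm, Complex.mul_conj, Complex.normSq_eq_norm_sq]
    have hgpos : 0 < ‖deriv g 0‖ := norm_pos_iff.2 (hg.deriv_ne_zero 0 h0)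
    rw [hcc b, hcc ω, mul_zero, sub_zero, one_pow, div_one]
    have e1 : (1 - ((‖b‖ ^ 2 : ℝ) : ℂ)) = ((1 - ‖b‖ ^ 2 : ℝ) : ℂ) := by push_cast; ring
    have e2 : (1 - ((‖ω‖ ^ 2 : ℝ) : ℂ)) = ((1 - ‖ω‖ ^ 2 : ℝ) : ℂ) := by push_cast; ring
    rw [e1, e2]
    simp only [norm_mul, norm_div, norm_pow, Complex.norm_real, Complex.norm_ofNat]
    have h1 : 0 < 1 - ‖b‖ ^ 2 := by nlinarith
    have h2 : 0 < 1 - ‖ω‖ ^ 2 := by nlinarith [norm_nonneg ω]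
    rw [Real.norm_of_nonneg h1.le, Real.norm_of_nonneg h2.le, ← hbω]
    have : (1 - ‖b‖ ^ 2) / (1 - ‖b‖ ^ 2) ^ 2 * ((1 - (‖b‖ ^ 2) ^ 2) * ‖deriv g 0‖ / (2 * ‖b‖)) =
        (1 + ‖b‖ ^ 2) / (2 * ‖b‖) * ‖deriv g 0‖ := by
      field_simp
      ring
    rw [this]
    have h3 : 1 < (1 + ‖b‖ ^ 2) / (2 * ‖b‖) := by
      rw [one_lt_div (by positivity)]
      nlinarith [mul_pos (sub_pos.2 hbn) (sub_pos.2 hbn)]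
    nlinarith

/-- A normalized conformal map of the unit disk onto its image, symmetric about the real axis. -/
structure IsSymmetricConformal (F : ℂ → ℂ) : Prop where
  diff : DifferentiableOn ℂ F (ball 0 1)
  inj : InjOn F (ball 0 1)
  zero : F 0 = 0
  deriv_ne_zero : ∀ z ∈ ball (0 : ℂ) 1, deriv F z ≠ 0
  deriv_zero : ∃ d : ℝ, 0 < d ∧ deriv F 0 = d
  conj_map : ∀ z ∈ ball (0 : ℂ) 1, F (conj z) = conj (F z)

theorem continuousOn_invFunOn {g : ℂ → ℂ} {U : Set ℂ} (hU : IsOpen U) (hd : DifferentiableOn ℂ g U)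
    (hinj : InjOn g U) (hne : ∀ z ∈ U, deriv g z ≠ 0) {z : ℂ} (hz : z ∈ U) :
    ContinuousAt (Function.invFunOn g U) (g z) := by
  have han : AnalyticAt ℂ g z := hd.analyticAt (hU.mem_nhds hz)
  rw [ContinuousAt, hinj.leftInvOn_invFunOn hz, tendsto_def]
  intro s hs
  have h1 : map g (𝓝 z) = 𝓝 (g z) :=
    (han.hasStrictDerivAt).map_nhds_eq (hne z hz)
  rw [← h1, mem_map]
  filter_upwards [hs, hU.mem_nhds hz] with w hw hwU
  rw [mem_preimage, mem_preimage, hinj.leftInvOn_invFunOn hwU]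
  exact hw

theorem hasDerivAt_invFunOn {g : ℂ → ℂ} {U : Set ℂ} (hU : IsOpen U) (hd : DifferentiableOn ℂ g U)
    (hinj : InjOn g U) (hne : ∀ z ∈ U, deriv g z ≠ 0) {z : ℂ} (hz : z ∈ U) :
    HasDerivAt (Function.invFunOn g U) (deriv g z)⁻¹ (g z) := by
  have han : AnalyticAt ℂ g z := hd.analyticAt (hU.mem_nhds hz)
  have h1 : map g (𝓝 z) = 𝓝 (g z) :=
    (han.hasStrictDerivAt).map_nhds_eq (hne z hz)
  have hz' := hinj.leftInvOn_invFunOn hz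
  refine HasDerivAt.of_local_left_inverse (f := g) (continuousOn_invFunOn hU hd hinj hne hz) ?_
    (hne z hz) ?_
  · rw [hz']; exact han.differentiableAt.hasDerivAt
  · rw [← h1, eventually_map]
    filter_upwards [hU.mem_nhds hz] with w hw
    rw [hinj.leftInvOn_invFunOn hw]

theorem isOpen_image_of_deriv_ne_zero {g : ℂ → ℂ} {U : Set ℂ} (hU : IsOpen U)
    (hd : DifferentiableOn ℂ g U) (hne : ∀ z ∈ U, deriv g z ≠ 0) : IsOpen (g '' U) := by
  rw [isOpen_iff_mem_nhds]
  rintro _ ⟨z, hz, rfl⟩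
  have han : AnalyticAt ℂ g z := hd.analyticAt (hU.mem_nhds hz)
  rw [← (han.hasStrictDerivAt).map_nhds_eq (hne z hz)]
  exact image_mem_map (hU.mem_nhds hz)

end HeleShaw

/-! ### The symmetric Riemann map -/

namespace HeleShaw
open Filter Set Metric ComplexConjugate

/-- The Riemann mapping theorem for bounded simply connected domains symmetric about the real
axis. -/
theorem exists_isSymmetricConformal {Ω : Set ℂ} (hΩ : IsOpen Ω) (hsc : IsSimplyConnected Ω)
    (hb : Bornology.IsBounded Ω) (h0 : (0 : ℂ) ∈ Ω) (hconj : ∀ z ∈ Ω, conj z ∈ Ω) :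
    ∃ F, IsSymmetricConformal F ∧ F '' ball 0 1 = Ω := by
  obtain ⟨g, hg, hg0, hmax⟩ := exists_extremal_diskInjection hΩ
    hsc.isPathConnected.isConnected.isPreconnected hb h0
  have hsurj : ∀ ω ∈ ball (0 : ℂ) 1, ω ∈ g '' Ω := by
    intro ω hω
    by_contra hcon
    obtain ⟨k, hk, hlt⟩ := hg.exists_larger hΩ hsc h0 (mem_ball_zero_iff.1 hω) hcon
    exact absurd (hmax k hk) (not_le.2 hlt)
  have hg0n : (‖deriv g 0‖ : ℂ) ≠ 0 := by exact_mod_cast norm_ne_zero_iff.2 hg0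
  -- The rotation that makes the derivative at the origin positive.
  set c : ℂ := conj (deriv g 0) / ‖deriv g 0‖ with hc
  have hcn : ‖c‖ = 1 := by
    rw [hc, norm_div, Complex.norm_conj, Complex.norm_real, norm_norm]
    exact div_self (norm_ne_zero_iff.2 hg0)
  have hc0 : c ≠ 0 := norm_ne_zero_iff.1 (by rw [hcn]; exact one_ne_zero)
  set k : ℂ → ℂ := fun z ↦ c * g z with hk
  have hgd : ∀ z ∈ Ω, HasDerivAt g (deriv g z) z := fun z hz ↦
    (hg.diff.differentiableAt (hΩ.mem_nhds hz)).hasDerivAt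
  have hkd : ∀ z ∈ Ω, HasDerivAt k (c * deriv g z) z := fun z hz ↦ (hgd z hz).const_mul c
  have hkdiff : DifferentiableOn ℂ k Ω := fun z hz ↦
    (hkd z hz).differentiableAt.differentiableWithinAt
  have hkinj : InjOn k Ω := fun x hx y hy h ↦ hg.inj hx hy (mul_left_cancel₀ hc0 h)
  have hkne : ∀ z ∈ Ω, deriv k z ≠ 0 := fun z hz ↦ by
    rw [(hkd z hz).deriv]; exact mul_ne_zero hc0 (hg.deriv_ne_zero z hz)
  have hkmaps : ∀ z ∈ Ω, k z ∈ ball (0 : ℂ) 1 := fun z hz ↦ by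
    rw [mem_ball_zero_iff, hk, norm_mul, hcn, one_mul]
    exact mem_ball_zero_iff.1 (hg.maps hz)
  have hksurj : ∀ ζ ∈ ball (0 : ℂ) 1, ∃ z ∈ Ω, k z = ζ := fun ζ hζ ↦ by
    obtain ⟨z, hz, h⟩ := hsurj (ζ / c) (by
      rw [mem_ball_zero_iff, norm_div, hcn, div_one]; exact mem_ball_zero_iff.1 hζ)
    exact ⟨z, hz, by rw [hk]; simp only; rw [h]; field_simp⟩
  have hk0 : k 0 = 0 := by simp [hk, hg.zero]
  have hkd0 : deriv k 0 = ‖deriv g 0‖ := by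
    rw [(hkd 0 h0).deriv, hc, div_mul_eq_mul_div, mul_comm (conj _), Complex.mul_conj,
      Complex.normSq_eq_norm_sq]
    push_cast
    field_simp
  set F := Function.invFunOn k Ω with hF
  have hFk : ∀ z ∈ Ω, F (k z) = z := fun z hz ↦ hkinj.leftInvOn_invFunOn hz
  have hFm : ∀ ζ ∈ ball (0 : ℂ) 1, F ζ ∈ Ω ∧ k (F ζ) = ζ := fun ζ hζ ↦ by
    obtain ⟨z, hz, rfl⟩ := hksurj ζ hζ
    rw [hFk z hz]; exact ⟨hz, rfl⟩
  have hFd : ∀ ζ ∈ ball (0 : ℂ) 1, HasDerivAt F (deriv k (F ζ))⁻¹ ζ := fun ζ hζ ↦ by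
    have := hasDerivAt_invFunOn hΩ hkdiff hkinj hkne (hFm ζ hζ).1
    rwa [(hFm ζ hζ).2] at this
  have hF0 : F 0 = 0 := by have := hFk 0 h0; rwa [hk0] at this
  have h0b : (0 : ℂ) ∈ ball (0 : ℂ) 1 := mem_ball_self one_pos
  have hFd0 : HasDerivAt F ((‖deriv g 0‖⁻¹ : ℝ) : ℂ) 0 := by
    have := hFd 0 h0b
    rw [hF0, hkd0] at this
    rwa [Complex.ofReal_inv]
  refine ⟨F, ⟨fun ζ hζ ↦ (hFd ζ hζ).differentiableAt.differentiableWithinAt, fun x hx y hy h ↦ ?_,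
    hF0, fun ζ hζ ↦ ?_, ⟨‖deriv g 0‖⁻¹, inv_pos.2 (norm_pos_iff.2 hg0), hFd0.deriv⟩, ?_⟩, ?_⟩
  · rw [← (hFm x hx).2, ← (hFm y hy).2, h]
  · rw [(hFd ζ hζ).deriv]; exact inv_ne_zero (hkne _ (hFm ζ hζ).1)
  · set Fc : ℂ → ℂ := fun ζ ↦ conj (F (conj ζ)) with hFc
    have hcb : ∀ ζ ∈ ball (0 : ℂ) 1, conj ζ ∈ ball (0 : ℂ) 1 := fun ζ hζ ↦ by
      rw [mem_ball_zero_iff, Complex.norm_conj]; exact mem_ball_zero_iff.1 hζ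
    have hFcm : ∀ ζ ∈ ball (0 : ℂ) 1, Fc ζ ∈ Ω := fun ζ hζ ↦
      hconj _ (hFm _ (hcb ζ hζ)).1
    have hFcd : ∀ ζ ∈ ball (0 : ℂ) 1, HasDerivAt Fc (conj (deriv k (F (conj ζ)))⁻¹) ζ := by
      intro ζ hζ
      have := (hFd _ (hcb ζ hζ)).conj_conj
      rwa [Complex.conj_conj] at this
    -- `H` maps the disk to itself, fixes `0` and has derivative `1` there, so it is the identity by
    -- the equality case of Schwarz. This says that `F` commutes with conjugation.
    set H : ℂ → ℂ := fun ζ ↦ k (Fc ζ) with hH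
    have hHd : ∀ ζ ∈ ball (0 : ℂ) 1, HasDerivAt H
        (deriv k (Fc ζ) * conj (deriv k (F (conj ζ)))⁻¹) ζ := fun ζ hζ ↦
      HasDerivAt.comp (h₂ := k) (h := Fc) ζ
        (hkdiff.differentiableAt (hΩ.mem_nhds (hFcm ζ hζ))).hasDerivAt (hFcd ζ hζ)
    have hFc0 : Fc 0 = 0 := by simp [hFc, hF0]
    have hH0 : H 0 = 0 := by simp [hH, hFc0, hk0]
    have hHd0 : dslope H 0 0 = 1 := by
      rw [dslope_same, (hHd 0 h0b).deriv, map_zero, hFc0, hF0, hkd0]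
      simp [hg0]
    have haff := Complex.affine_of_mapsTo_ball_of_norm_dslope_eq_div (f := H) (c := 0) (R₁ := 1)
      (R₂ := 1) (fun ζ hζ ↦ (hHd ζ hζ).differentiableAt.differentiableWithinAt)
      (fun ζ hζ ↦ by rw [hH0]; exact ball_subset_closedBall (hkmaps _ (hFcm ζ hζ)))
      h0b (by rw [hHd0]; simp)
    intro ζ hζ
    have h1 : H (conj ζ) = conj ζ := by
      have := haff (hcb ζ hζ)
      simp only [hH0, hHd0, sub_zero, smul_eq_mul, mul_one, zero_add] at this
      exact this
    have h2 : Fc (conj ζ) = F (conj ζ) :=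
      hkinj (hFcm _ (hcb ζ hζ)) (hFm _ (hcb ζ hζ)).1 (by rw [(hFm _ (hcb ζ hζ)).2]; exact h1)
    rw [← h2, hFc]
    simp
  · ext z
    constructor
    · rintro ⟨ζ, hζ, rfl⟩; exact (hFm ζ hζ).1
    · intro hz; exact ⟨k z, hkmaps z hz, hFk z hz⟩

end HeleShaw

namespace HeleShaw
open Filter Set Metric ComplexConjugate

/-! ### Square roots -/

theorem sq_cpow_half {w : ℂ} (hw : 0 < w.re) : (w ^ 2) ^ (1 / 2 : ℂ) = w := by
  rw [one_div]; exact Complex.sq_cpow_two_inv hw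

theorem cpow_half_sq (z : ℂ) : (z ^ (1 / 2 : ℂ)) ^ 2 = z := by
  rw [one_div]; exact_mod_cast Complex.cpow_nat_inv_pow z two_ne_zero

theorem sq_mem_slitPlane {w : ℂ} (hw : 0 < w.re) : w ^ 2 ∈ Complex.slitPlane := by
  rw [Complex.mem_slitPlane_iff, or_iff_not_imp_right, not_not]
  intro h
  rw [sq, Complex.mul_im] at h
  have : w.im = 0 := by nlinarith
  rw [sq, Complex.mul_re, this]
  nlinarith

theorem cpow_half_re_pos {z : ℂ} (hz : z ∈ Complex.slitPlane) : 0 < (z ^ (1 / 2 : ℂ)).re := by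
  have h0 := Complex.slitPlane_ne_zero hz
  have harg := Complex.mem_slitPlane_iff_arg.1 hz
  rw [Complex.cpow_def_of_ne_zero h0, Complex.exp_re]
  apply mul_pos (Real.exp_pos _)
  have : (Complex.log z * (1 / 2)).im = Complex.arg z / 2 := by
    have : (1 / 2 : ℂ) = ((1 / 2 : ℝ) : ℂ) := by push_cast; rfl
    rw [this, Complex.im_mul_ofReal, Complex.log_im]; ring
  rw [this]
  apply Real.cos_pos_of_mem_Ioo
  have h1 := Complex.neg_pi_lt_arg z
  have h2 := lt_of_le_of_ne (Complex.arg_le_pi z) harg.1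
  constructor <;> linarith

theorem sq_re_add_norm (w : ℂ) : ‖w ^ 2‖ + (w ^ 2).re = 2 * w.re ^ 2 := by
  rw [norm_pow, ← Complex.normSq_eq_norm_sq, Complex.normSq_apply, sq w, Complex.mul_re]; ring

/-! ### Gradients of real parts of holomorphic functions -/

theorem hasGradientAt_re {H : ℂ → ℂ} {H' z : ℂ} (h : HasDerivAt H H' z) :
    HasGradientAt (fun z ↦ (H z).re) (conj H') z := by
  rw [hasGradientAt_iff_hasFDerivAt]
  have h1 := (Complex.reCLM.hasFDerivAt (x := H z)).comp z (h.hasFDerivAt.restrictScalars ℝ)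
  convert! h1 using 1
  ext v
  simp [Complex.inner]

/-! ### The square-root coordinate on the right half disk -/

/-- The right half of the unit disk. -/
def rightHalfDisk : Set ℂ := {w | ‖w‖ < 1 ∧ 0 < w.re}

theorem isOpen_rightHalfDisk : IsOpen rightHalfDisk :=
  (isOpen_lt continuous_norm continuous_const).inter (isOpen_lt continuous_const Complex.continuous_re)

theorem isBounded_rightHalfDisk : Bornology.IsBounded rightHalfDisk :=
  isBounded_ball.subset fun _ hw ↦ mem_ball_zero_iff.2 hw.1

theorem ne_zero_of_mem_rightHalfDisk {w : ℂ} (hw : w ∈ rightHalfDisk) : w ≠ 0 := by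
  rintro rfl
  exact lt_irrefl _ hw.2

theorem sq_mem_ball {w : ℂ} (hw : ‖w‖ < 1) : w ^ 2 ∈ ball (0 : ℂ) 1 := by
  rw [mem_ball_zero_iff, norm_pow]; nlinarith [norm_nonneg w]

theorem conj_mem_ball {w : ℂ} (hw : w ∈ ball (0 : ℂ) 1) : conj w ∈ ball (0 : ℂ) 1 := by
  rw [mem_ball_zero_iff, Complex.norm_conj]; exact mem_ball_zero_iff.1 hw

theorem dslope_conj {h : ℂ → ℂ} (hh : DifferentiableOn ℂ h (ball 0 1))
    (hc : ∀ z ∈ ball (0 : ℂ) 1, h (conj z) = conj (h z)) {z : ℂ} (hz : z ∈ ball (0 : ℂ) 1) :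
    dslope h 0 (conj z) = conj (dslope h 0 z) := by
  have h0b : (0 : ℂ) ∈ ball (0 : ℂ) 1 := mem_ball_self one_pos
  have h00 : conj (h 0) = h 0 := by rw [← hc 0 h0b, map_zero]
  by_cases h0 : z = 0
  · subst h0
    have hd : HasDerivAt h (deriv h 0) (conj 0) := by
      rw [map_zero]
      exact (hh.differentiableAt (isOpen_ball.mem_nhds h0b)).hasDerivAt
    rw [map_zero, dslope_same]
    have h1 := hd.conj_conj
    rw [Complex.conj_conj] at h1
    have h2 : conj ∘ h ∘ conj =ᶠ[𝓝 0] h := by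
      filter_upwards [isOpen_ball.mem_nhds h0b] with w hw
      simp [hc w hw]
    exact (h2.deriv_eq).symm.trans h1.deriv
  · have h1 : conj z ≠ 0 := fun h ↦ h0 (by simpa using h)
    rw [dslope_of_ne _ h0, dslope_of_ne _ h1, slope_def_field, slope_def_field, hc z hz]
    simp [h00]

namespace IsSymmetricConformal

variable {F : ℂ → ℂ}

theorem zero_mem : (0 : ℂ) ∈ ball (0 : ℂ) 1 := mem_ball_self one_pos

theorem ne_zero (hF : IsSymmetricConformal F) {z : ℂ} (hz : z ∈ ball (0 : ℂ) 1) (h0 : z ≠ 0) :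
    F z ≠ 0 := fun h ↦ h0 (hF.inj hz zero_mem (h.trans hF.zero.symm))

theorem eq_mul_dslope (hF : IsSymmetricConformal F) (z : ℂ) : F z = z * dslope F 0 z := by
  have := sub_smul_dslope F 0 z
  rw [hF.zero, sub_zero, sub_zero, smul_eq_mul] at this
  exact this.symm

theorem dslope_diff (hF : IsSymmetricConformal F) :
    DifferentiableOn ℂ (dslope F 0) (ball 0 1) :=
  (Complex.differentiableOn_dslope (isOpen_ball.mem_nhds zero_mem)).2 hF.diff

theorem dslope_ne_zero (hF : IsSymmetricConformal F) {z : ℂ} (hz : z ∈ ball (0 : ℂ) 1) :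
    dslope F 0 z ≠ 0 := by
  by_cases h0 : z = 0
  · subst h0; rw [dslope_same]; exact hF.deriv_ne_zero 0 zero_mem
  · intro h
    exact hF.ne_zero hz h0 (by rw [hF.eq_mul_dslope, h, mul_zero])

theorem dslope_conj (hF : IsSymmetricConformal F) {z : ℂ} (hz : z ∈ ball (0 : ℂ) 1) :
    dslope F 0 (conj z) = conj (dslope F 0 z) :=
  HeleShaw.dslope_conj hF.diff hF.conj_map hz

theorem im_eq_zero_iff (hF : IsSymmetricConformal F) {z : ℂ} (hz : z ∈ ball (0 : ℂ) 1) :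
    (F z).im = 0 ↔ z.im = 0 := by
  rw [← Complex.conj_eq_iff_im, ← Complex.conj_eq_iff_im, ← hF.conj_map z hz]
  exact hF.inj.eq_iff (conj_mem_ball hz) hz

/-- On the real diameter `F t / t` is real, never zero, and positive at `t = 0`; the intermediate
value theorem does the rest. -/
theorem dslope_ofReal_re_pos (hF : IsSymmetricConformal F) {t : ℝ} (ht : |t| < 1) :
    0 < (dslope F 0 t).re := by
  have hmem : ∀ s : ℝ, |s| < 1 → (s : ℂ) ∈ ball (0 : ℂ) 1 := fun s hs ↦ by
    rw [mem_ball_zero_iff, Complex.norm_real]; exact hs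
  have him : ∀ s : ℝ, |s| < 1 → (dslope F 0 s).im = 0 := fun s hs ↦ by
    rw [← Complex.conj_eq_iff_im, ← hF.dslope_conj (hmem s hs), Complex.conj_ofReal]
  have hne : ∀ s : ℝ, |s| < 1 → (dslope F 0 s).re ≠ 0 := fun s hs h ↦
    hF.dslope_ne_zero (hmem s hs) (Complex.ext h (him s hs))
  have hcont : ContinuousOn (fun s : ℝ ↦ (dslope F 0 s).re) (Ioo (-1) 1) := by
    refine Complex.continuous_re.comp_continuousOn (hF.dslope_diff.continuousOn.comp
      Complex.continuous_ofReal.continuousOn fun s hs ↦ hmem s (abs_lt.2 hs))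
  obtain ⟨d, hd, hd'⟩ := hF.deriv_zero
  have h0 : 0 < (dslope F 0 ((0 : ℝ) : ℂ)).re := by
    rw [Complex.ofReal_zero, dslope_same, hd']; exact_mod_cast hd
  by_contra! hcon
  have hpc : IsPreconnected (Ioo (-1 : ℝ) 1) := isPreconnected_Ioo
  obtain ⟨s, hs, hs0⟩ := hpc.intermediate_value (abs_lt.1 ht) (show (0 : ℝ) ∈ Ioo (-1 : ℝ) 1 by simp)
    hcont ⟨hcon, h0.le⟩
  exact hne s (abs_lt.2 hs) hs0

theorem ofReal_eq (hF : IsSymmetricConformal F) {t : ℝ} (ht : |t| < 1) :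
    F t = ((t * (dslope F 0 t).re : ℝ) : ℂ) := by
  have hmem : (t : ℂ) ∈ ball (0 : ℂ) 1 := by
    rw [mem_ball_zero_iff, Complex.norm_real]; exact ht
  have him : (dslope F 0 t).im = 0 := by
    rw [← Complex.conj_eq_iff_im, ← hF.dslope_conj hmem, Complex.conj_ofReal]
  rw [hF.eq_mul_dslope, Complex.ofReal_mul]
  congr 1
  exact Complex.ext rfl (by rw [him, Complex.ofReal_im])

/-- Off the real axis symmetry and injectivity preserve nonreality; on it `F t` has the sign of `t`.
So the slit of `Ω` corresponds to the slit of the disk, and the square root opens `Ω` minus the slit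
onto the right half disk. -/
theorem mem_slitPlane_iff (hF : IsSymmetricConformal F) {z : ℂ} (hz : z ∈ ball (0 : ℂ) 1) :
    F z ∈ Complex.slitPlane ↔ z ∈ Complex.slitPlane := by
  rw [Complex.mem_slitPlane_iff, Complex.mem_slitPlane_iff, Ne, hF.im_eq_zero_iff hz]
  by_cases him : z.im = 0
  · simp only [him, not_true_eq_false, or_false, ne_eq]
    obtain ⟨t, rfl⟩ : ∃ t : ℝ, z = t := ⟨z.re, Complex.ext rfl (by simp [him])⟩
    have ht : |t| < 1 := by
      rw [mem_ball_zero_iff, Complex.norm_real] at hz; exact hz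
    rw [hF.ofReal_eq ht, Complex.ofReal_re, Complex.ofReal_re]
    exact mul_pos_iff_of_pos_right (hF.dslope_ofReal_re_pos ht)
  · simp [him]

theorem isOpen_image (hF : IsSymmetricConformal F) : IsOpen (F '' ball 0 1) :=
  isOpen_image_of_deriv_ne_zero isOpen_ball hF.diff hF.deriv_ne_zero

end IsSymmetricConformal

/-- The branch of `(F⁻¹) ^ (1/2)` with positive real part off the negative axis. -/
noncomputable def sqrtInv (F : ℂ → ℂ) (z : ℂ) : ℂ :=
  (Function.invFunOn F (ball 0 1) z) ^ (1 / 2 : ℂ)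

namespace IsSymmetricConformal

variable {F : ℂ → ℂ}

theorem invFunOn_apply (hF : IsSymmetricConformal F) {ζ : ℂ} (hζ : ζ ∈ ball (0 : ℂ) 1) :
    Function.invFunOn F (ball 0 1) (F ζ) = ζ := hF.inj.leftInvOn_invFunOn hζ

theorem sqrtInv_apply (hF : IsSymmetricConformal F) {w : ℂ} (hw : w ∈ rightHalfDisk) :
    sqrtInv F (F (w ^ 2)) = w := by
  rw [sqrtInv, hF.invFunOn_apply (sq_mem_ball hw.1), sq_cpow_half hw.2]

theorem exists_sq (hF : IsSymmetricConformal F) {z : ℂ}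
    (hz : z ∈ F '' ball 0 1 ∩ Complex.slitPlane) : ∃ w ∈ rightHalfDisk, F (w ^ 2) = z := by
  obtain ⟨⟨ζ, hζ, rfl⟩, hs⟩ := hz
  refine ⟨ζ ^ (1 / 2 : ℂ), ⟨?_, cpow_half_re_pos ((hF.mem_slitPlane_iff hζ).1 hs)⟩, ?_⟩
  · have h1 : ‖ζ ^ (1 / 2 : ℂ)‖ ^ 2 = ‖ζ‖ := by rw [← norm_pow, cpow_half_sq]
    have h2 := mem_ball_zero_iff.1 hζ
    nlinarith [norm_nonneg (ζ ^ (1 / 2 : ℂ))]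
  · rw [cpow_half_sq]

theorem sqrtInv_mem (hF : IsSymmetricConformal F) {z : ℂ}
    (hz : z ∈ F '' ball 0 1 ∩ Complex.slitPlane) : sqrtInv F z ∈ rightHalfDisk := by
  obtain ⟨w, hw, rfl⟩ := hF.exists_sq hz
  rwa [hF.sqrtInv_apply hw]

theorem apply_sqrtInv (hF : IsSymmetricConformal F) {z : ℂ}
    (hz : z ∈ F '' ball 0 1 ∩ Complex.slitPlane) : F (sqrtInv F z ^ 2) = z := by
  obtain ⟨w, hw, rfl⟩ := hF.exists_sq hz
  rw [hF.sqrtInv_apply hw]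

theorem hasDerivAt_sqrtInv (hF : IsSymmetricConformal F) {w : ℂ} (hw : w ∈ rightHalfDisk) :
    HasDerivAt (sqrtInv F) (2 * w * deriv F (w ^ 2))⁻¹ (F (w ^ 2)) := by
  have hb := sq_mem_ball hw.1
  have h1 := hasDerivAt_invFunOn isOpen_ball hF.diff hF.inj hF.deriv_ne_zero hb
  have hid : HasDerivAt (fun ζ : ℂ ↦ ζ ^ (1 / 2 : ℂ)) (2 * w)⁻¹
      (Function.invFunOn F (ball 0 1) (F (w ^ 2))) := by
    rw [hF.invFunOn_apply hb]
    have := (hasDerivAt_id (w ^ 2)).cpow_const (c := (1 / 2 : ℂ)) (sq_mem_slitPlane hw.2)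
    convert! this using 1
    have hw0 := ne_zero_of_mem_rightHalfDisk hw
    have e : (1 / 2 - 1 : ℂ) = -(1 / 2) := by norm_num
    simp only [id, e]
    rw [Complex.cpow_neg, sq_cpow_half hw.2]
    field_simp
  have := hid.comp (F (w ^ 2)) h1
  convert! this using 1
  rw [mul_inv]

/-- Properness of `F`: the preimage of a compact subset of the image is compact in the open disk and
so misses the circle. It takes the place of a boundary extension. -/
theorem eventually_notMem (hF : IsSymmetricConformal F) {K : Set ℂ} (hK : K ⊆ F '' ball 0 1)
    (hKc : IsCompact K) {w₀ : ℂ} (hw₀ : ‖w₀‖ = 1) : ∀ᶠ w in 𝓝[ball 0 1] w₀, F w ∉ K := by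
  set φ := Function.invFunOn F (ball 0 1) with hφ
  have hcont : ContinuousOn φ K := fun z hz ↦ by
    obtain ⟨ζ, hζ, rfl⟩ := hK hz
    exact (continuousOn_invFunOn isOpen_ball hF.diff hF.inj hF.deriv_ne_zero
      hζ).continuousWithinAt
  have hc := hKc.image_of_continuousOn hcont
  have hnot : w₀ ∉ φ '' K := by
    rintro ⟨z, hz, h⟩
    obtain ⟨ζ, hζ, rfl⟩ := hK hz
    rw [hφ, hF.invFunOn_apply hζ] at h
    rw [h, mem_ball_zero_iff, hw₀] at hζ
    exact lt_irrefl _ hζ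
  filter_upwards [mem_nhdsWithin_of_mem_nhds (hc.isClosed.isOpen_compl.mem_nhds hnot),
    self_mem_nhdsWithin] with w hw hwb hwK
  exact hw ⟨F w, hwK, hF.invFunOn_apply hwb⟩

end IsSymmetricConformal

end HeleShaw

/-! ### The source potential in conformal coordinates -/

namespace HeleShaw
open Filter Set Metric ComplexConjugate Asymptotics

theorem inv_sub_re (w : ℂ) : (w⁻¹ - w).re = w.re * ((‖w‖ ^ 2)⁻¹ - 1) := by
  rw [Complex.sub_re, Complex.inv_re, Complex.normSq_eq_norm_sq]; ring

theorem inv_sub_re_nonneg {w : ℂ} (hw : w ∈ rightHalfDisk) : 0 ≤ (w⁻¹ - w).re := by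
  rw [inv_sub_re]
  have hpos : 0 < ‖w‖ := norm_pos_iff.2 (ne_zero_of_mem_rightHalfDisk hw)
  have : 1 ≤ (‖w‖ ^ 2)⁻¹ := by
    rw [one_le_inv₀ (by positivity)]; nlinarith [hw.1]
  exact mul_nonneg hw.2.le (by linarith)

/-- The kernel `Re (w⁻¹ - w)` is equivalent at the origin to `Re w⁻¹`. -/
theorem inv_sub_re_isEquivalent :
    (fun w : ℂ ↦ (w⁻¹ - w).re) ~[𝓝[{w : ℂ | 0 < w.re}] 0] fun w ↦ (w⁻¹).re := by
  rw [IsEquivalent, isLittleO_iff]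
  intro c hc
  have h1 : ∀ᶠ w : ℂ in 𝓝[{w : ℂ | 0 < w.re}] 0, ‖w‖ ^ 2 < c := by
    have : Tendsto (fun w : ℂ ↦ ‖w‖ ^ 2) (𝓝 0) (𝓝 0) := by
      have h : Continuous fun w : ℂ ↦ ‖w‖ ^ 2 := by fun_prop
      have h := h.tendsto 0
      rwa [norm_zero, zero_pow two_ne_zero] at h
    exact (this.eventually (gt_mem_nhds hc)).filter_mono nhdsWithin_le_nhds
  filter_upwards [h1, self_mem_nhdsWithin] with w hw hre
  have hw0 : w ≠ 0 := by rintro rfl; exact lt_irrefl _ hre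
  have hpos : 0 < ‖w‖ := norm_pos_iff.2 hw0
  simp only [Pi.sub_apply, Complex.sub_re, sub_sub_cancel_left, norm_neg, Complex.inv_re,
    Complex.normSq_eq_norm_sq, norm_div, norm_pow, norm_norm]
  rw [mul_div_assoc', le_div_iff₀ (by positivity), mul_comm]
  gcongr

/-- The square root of a symmetric conformal map near the origin, in the real-part sense needed for
the source condition. -/
theorem IsSymmetricConformal.exists_cpow_isEquivalent {F : ℂ → ℂ} (hF : IsSymmetricConformal F) :
    ∃ c : ℝ, 0 < c ∧ (fun w : ℂ ↦ (F (w ^ 2) ^ (-(1 / 2) : ℂ)).re)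
      ~[𝓝[{w : ℂ | 0 < w.re}] 0] fun w ↦ c * (w⁻¹).re := by
  obtain ⟨d, hd, hd'⟩ := hF.deriv_zero
  set g := dslope F 0 with hg
  have hg0 : g 0 = d := by rw [hg, dslope_same, hd']
  have hball : ball (0 : ℂ) 1 ∈ 𝓝 (0 : ℂ) := isOpen_ball.mem_nhds IsSymmetricConformal.zero_mem
  have hgan : AnalyticAt ℂ g 0 := hF.dslope_diff.analyticAt hball
  have hslit0 : g 0 ∈ Complex.slitPlane := by rw [hg0]; exact Complex.ofReal_mem_slitPlane.2 hd
  set e : ℂ → ℂ := fun ζ ↦ g ζ ^ (-(1 / 2) : ℂ) with he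
  have hean : AnalyticAt ℂ e 0 := hgan.cpow analyticAt_const hslit0
  have he0 : e 0 = ((d ^ (-(1 / 2) : ℝ) : ℝ) : ℂ) := by
    rw [he]; simp only; rw [hg0, Complex.ofReal_cpow hd.le]; push_cast; rfl
  set c := d ^ (-(1 / 2) : ℝ) with hc
  have hcpos : 0 < c := Real.rpow_pos_of_pos hd _
  have hslit : ∀ᶠ ζ in 𝓝 (0 : ℂ), g ζ ∈ Complex.slitPlane :=
    hgan.continuousAt.eventually (Complex.isOpen_slitPlane.mem_nhds hslit0)
  -- Near the imaginary axis `Re w⁻¹` is far smaller than `|w⁻¹|`, so the limit `e → c` alone does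
  -- not control real parts. But `e` is Lipschitz and commutes with conjugation, hence `|Im (e ζ)| ≤
  -- K |Im ζ|`, and `Im w² = 2 Re w Im w` supplies the missing factor `Re w`.
  obtain ⟨K, s, hs, hK⟩ := hean.hasStrictDerivAt.hasStrictFDerivAt.exists_lipschitzOnWith
  have hconjs : ∀ᶠ ζ in 𝓝 (0 : ℂ), conj ζ ∈ s := by
    have : Tendsto (fun ζ : ℂ ↦ conj ζ) (𝓝 0) (𝓝 0) := by
      have := Complex.continuous_conj.tendsto (0 : ℂ); rwa [map_zero] at this
    exact this hs
  have him : ∀ᶠ ζ in 𝓝 (0 : ℂ), |(e ζ).im| ≤ K * |ζ.im| := by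
    filter_upwards [hs, hconjs, hslit, hball] with ζ h1 h2 h3 h4
    have hec : e (conj ζ) = conj (e ζ) := by
      simp only [he]
      have hcc : conj (-(1 / 2) : ℂ) = -(1 / 2) := by
        rw [map_neg, map_div₀, map_one, Complex.conj_ofNat]
      rw [hg, hF.dslope_conj h4, Complex.conj_cpow _ _ (Complex.mem_slitPlane_iff_arg.1 h3).1, hcc]
    have h5 := hK.dist_le_mul _ h1 _ h2
    rw [hec, dist_eq_norm, dist_eq_norm, Complex.sub_conj, Complex.sub_conj] at h5
    simp only [norm_mul, Complex.norm_I, Complex.norm_real, mul_one] at h5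
    simp only [Real.norm_eq_abs, abs_two] at h5
    linarith
  have hsq : Tendsto (fun w : ℂ ↦ w ^ 2) (𝓝[{w : ℂ | 0 < w.re}] 0) (𝓝 0) := by
    have := (continuous_pow 2).tendsto (0 : ℂ)
    rw [zero_pow two_ne_zero] at this
    exact this.mono_left nhdsWithin_le_nhds
  set q : ℂ → ℝ := fun w ↦ ((e (w ^ 2)).re + w.im * (e (w ^ 2)).im / w.re) / c with hq
  have hqlim : Tendsto q (𝓝[{w : ℂ | 0 < w.re}] 0) (𝓝 1) := by
    have h1 : Tendsto (fun w : ℂ ↦ (e (w ^ 2)).re) (𝓝[{w : ℂ | 0 < w.re}] 0) (𝓝 c) := by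
      have := (Complex.continuous_re.tendsto _).comp (hean.continuousAt.tendsto.comp hsq)
      rwa [he0, Complex.ofReal_re] at this
    have h2 : Tendsto (fun w : ℂ ↦ w.im * (e (w ^ 2)).im / w.re) (𝓝[{w : ℂ | 0 < w.re}] 0)
        (𝓝 0) := by
      have hz : Tendsto (fun w : ℂ ↦ 2 * K * w.im ^ 2) (𝓝[{w : ℂ | 0 < w.re}] 0) (𝓝 0) := by
        have h : Continuous fun w : ℂ ↦ 2 * (K : ℝ) * w.im ^ 2 := by fun_prop
        have := h.tendsto 0
        rw [Complex.zero_im, zero_pow two_ne_zero, mul_zero] at this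
        exact this.mono_left nhdsWithin_le_nhds
      refine squeeze_zero_norm' ?_ hz
      filter_upwards [hsq him, self_mem_nhdsWithin] with w hw hre
      have hre' : 0 < w.re := hre
      rw [mem_preimage, mem_ofPred_eq] at hw
      rw [Real.norm_eq_abs, abs_div, abs_mul, abs_of_pos hre', div_le_iff₀ hre']
      have h3 : |(w ^ 2).im| = 2 * w.re * |w.im| := by
        rw [sq, Complex.mul_im, show w.re * w.im + w.im * w.re = 2 * w.re * w.im by ring, abs_mul,
          abs_of_pos (by positivity)]
      rw [h3] at hw
      calc |w.im| * |(e (w ^ 2)).im| ≤ |w.im| * (K * (2 * w.re * |w.im|)) := by gcongr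
        _ = 2 * K * |w.im| ^ 2 * w.re := by ring
        _ = _ := by rw [sq_abs]
    have := (h1.add h2).div_const c
    rwa [add_zero, div_self hcpos.ne'] at this
  refine ⟨c, hcpos, ?_⟩
  rw [isEquivalent_iff_exists_eq_mul]
  refine ⟨q, hqlim, ?_⟩
  filter_upwards [hqlim.eventually (lt_mem_nhds zero_lt_one), hsq hslit, hsq hball,
    self_mem_nhdsWithin] with w hqw hsl hb hre
  have hre' : 0 < w.re := hre
  have hw0 : w ≠ 0 := by rintro rfl; exact lt_irrefl _ hre'
  have hn : 0 < Complex.normSq w := Complex.normSq_pos.2 hw0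
  have hkey : (e (w ^ 2) * w⁻¹).re = q w * (c * (w⁻¹).re) := by
    rw [Complex.mul_re, Complex.inv_re, Complex.inv_im, hq]
    field_simp
    ring
  have hpos : 0 < (e (w ^ 2) * w⁻¹).re := by
    rw [hkey, Complex.inv_re]; positivity
  have hene : e (w ^ 2) ≠ 0 := by
    intro h; rw [h, zero_mul] at hpos; exact lt_irrefl _ hpos
  have hgne : g (w ^ 2) ≠ 0 := Complex.slitPlane_ne_zero hsl
  have hinv : 0 < ((e (w ^ 2) * w⁻¹)⁻¹).re := by
    rw [Complex.inv_re]
    exact div_pos hpos (Complex.normSq_pos.2 (mul_ne_zero hene (inv_ne_zero hw0)))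
  -- The reciprocal of `e (w²) / w` squares to `F (w²)` and has positive real part by `hinv`, so it
  -- is the principal root.
  have hsqe : ((e (w ^ 2) * w⁻¹)⁻¹) ^ 2 = F (w ^ 2) := by
    have h1 : e (w ^ 2) ^ 2 = (g (w ^ 2))⁻¹ := by
      simp only [he]
      rw [← Complex.cpow_nat_mul]
      norm_num
      rw [Complex.cpow_neg_one]
    rw [hF.eq_mul_dslope, ← hg, inv_pow, mul_pow, h1]
    field_simp
  simp only [Pi.mul_apply]
  rw [← hkey, ← hsqe, Complex.cpow_neg, sq_cpow_half hinv, inv_inv]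

/-- The potential of a source at the origin, with strength parameter `c`, in the image of `F`. -/
noncomputable def sourcePotential (F : ℂ → ℂ) (c : ℝ) (z : ℂ) : ℝ :=
  (-(c : ℂ) * ((sqrtInv F z)⁻¹ - sqrtInv F z)).re

theorem sourcePotential_eq (F : ℂ → ℂ) (c : ℝ) (z : ℂ) :
    sourcePotential F c z = -(c * ((sqrtInv F z)⁻¹ - sqrtInv F z).re) := by
  rw [sourcePotential, ← Complex.ofReal_neg, Complex.re_ofReal_mul, neg_mul]

namespace IsSymmetricConformal

variable {F : ℂ → ℂ}

theorem hasDerivAt_sourcePotential (hF : IsSymmetricConformal F) (c : ℂ) {w : ℂ}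
    (hw : w ∈ rightHalfDisk) :
    HasDerivAt (fun z ↦ -c * ((sqrtInv F z)⁻¹ - sqrtInv F z))
      (c * (1 + w ^ 2) / (2 * w ^ 3 * deriv F (w ^ 2))) (F (w ^ 2)) := by
  have h := hF.hasDerivAt_sqrtInv hw
  have hw0 := ne_zero_of_mem_rightHalfDisk hw
  have hd := hF.deriv_ne_zero _ (sq_mem_ball hw.1)
  have h2 := ((h.inv (by rw [hF.sqrtInv_apply hw]; exact hw0)).sub h).const_mul (-c)
  rw [hF.sqrtInv_apply hw] at h2
  convert! h2 using 1
  field_simp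
  ring

theorem gradient_sourcePotential (hF : IsSymmetricConformal F) (c : ℝ) {w : ℂ}
    (hw : w ∈ rightHalfDisk) :
    gradient (sourcePotential F c) (F (w ^ 2)) =
      conj (c * (1 + w ^ 2) / (2 * w ^ 3 * deriv F (w ^ 2))) :=
  (hasGradientAt_re (hF.hasDerivAt_sourcePotential c hw)).gradient

/-- Each smaller closed disk has a compact image inside the domain, and `p` lies at positive
distance from it. -/
theorem tendsto_norm_sqrtInv (hF : IsSymmetricConformal F) {p : ℂ}
    (hp : p ∈ frontier (F '' ball 0 1)) :
    Tendsto (fun z ↦ ‖sqrtInv F z‖) (𝓝[F '' ball 0 1 ∩ Complex.slitPlane] p) (𝓝 1) := by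
  rw [hF.isOpen_image.frontier_eq] at hp
  refine tendsto_order.2 ⟨fun r hr ↦ ?_, fun r hr ↦ ?_⟩
  · set r' := max r 0 with hr'
    have hr'1 : r' < 1 := max_lt hr zero_lt_one
    have hr'0 : 0 ≤ r' := le_max_right _ _
    have hsub : closedBall (0 : ℂ) (r' ^ 2) ⊆ ball 0 1 := closedBall_subset_ball (by nlinarith)
    have hK : IsCompact (F '' closedBall 0 (r' ^ 2)) :=
      (isCompact_closedBall _ _).image_of_continuousOn (hF.diff.continuousOn.mono hsub)
    have hpK : p ∉ F '' closedBall 0 (r' ^ 2) := fun h ↦ hp.2 (image_mono hsub h)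
    filter_upwards [mem_nhdsWithin_of_mem_nhds (hK.isClosed.isOpen_compl.mem_nhds hpK),
      self_mem_nhdsWithin] with z hz hzU
    by_contra! hle
    refine hz ⟨sqrtInv F z ^ 2, ?_, hF.apply_sqrtInv hzU⟩
    rw [mem_closedBall_zero_iff, norm_pow]
    exact pow_le_pow_left₀ (norm_nonneg _) (hle.trans (le_max_left _ _)) 2
  · filter_upwards [self_mem_nhdsWithin] with z hzU
    exact (hF.sqrtInv_mem hzU).1.trans hr

/-- `Re (w⁻¹ - w) = Re w (|w|⁻² - 1)` vanishes on both parts of the boundary of the half disk, the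
diameter and the arc, and `c` is the constant that normalises the source. -/
theorem isPotential_sourcePotential (hF : IsSymmetricConformal F) {c : ℝ}
    (hc : (fun w : ℂ ↦ (F (w ^ 2) ^ (-(1 / 2) : ℂ)).re)
      ~[𝓝[{w : ℂ | 0 < w.re}] 0] fun w ↦ c * (w⁻¹).re) :
    IsPotential (F '' ball 0 1) (sourcePotential F c) := by
  have hU : IsOpen (F '' ball 0 1 ∩ Complex.slitPlane) :=
    hF.isOpen_image.inter Complex.isOpen_slitPlane
  refine ⟨fun z hz ↦ ?_, fun p hp ↦ ?_, fun p hp hp0 ↦ ?_, ?_⟩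
  · have : DifferentiableOn ℂ (fun z ↦ -(c : ℂ) * ((sqrtInv F z)⁻¹ - sqrtInv F z))
        (F '' ball 0 1 ∩ Complex.slitPlane) := fun z hz ↦ by
      obtain ⟨w, hw, rfl⟩ := hF.exists_sq hz
      exact (hF.hasDerivAt_sourcePotential c hw).differentiableAt.differentiableWithinAt
    exact (this.analyticAt (hU.mem_nhds hz)).harmonicAt_re
  · have h1 := hF.tendsto_norm_sqrtInv hp
    have h2 : Tendsto (fun z ↦ |c| * ((‖sqrtInv F z‖ ^ 2)⁻¹ - 1))
        (𝓝[F '' ball 0 1 ∩ Complex.slitPlane] p) (𝓝 0) := by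
      have := (((h1.pow 2).inv₀ (by norm_num)).sub_const 1).const_mul |c|
      simpa using this
    refine squeeze_zero_norm' ?_ h2
    filter_upwards [self_mem_nhdsWithin] with z hz
    have hm := hF.sqrtInv_mem hz
    have h3 := inv_sub_re_nonneg hm
    rw [sourcePotential_eq, norm_neg, norm_mul, Real.norm_eq_abs, Real.norm_of_nonneg h3]
    gcongr
    rw [inv_sub_re] at h3 ⊢
    have h4 : 0 ≤ (‖sqrtInv F z‖ ^ 2)⁻¹ - 1 := nonneg_of_mul_nonneg_right h3 hm.2
    have h5 : (sqrtInv F z).re ≤ 1 := ((Complex.re_le_norm _).trans hm.1.le)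
    nlinarith
  · obtain ⟨⟨ζ, hζ, rfl⟩, hs⟩ := hp
    rw [hF.mem_slitPlane_iff hζ] at hs
    have hζ0 : ζ ≠ 0 := by rintro rfl; exact hp0 hF.zero
    have hcont : Tendsto (fun z ↦ sqrtInv F z ^ 2) (𝓝[F '' ball 0 1 ∩ Complex.slitPlane] (F ζ))
        (𝓝 ζ) := by
      have := (continuousOn_invFunOn isOpen_ball hF.diff hF.inj hF.deriv_ne_zero hζ).tendsto
      rw [hF.invFunOn_apply hζ] at this
      refine (this.mono_left nhdsWithin_le_nhds).congr fun z ↦ ?_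
      rw [sqrtInv, cpow_half_sq]
    have hnorm : Tendsto (fun z ↦ ‖sqrtInv F z‖ ^ 2)
        (𝓝[F '' ball 0 1 ∩ Complex.slitPlane] (F ζ)) (𝓝 ‖ζ‖) := by
      simpa [norm_pow] using hcont.norm
    -- The root jumps across the slit, but `2 (Re w)² = |w²| + Re w²` is continuous there and tends
    -- to `|ζ| + Re ζ = 0`.
    have hre2 : Tendsto (fun z ↦ 2 * (sqrtInv F z).re ^ 2)
        (𝓝[F '' ball 0 1 ∩ Complex.slitPlane] (F ζ)) (𝓝 0) := by
      have h1 := hcont.norm.add ((Complex.continuous_re.tendsto _).comp hcont)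
      have h2 : ‖ζ‖ + ζ.re = 0 := by
        rw [Complex.mem_slitPlane_iff, not_or, not_lt, not_not] at hs
        have : ζ = (ζ.re : ℂ) := Complex.ext rfl (by simp [hs.2])
        rw [this, Complex.norm_real, Real.norm_of_nonpos (by simpa using hs.1)]
        simp
      rw [h2] at h1
      exact h1.congr fun z ↦ sq_re_add_norm _
    have hre : Tendsto (fun z ↦ (sqrtInv F z).re)
        (𝓝[F '' ball 0 1 ∩ Complex.slitPlane] (F ζ)) (𝓝 0) := by
      rw [tendsto_zero_iff_abs_tendsto_zero]
      have := (hre2.div_const 2).sqrt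
      simpa [Real.sqrt_sq_eq_abs, Function.comp_def] using this
    have hfin := ((hre.mul ((hnorm.inv₀ (norm_ne_zero_iff.2 hζ0)).sub_const 1)).const_mul c).neg
    rw [zero_mul, mul_zero, neg_zero] at hfin
    refine hfin.congr fun z ↦ ?_
    rw [sourcePotential_eq, inv_sub_re]
  · have hψ : Tendsto (sqrtInv F) (𝓝[F '' ball 0 1 ∩ Complex.slitPlane] 0)
        (𝓝[{w : ℂ | 0 < w.re}] 0) := by
      refine tendsto_nhdsWithin_iff.2 ⟨?_, ?_⟩
      · have h1 := (continuousOn_invFunOn isOpen_ball hF.diff hF.inj hF.deriv_ne_zero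
          zero_mem).tendsto
        rw [hF.invFunOn_apply zero_mem, hF.zero] at h1
        have h2 := (h1.mono_left (nhdsWithin_le_nhds
          (s := F '' ball 0 1 ∩ Complex.slitPlane))).norm.sqrt
        rw [tendsto_zero_iff_norm_tendsto_zero]
        simp only [norm_zero, Real.sqrt_zero] at h2
        refine h2.congr fun z ↦ ?_
        have : ‖Function.invFunOn F (ball 0 1) z‖ = ‖sqrtInv F z‖ ^ 2 := by
          rw [← norm_pow, sqrtInv, cpow_half_sq]
        rw [this, Real.sqrt_sq (norm_nonneg _)]
      · filter_upwards [self_mem_nhdsWithin] with z hz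
        exact (hF.sqrtInv_mem hz).2
    have h1 := hc.comp_tendsto hψ
    have h2 := ((IsEquivalent.refl (u := fun _ : ℂ ↦ c)).mul inv_sub_re_isEquivalent).comp_tendsto hψ
    have h3 := (h2.trans h1.symm).neg
    refine (h3.congr_left (.of_forall fun z ↦ ?_)).congr_right ?_
    · simp [sourcePotential_eq]
    · filter_upwards [self_mem_nhdsWithin] with z hz
      simp only [Function.comp_apply, hF.apply_sqrtInv hz]

end IsSymmetricConformal

end HeleShaw

namespace HeleShaw
open Filter Set Metric ComplexConjugate Asymptotics

/-! ### Boundary charts -/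

theorem fderiv_eq_inner_gradient (ρ : ℂ → ℝ) (p v : ℂ) :
    fderiv ℝ ρ p v = inner ℝ (gradient ρ p) v := by
  rw [← toDual_gradient]; rfl

/-- A local straightening of the boundary: the real part is the defining function. -/
noncomputable def boundaryChart (ρ : ℂ → ℝ) (p z : ℂ) : ℂ :=
  ρ z + (inner ℝ (Complex.I * gradient ρ p) z : ℝ) * Complex.I

namespace IsDefiningFunctionAt

variable {Ω : Set ℂ} {p : ℂ} {ρ : ℂ → ℝ}

theorem contDiffAt_boundaryChart (h : IsDefiningFunctionAt Ω p ρ) :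
    ContDiffAt ℝ 2 (boundaryChart ρ p) p := by
  have h1 := h.contDiffAt
  have h2 : ContDiffAt ℝ 2 (fun z ↦ ((ρ z : ℝ) : ℂ)) p := Complex.ofRealCLM.contDiff.contDiffAt.comp p h1
  have h3 : ContDiffAt ℝ 2
      (fun z : ℂ ↦ ((inner ℝ (Complex.I * gradient ρ p) z : ℝ) : ℂ)) p :=
    Complex.ofRealCLM.contDiff.contDiffAt.comp p (contDiffAt_const.inner ℝ contDiffAt_id)
  exact h2.add (h3.mul contDiffAt_const)

theorem conj_gradient_ne_zero (h : IsDefiningFunctionAt Ω p ρ) : conj (gradient ρ p) ≠ 0 :=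
  fun h' ↦ h.gradient_ne_zero (by simpa using h')

/-- The derivative of the boundary chart. -/
noncomputable def chartDeriv (h : IsDefiningFunctionAt Ω p ρ) : ℂ ≃L[ℝ] ℂ :=
  ContinuousLinearEquiv.equivOfInverse (ContinuousLinearMap.mul ℝ ℂ (conj (gradient ρ p)))
    (ContinuousLinearMap.mul ℝ ℂ (conj (gradient ρ p))⁻¹)
    (fun v ↦ by simp [h.gradient_ne_zero])
    (fun v ↦ by simp [h.gradient_ne_zero])

theorem chartDeriv_apply (h : IsDefiningFunctionAt Ω p ρ) (v : ℂ) :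
    h.chartDeriv v = conj (gradient ρ p) * v := rfl

theorem chartDeriv_symm_apply (h : IsDefiningFunctionAt Ω p ρ) (v : ℂ) :
    h.chartDeriv.symm v = (conj (gradient ρ p))⁻¹ * v := rfl

theorem hasFDerivAt_boundaryChart (h : IsDefiningFunctionAt Ω p ρ) :
    HasFDerivAt (boundaryChart ρ p) (h.chartDeriv : ℂ →L[ℝ] ℂ) p := by
  have hd : DifferentiableAt ℝ ρ p := h.contDiffAt.differentiableAt two_ne_zero
  have h1 := Complex.ofRealCLM.hasFDerivAt.comp p hd.hasFDerivAt
  have h2 := (Complex.ofRealCLM.hasFDerivAt.comp p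
    (innerSL ℝ (Complex.I * gradient ρ p)).hasFDerivAt).mul_const Complex.I
  convert! h1.add h2 using 1
  refine ContinuousLinearMap.ext fun v ↦ ?_
  simp only [ContinuousLinearEquiv.coe_coe, chartDeriv_apply, add_apply,
    ContinuousLinearMap.comp_apply, Complex.ofRealCLM_apply, fderiv_eq_inner_gradient,
    smul_apply, innerSL_apply_apply, Complex.inner]
  apply Complex.ext
  · simp only [Complex.mul_re, Complex.mul_im, Complex.add_re, Complex.conj_re, Complex.conj_im,
      Complex.ofReal_re, Complex.ofReal_im, Complex.I_re, Complex.I_im, smul_eq_mul]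
    ring
  · simp only [Complex.mul_re, Complex.mul_im, Complex.add_im, Complex.conj_re, Complex.conj_im,
      Complex.ofReal_re, Complex.ofReal_im, Complex.I_re, Complex.I_im, smul_eq_mul]
    ring_nf

/-- The inverse of the boundary chart. -/
noncomputable def chartInv (h : IsDefiningFunctionAt Ω p ρ) : ℂ → ℂ :=
  h.contDiffAt_boundaryChart.localInverse h.hasFDerivAt_boundaryChart two_ne_zero

theorem hasStrictFDerivAt_boundaryChart (h : IsDefiningFunctionAt Ω p ρ) :
    HasStrictFDerivAt (boundaryChart ρ p) (h.chartDeriv : ℂ →L[ℝ] ℂ) p :=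
  h.contDiffAt_boundaryChart.hasStrictFDerivAt' h.hasFDerivAt_boundaryChart two_ne_zero

theorem chartInv_apply (h : IsDefiningFunctionAt Ω p ρ) : h.chartInv (boundaryChart ρ p p) = p :=
  h.contDiffAt_boundaryChart.localInverse_apply_image h.hasFDerivAt_boundaryChart two_ne_zero

theorem contDiffAt_chartInv (h : IsDefiningFunctionAt Ω p ρ) :
    ContDiffAt ℝ 2 h.chartInv (boundaryChart ρ p p) :=
  h.contDiffAt_boundaryChart.to_localInverse h.hasFDerivAt_boundaryChart two_ne_zero

theorem eventually_chartInv_boundaryChart (h : IsDefiningFunctionAt Ω p ρ) :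
    ∀ᶠ z in 𝓝 p, h.chartInv (boundaryChart ρ p z) = z :=
  h.hasStrictFDerivAt_boundaryChart.eventually_left_inverse

theorem eventually_boundaryChart_chartInv (h : IsDefiningFunctionAt Ω p ρ) :
    ∀ᶠ y in 𝓝 (boundaryChart ρ p p), boundaryChart ρ p (h.chartInv y) = y :=
  h.hasStrictFDerivAt_boundaryChart.eventually_right_inverse

theorem hasStrictFDerivAt_chartInv (h : IsDefiningFunctionAt Ω p ρ) :
    HasStrictFDerivAt h.chartInv (h.chartDeriv.symm : ℂ →L[ℝ] ℂ) (boundaryChart ρ p p) :=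
  h.hasStrictFDerivAt_boundaryChart.to_localInverse

theorem boundaryChart_re (ρ : ℂ → ℝ) (p z : ℂ) : (boundaryChart ρ p z).re = ρ z := by
  simp [boundaryChart]

theorem boundaryChart_self_re (h : IsDefiningFunctionAt Ω p ρ) :
    (boundaryChart ρ p p).re = 0 := by
  rw [boundaryChart_re, h.eq_zero]

theorem tendsto_chartInv (h : IsDefiningFunctionAt Ω p ρ) :
    Tendsto h.chartInv (𝓝 (boundaryChart ρ p p)) (𝓝 p) := by
  have := h.contDiffAt_chartInv.continuousAt.tendsto
  rwa [h.chartInv_apply] at this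

theorem eventually_chartInv_mem_iff (h : IsDefiningFunctionAt Ω p ρ) :
    ∀ᶠ y in 𝓝 (boundaryChart ρ p p), h.chartInv y ∈ Ω ↔ y.re < 0 := by
  filter_upwards [h.tendsto_chartInv.eventually h.mem_iff, h.eventually_boundaryChart_chartInv]
    with y h1 h2
  rw [h1, ← boundaryChart_re ρ p, h2]

theorem tendsto_chartInv_nhdsWithin (h : IsDefiningFunctionAt Ω p ρ) :
    Tendsto h.chartInv (𝓝[{y | y.re < 0}] (boundaryChart ρ p p)) (𝓝[Ω] p) := by
  refine tendsto_nhdsWithin_iff.2 ⟨h.tendsto_chartInv.mono_left nhdsWithin_le_nhds, ?_⟩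
  filter_upwards [h.eventually_chartInv_mem_iff.filter_mono nhdsWithin_le_nhds,
    self_mem_nhdsWithin] with y h1 h2
  exact h1.2 h2

theorem tendsto_boundaryChart_nhdsWithin (h : IsDefiningFunctionAt Ω p ρ) :
    Tendsto (boundaryChart ρ p) (𝓝[Ω] p) (𝓝[{y | y.re < 0}] (boundaryChart ρ p p)) := by
  refine tendsto_nhdsWithin_iff.2
    ⟨h.contDiffAt_boundaryChart.continuousAt.tendsto.mono_left nhdsWithin_le_nhds, ?_⟩
  filter_upwards [h.mem_iff.filter_mono nhdsWithin_le_nhds, self_mem_nhdsWithin] with z h1 h2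
  rw [boundaryChart_re]
  exact h1.1 h2

theorem eventually_chartInv_mem_frontier (h : IsDefiningFunctionAt Ω p ρ) (hΩ : IsOpen Ω) :
    ∀ᶠ y in 𝓝 (boundaryChart ρ p p), y.re = 0 → h.chartInv y ∈ frontier Ω := by
  have hc : ∀ᶠ y in 𝓝 (boundaryChart ρ p p), ContinuousAt h.chartInv y :=
    (h.contDiffAt_chartInv.eventually (by simp)).mono fun y hy ↦ hy.continuousAt
  filter_upwards [hc, h.eventually_chartInv_mem_iff.eventually_nhds] with y hy hm hre
  rw [hΩ.frontier_eq]
  refine ⟨?_, fun hmem ↦ ?_⟩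
  · have hlim : Tendsto (fun s : ℝ ↦ y - s) (𝓝[>] 0) (𝓝 y) := by
      have : Continuous fun s : ℝ ↦ y - s := by fun_prop
      have := this.tendsto 0
      rw [Complex.ofReal_zero, sub_zero] at this
      exact this.mono_left nhdsWithin_le_nhds
    refine mem_closure_of_tendsto (hy.tendsto.comp hlim) ?_
    filter_upwards [hlim.eventually hm, self_mem_nhdsWithin] with s hs hpos
    have hpos' : 0 < s := hpos
    exact hs.2 (by simp [hre, hpos'])
  · have := (hm.self_of_nhds).1 hmem
    rw [hre] at this
    exact lt_irrefl _ this

/-- A function with a gradient limit at a boundary point is strictly differentiable there, from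
inside the domain. -/
theorem isLittleO_of_tendsto_fderiv {E : Type*} [NormedAddCommGroup E] [NormedSpace ℝ E]
    (h : IsDefiningFunctionAt Ω p ρ) {f : ℂ → E} {L : ℂ →L[ℝ] E}
    (hd : ∀ᶠ z in 𝓝[Ω] p, DifferentiableAt ℝ f z) (hL : Tendsto (fderiv ℝ f) (𝓝[Ω] p) (𝓝 L)) :
    (fun q : ℂ × ℂ ↦ f q.1 - f q.2 - L (q.1 - q.2)) =o[𝓝[Ω] p ×ˢ 𝓝[Ω] p]
      fun q : ℂ × ℂ ↦ q.1 - q.2 := by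
  set y₀ := boundaryChart ρ p p with hy₀
  set L' : ℂ →L[ℝ] E := L.comp (h.chartDeriv.symm : ℂ →L[ℝ] ℂ) with hL'
  have hcd : ∀ᶠ y in 𝓝[{y : ℂ | y.re < 0}] y₀, DifferentiableAt ℝ h.chartInv y :=
    ((h.contDiffAt_chartInv.eventually (by simp)).mono fun y hy ↦
      hy.differentiableAt two_ne_zero).filter_mono nhdsWithin_le_nhds
  have hfd : Tendsto (fun y ↦ (fderiv ℝ f (h.chartInv y)).comp (fderiv ℝ h.chartInv y))
      (𝓝[{y : ℂ | y.re < 0}] y₀) (𝓝 L') := by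
    have h1 := hL.comp h.tendsto_chartInv_nhdsWithin
    have h2 : ContinuousAt (fderiv ℝ h.chartInv) y₀ :=
      (h.contDiffAt_chartInv.fderiv_right (m := 1) (by norm_num)).continuousAt
    have h3 := h2.tendsto.mono_left (nhdsWithin_le_nhds (s := {y : ℂ | y.re < 0}))
    rw [h.hasStrictFDerivAt_chartInv.hasFDerivAt.fderiv] at h3
    exact (isBoundedBilinearMap_comp.continuous.tendsto
      (L, (h.chartDeriv.symm : ℂ →L[ℝ] ℂ))).comp (h1.prodMk_nhds h3)
  -- In the chart the domain is a half-plane, whose intersections with balls are convex, so the mean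
  -- value inequality applies.
  have key : (fun q : ℂ × ℂ ↦ f (h.chartInv q.1) - f (h.chartInv q.2) - L' (q.1 - q.2))
      =o[𝓝[{y : ℂ | y.re < 0}] y₀ ×ˢ 𝓝[{y : ℂ | y.re < 0}] y₀] fun q : ℂ × ℂ ↦ q.1 - q.2 := by
    rw [isLittleO_iff]
    intro c hc
    have hev : ∀ᶠ y in 𝓝[{y : ℂ | y.re < 0}] y₀,
        HasFDerivAt (f ∘ h.chartInv)
          ((fderiv ℝ f (h.chartInv y)).comp (fderiv ℝ h.chartInv y)) y ∧
        ‖(fderiv ℝ f (h.chartInv y)).comp (fderiv ℝ h.chartInv y) - L'‖ ≤ c := by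
      filter_upwards [hcd, h.tendsto_chartInv_nhdsWithin.eventually hd,
        Metric.tendsto_nhds.1 hfd c hc] with y h1 h2 h3
      exact ⟨h2.hasFDerivAt.comp y h1.hasFDerivAt, by rw [← dist_eq_norm]; exact h3.le⟩
    obtain ⟨r, hr, hsub⟩ := Metric.mem_nhdsWithin_iff.1 hev
    have hconv : Convex ℝ (ball y₀ r ∩ {y : ℂ | y.re < 0}) :=
      (convex_ball y₀ r).inter (convex_halfSpace_re_lt 0)
    have hmem : ball y₀ r ∩ {y : ℂ | y.re < 0} ∈ 𝓝[{y : ℂ | y.re < 0}] y₀ :=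
      inter_mem (mem_nhdsWithin_of_mem_nhds (ball_mem_nhds _ hr)) self_mem_nhdsWithin
    filter_upwards [prod_mem_prod hmem hmem] with q hq
    exact hconv.norm_image_sub_le_of_norm_hasFDerivWithin_le'
      (fun x hx ↦ (hsub hx).1.hasFDerivWithinAt) (fun x hx ↦ (hsub hx).2) hq.2 hq.1
  have hT := h.tendsto_boundaryChart_nhdsWithin
  have hstrict : (fun q : ℂ × ℂ ↦ boundaryChart ρ p q.1 - boundaryChart ρ p q.2 -
      h.chartDeriv (q.1 - q.2)) =o[𝓝[Ω] p ×ˢ 𝓝[Ω] p] fun q : ℂ × ℂ ↦ q.1 - q.2 := by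
    refine (h.hasStrictFDerivAt_boundaryChart.isLittleO).mono ?_
    rw [nhds_prod_eq]
    exact prod_mono nhdsWithin_le_nhds nhdsWithin_le_nhds
  have hbig : (fun q : ℂ × ℂ ↦ boundaryChart ρ p q.1 - boundaryChart ρ p q.2)
      =O[𝓝[Ω] p ×ˢ 𝓝[Ω] p] fun q : ℂ × ℂ ↦ q.1 - q.2 := by
    have h1 : (fun q : ℂ × ℂ ↦ h.chartDeriv (q.1 - q.2)) =O[𝓝[Ω] p ×ˢ 𝓝[Ω] p]
        fun q : ℂ × ℂ ↦ q.1 - q.2 :=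
      (h.chartDeriv : ℂ →L[ℝ] ℂ).isBigO_comp _ _
    refine (hstrict.isBigO.add h1).congr_left fun q ↦ by abel
  have h1 := (key.comp_tendsto (hT.prodMap hT)).trans_isBigO hbig
  have h2 : (fun q : ℂ × ℂ ↦ L' (boundaryChart ρ p q.1 - boundaryChart ρ p q.2 -
      h.chartDeriv (q.1 - q.2))) =o[𝓝[Ω] p ×ˢ 𝓝[Ω] p] fun q : ℂ × ℂ ↦ q.1 - q.2 :=
    (L'.isBigO_comp _ _).trans_isLittleO hstrict
  refine (h1.add h2).congr' ?_ .rfl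
  have hleft : ∀ᶠ z in 𝓝[Ω] p, h.chartInv (boundaryChart ρ p z) = z :=
    h.eventually_chartInv_boundaryChart.filter_mono nhdsWithin_le_nhds
  filter_upwards [prod_mem_prod hleft hleft] with q hq
  have e1 : h.chartInv (boundaryChart ρ p q.1) = q.1 := hq.1
  have e2 : h.chartInv (boundaryChart ρ p q.2) = q.2 := hq.2
  simp only [Function.comp_apply, Prod.map_fst, Prod.map_snd, e1, e2]
  rw [map_sub L' _ (h.chartDeriv (q.1 - q.2))]
  have : L' (h.chartDeriv (q.1 - q.2)) = L (q.1 - q.2) := by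
    simp [hL']
  rw [this]
  abel

/-- Passage to the boundary values of `isLittleO_of_tendsto_fderiv`. -/
theorem isLittleO_boundary {E : Type*} [NormedAddCommGroup E] [NormedSpace ℝ E]
    {f : ℂ → E} {L : ℂ →L[ℝ] E} {b : ℂ → E}
    (ho : (fun q : ℂ × ℂ ↦ f q.1 - f q.2 - L (q.1 - q.2)) =o[𝓝[Ω] p ×ˢ 𝓝[Ω] p]
      fun q : ℂ × ℂ ↦ q.1 - q.2)
    (hb : ∀ᶠ q in 𝓝[frontier Ω] p, Tendsto f (𝓝[Ω] q) (𝓝 (b q))) :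
    (fun q : ℂ × ℂ ↦ b q.1 - b q.2 - L (q.1 - q.2)) =o[𝓝[frontier Ω] p ×ˢ 𝓝[frontier Ω] p]
      fun q : ℂ × ℂ ↦ q.1 - q.2 := by
  rw [isLittleO_iff] at ho ⊢
  intro c hc
  obtain ⟨t, ht, hsub⟩ := Filter.mem_prod_same_iff.1 (ho hc)
  obtain ⟨O, hO, hpO, hOt⟩ := mem_nhdsWithin.1 ht
  have hmem : O ∩ frontier Ω ∈ 𝓝[frontier Ω] p :=
    inter_mem (mem_nhdsWithin_of_mem_nhds (hO.mem_nhds hpO)) self_mem_nhdsWithin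
  have hall := inter_mem hmem hb
  filter_upwards [prod_mem_prod hall hall] with q hq
  obtain ⟨⟨⟨h1, h2⟩, h3⟩, ⟨h4, h5⟩, h6⟩ := hq
  have n1 : (𝓝[Ω] q.1).NeBot := mem_closure_iff_nhdsWithin_neBot.1 (frontier_subset_closure h2)
  have n2 : (𝓝[Ω] q.2).NeBot := mem_closure_iff_nhdsWithin_neBot.1 (frontier_subset_closure h5)
  have t1 : Tendsto (fun z : ℂ × ℂ ↦ z.1) (𝓝[Ω] q.1 ×ˢ 𝓝[Ω] q.2) (𝓝 q.1) :=
    tendsto_fst.mono_right nhdsWithin_le_nhds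
  have t2 : Tendsto (fun z : ℂ × ℂ ↦ z.2) (𝓝[Ω] q.1 ×ˢ 𝓝[Ω] q.2) (𝓝 q.2) :=
    tendsto_snd.mono_right nhdsWithin_le_nhds
  have l1 : Tendsto (fun z : ℂ × ℂ ↦ ‖f z.1 - f z.2 - L (z.1 - z.2)‖) (𝓝[Ω] q.1 ×ˢ 𝓝[Ω] q.2)
      (𝓝 ‖b q.1 - b q.2 - L (q.1 - q.2)‖) :=
    (((Tendsto.comp h3 tendsto_fst).sub (Tendsto.comp h6 tendsto_snd)).sub
      ((L.continuous.tendsto _).comp (t1.sub t2))).norm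
  have l2 : Tendsto (fun z : ℂ × ℂ ↦ c * ‖z.1 - z.2‖) (𝓝[Ω] q.1 ×ˢ 𝓝[Ω] q.2)
      (𝓝 (c * ‖q.1 - q.2‖)) := (t1.sub t2).norm.const_mul c
  refine le_of_tendsto_of_tendsto l1 l2 ?_
  have m1 : O ∩ Ω ∈ 𝓝[Ω] q.1 :=
    inter_mem (mem_nhdsWithin_of_mem_nhds (hO.mem_nhds h1)) self_mem_nhdsWithin
  have m2 : O ∩ Ω ∈ 𝓝[Ω] q.2 :=
    inter_mem (mem_nhdsWithin_of_mem_nhds (hO.mem_nhds h4)) self_mem_nhdsWithin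
  filter_upwards [prod_mem_prod m1 m2] with z hz
  exact hsub ⟨hOt hz.1, hOt hz.2⟩

/-- The hypothesis bounds increments of `f` by a multiple of the distance, so `f` is Cauchy at `p`.
-/
theorem exists_tendsto_of_isLittleO {E : Type*} [NormedAddCommGroup E] [NormedSpace ℝ E]
    [CompleteSpace E] {f : ℂ → E} {L : ℂ →L[ℝ] E} (hp : p ∈ closure Ω)
    (ho : (fun q : ℂ × ℂ ↦ f q.1 - f q.2 - L (q.1 - q.2)) =o[𝓝[Ω] p ×ˢ 𝓝[Ω] p]
      fun q : ℂ × ℂ ↦ q.1 - q.2) : ∃ b, Tendsto f (𝓝[Ω] p) (𝓝 b) := by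
  have n1 : (𝓝[Ω] p).NeBot := mem_closure_iff_nhdsWithin_neBot.1 hp
  refine CompleteSpace.complete ((cauchy_map_iff).2 ⟨n1, ?_⟩)
  have hbig : (fun q : ℂ × ℂ ↦ f q.1 - f q.2) =O[𝓝[Ω] p ×ˢ 𝓝[Ω] p] fun q : ℂ × ℂ ↦ q.1 - q.2 :=
    (ho.isBigO.add (L.isBigO_comp (fun q : ℂ × ℂ ↦ q.1 - q.2) _)).congr_left fun q ↦ by
      simp
  have hz : Tendsto (fun q : ℂ × ℂ ↦ q.1 - q.2) (𝓝[Ω] p ×ˢ 𝓝[Ω] p) (𝓝 0) := by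
    have t1 : Tendsto (fun z : ℂ × ℂ ↦ z.1) (𝓝[Ω] p ×ˢ 𝓝[Ω] p) (𝓝 p) :=
      tendsto_fst.mono_right nhdsWithin_le_nhds
    have t2 : Tendsto (fun z : ℂ × ℂ ↦ z.2) (𝓝[Ω] p ×ˢ 𝓝[Ω] p) (𝓝 p) :=
      tendsto_snd.mono_right nhdsWithin_le_nhds
    simpa using t1.sub t2
  have := hbig.trans_tendsto hz
  rw [Metric.uniformity_basis_dist.tendsto_right_iff]
  intro ε hε
  filter_upwards [Metric.tendsto_nhds.1 this ε hε] with q hq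
  simpa [dist_eq_norm] using hq

end IsDefiningFunctionAt

end HeleShaw

/-! ### Tangential derivatives along the boundary curve -/

namespace HeleShaw
open Filter Set Metric ComplexConjugate Asymptotics

namespace IsDefiningFunctionAt

variable {Ω : Set ℂ} {p : ℂ} {ρ : ℂ → ℝ}

/-- The boundary curve through `p`. -/
noncomputable def boundaryCurve (h : IsDefiningFunctionAt Ω p ρ) (t : ℝ) : ℂ :=
  h.chartInv (boundaryChart ρ p p + t * Complex.I)

theorem tendsto_add_mul_I (y : ℂ) : Tendsto (fun t : ℝ ↦ y + t * Complex.I) (𝓝 0) (𝓝 y) := by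
  have : Continuous fun t : ℝ ↦ y + t * Complex.I := by fun_prop
  have := this.tendsto 0
  rwa [Complex.ofReal_zero, zero_mul, add_zero] at this

theorem boundaryCurve_zero (h : IsDefiningFunctionAt Ω p ρ) : h.boundaryCurve 0 = p := by
  rw [boundaryCurve, Complex.ofReal_zero, zero_mul, add_zero, h.chartInv_apply]

theorem tendsto_boundaryCurve (h : IsDefiningFunctionAt Ω p ρ) :
    Tendsto h.boundaryCurve (𝓝 0) (𝓝 p) :=
  h.tendsto_chartInv.comp (tendsto_add_mul_I _)

theorem eventually_boundaryCurve_mem (h : IsDefiningFunctionAt Ω p ρ) (hΩ : IsOpen Ω) :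
    ∀ᶠ t in 𝓝 0, h.boundaryCurve t ∈ frontier Ω := by
  filter_upwards [(tendsto_add_mul_I _).eventually (h.eventually_chartInv_mem_frontier hΩ)] with t ht
  exact ht (by simp [h.boundaryChart_self_re])

theorem mem_frontier (h : IsDefiningFunctionAt Ω p ρ) (hΩ : IsOpen Ω) : p ∈ frontier Ω := by
  have := (h.eventually_boundaryCurve_mem hΩ).self_of_nhds
  rwa [h.boundaryCurve_zero] at this

theorem hasDerivAt_boundaryCurve (h : IsDefiningFunctionAt Ω p ρ) :
    HasDerivAt h.boundaryCurve ((conj (gradient ρ p))⁻¹ * Complex.I) 0 := by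
  have h1 : HasDerivAt (fun t : ℝ ↦ boundaryChart ρ p p + t * Complex.I) (1 * Complex.I) 0 :=
    (((hasDerivAt_id (0 : ℝ)).ofReal_comp).mul_const Complex.I).const_add _
  have h2 : HasFDerivAt h.chartInv (h.chartDeriv.symm : ℂ →L[ℝ] ℂ)
      (boundaryChart ρ p p + ((0 : ℝ) : ℂ) * Complex.I) := by
    rw [Complex.ofReal_zero, zero_mul, add_zero]
    exact h.hasStrictFDerivAt_chartInv.hasFDerivAt
  have h3 := h2.comp_hasDerivAt (0 : ℝ) h1
  convert! h3 using 1
  simp [chartDeriv_symm_apply]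

theorem eventually_differentiableAt_boundaryCurve (h : IsDefiningFunctionAt Ω p ρ) :
    ∀ᶠ t in 𝓝 0, DifferentiableAt ℝ h.boundaryCurve t := by
  have hc : ∀ᶠ y in 𝓝 (boundaryChart ρ p p), DifferentiableAt ℝ h.chartInv y :=
    (h.contDiffAt_chartInv.eventually (by simp)).mono fun y hy ↦ hy.differentiableAt two_ne_zero
  filter_upwards [(tendsto_add_mul_I _).eventually hc] with t ht
  have : DifferentiableAt ℝ (fun t : ℝ ↦ boundaryChart ρ p p + t * Complex.I) t := by fun_prop
  exact ht.comp t this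

theorem continuousAt_gradient (h : IsDefiningFunctionAt Ω p ρ) : ContinuousAt (gradient ρ) p :=
  (InnerProductSpace.toDual ℝ ℂ).symm.continuous.continuousAt.comp
    (h.contDiffAt.fderiv_right (m := 1) (by norm_num)).continuousAt

/-- A defining function at `p` is one at all nearby boundary points. -/
theorem eventually (h : IsDefiningFunctionAt Ω p ρ) (hΩ : IsOpen Ω) :
    ∀ᶠ q in 𝓝 p, q ∈ frontier Ω → IsDefiningFunctionAt Ω q ρ := by
  filter_upwards [h.contDiffAt.eventually (by simp), h.mem_iff.eventually_nhds,
    h.continuousAt_gradient.eventually_ne h.gradient_ne_zero] with q h1 h2 h3 hq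
  rw [hΩ.frontier_eq] at hq
  refine ⟨h1, le_antisymm ?_ ?_, h3, h2⟩
  · have n1 : (𝓝[Ω] q).NeBot := mem_closure_iff_nhdsWithin_neBot.1 hq.1
    refine le_of_tendsto (h1.continuousAt.tendsto.mono_left (nhdsWithin_le_nhds (s := Ω))) ?_
    filter_upwards [h2.filter_mono nhdsWithin_le_nhds, self_mem_nhdsWithin] with z hz hzΩ
    exact (hz.1 hzΩ).le
  · by_contra! hlt
    exact hq.2 (h2.self_of_nhds.2 hlt)

theorem eventually_exists_boundaryCurve_eq (h : IsDefiningFunctionAt Ω p ρ) (hΩ : IsOpen Ω) {δ : ℝ}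
    (hδ : 0 < δ) : ∀ᶠ q in 𝓝[frontier Ω] p, ∃ t, |t| < δ ∧ h.boundaryCurve t = q := by
  have h1 : ContinuousAt (fun q ↦ (boundaryChart ρ p q - boundaryChart ρ p p).im) p :=
    Complex.continuous_im.continuousAt.comp
      (h.contDiffAt_boundaryChart.continuousAt.sub continuousAt_const)
  have h2 : ∀ᶠ q in 𝓝 p, |(boundaryChart ρ p q - boundaryChart ρ p p).im| < δ :=
    h1.abs.eventually (gt_mem_nhds (by simpa using hδ))
  filter_upwards [h2.filter_mono nhdsWithin_le_nhds,
    h.eventually_chartInv_boundaryChart.filter_mono nhdsWithin_le_nhds,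
    (h.eventually hΩ).filter_mono nhdsWithin_le_nhds, self_mem_nhdsWithin] with q h3 h4 h5 h6
  refine ⟨_, h3, ?_⟩
  rw [boundaryCurve]
  conv_rhs => rw [← h4]
  congr 1
  apply Complex.ext
  · simp [boundaryChart_re, h.eq_zero, (h5 h6).eq_zero]
  · simp

/-- If `f` vanishes on the boundary, its boundary derivative vanishes in the tangential direction. -/
theorem tangential_eq_zero {E : Type*} [NormedAddCommGroup E] [NormedSpace ℝ E]
    (h : IsDefiningFunctionAt Ω p ρ) (hΩ : IsOpen Ω) {f : ℂ → E} {L : ℂ →L[ℝ] E}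
    (hd : ∀ᶠ z in 𝓝[Ω] p, DifferentiableAt ℝ f z) (hL : Tendsto (fderiv ℝ f) (𝓝[Ω] p) (𝓝 L))
    (hb : ∀ᶠ q in 𝓝[frontier Ω] p, Tendsto f (𝓝[Ω] q) (𝓝 0)) :
    L (Complex.I * gradient ρ p) = 0 := by
  have ho := isLittleO_boundary (b := fun _ ↦ 0) (h.isLittleO_of_tendsto_fderiv hd hL) hb
  have hpf := h.mem_frontier hΩ
  have ht : Tendsto (fun t ↦ (h.boundaryCurve t, p)) (𝓝 0)
      (𝓝[frontier Ω] p ×ˢ 𝓝[frontier Ω] p) :=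
    (tendsto_nhdsWithin_iff.2 ⟨h.tendsto_boundaryCurve, h.eventually_boundaryCurve_mem hΩ⟩).prodMk
      (tendsto_const_pure.mono_right (pure_le_nhdsWithin hpf))
  have h1 := ho.comp_tendsto ht
  have hσ := h.hasDerivAt_boundaryCurve
  have hbig : (fun t ↦ h.boundaryCurve t - p) =O[𝓝 0] fun t : ℝ ↦ t := by
    have := hσ.isBigO_sub
    simpa [h.boundaryCurve_zero] using this
  have h2 : (fun t ↦ L (h.boundaryCurve t - p)) =o[𝓝 0] fun t : ℝ ↦ t := by
    have := h1.trans_isBigO hbig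
    refine (this.neg_left).congr_left fun t ↦ ?_
    simp
  have h3 : HasDerivAt (fun t ↦ L (h.boundaryCurve t)) 0 0 := by
    rw [hasDerivAt_iff_isLittleO]
    simpa [h.boundaryCurve_zero, ← map_sub] using h2
  have h4 : HasDerivAt (fun t ↦ L (h.boundaryCurve t))
      (L ((conj (gradient ρ p))⁻¹ * Complex.I)) 0 := L.hasFDerivAt.comp_hasDerivAt 0 hσ
  have h5 := h4.unique h3
  have hne := h.conj_gradient_ne_zero
  have h6 : Complex.I * gradient ρ p =
      Complex.normSq (gradient ρ p) • ((conj (gradient ρ p))⁻¹ * Complex.I) := by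
    rw [Complex.real_smul, ← Complex.mul_conj]
    field_simp
  rw [h6, map_smul, h5, smul_zero]

/-- If the boundary derivative vanishes in the tangential direction, the boundary values are locally
constant. -/
theorem boundary_eventuallyConst {E : Type*} [NormedAddCommGroup E] [NormedSpace ℝ E]
    (h : IsDefiningFunctionAt Ω p ρ) (hΩ : IsOpen Ω) {f b : ℂ → E} {L : ℂ → ℂ →L[ℝ] E}
    (hd : ∀ᶠ q in 𝓝[frontier Ω] p, ∀ᶠ z in 𝓝[Ω] q, DifferentiableAt ℝ f z)
    (hL : ∀ᶠ q in 𝓝[frontier Ω] p, Tendsto (fderiv ℝ f) (𝓝[Ω] q) (𝓝 (L q)))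
    (hb : ∀ᶠ q in 𝓝[frontier Ω] p, Tendsto f (𝓝[Ω] q) (𝓝 (b q)))
    (htan : ∀ᶠ q in 𝓝[frontier Ω] p, L q (Complex.I * gradient ρ q) = 0) :
    ∀ᶠ q in 𝓝[frontier Ω] p, b q = b p := by
  set σ := h.boundaryCurve with hσ
  have hσt : Tendsto σ (𝓝 0) (𝓝[frontier Ω] p) :=
    tendsto_nhdsWithin_iff.2 ⟨h.tendsto_boundaryCurve, h.eventually_boundaryCurve_mem hΩ⟩
  have hev : ∀ᶠ t in 𝓝 (0 : ℝ), HasDerivAt (fun t ↦ b (σ t)) 0 t := by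
    have hdef : ∀ᶠ q in 𝓝[frontier Ω] p, IsDefiningFunctionAt Ω q ρ := by
      filter_upwards [(h.eventually hΩ).filter_mono nhdsWithin_le_nhds, self_mem_nhdsWithin]
        with q h1 h2 using h1 h2
    have hbb : ∀ᶠ q in 𝓝[frontier Ω] p, ∀ᶠ q' in 𝓝[frontier Ω] q, Tendsto f (𝓝[Ω] q') (𝓝 (b q')) := by
      exact eventually_eventually_nhdsWithin.2 hb
    filter_upwards [hσt.eventually hd, hσt.eventually hL, hσt.eventually hbb, hσt.eventually htan,
      hσt.eventually hdef, (hσt.eventually hdef).eventually_nhds,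
      h.eventually_differentiableAt_boundaryCurve,
      (h.eventually_boundaryCurve_mem hΩ).eventually_nhds] with t h1 h2 h3 h4 h5 h6 h7 h8
    have ho := isLittleO_boundary (h5.isLittleO_of_tendsto_fderiv h1 h2) h3
    have hpf := h5.mem_frontier hΩ
    have ht : Tendsto (fun s ↦ (σ s, σ t)) (𝓝 t)
        (𝓝[frontier Ω] (σ t) ×ˢ 𝓝[frontier Ω] (σ t)) :=
      (tendsto_nhdsWithin_iff.2 ⟨h7.continuousAt.tendsto, h8⟩).prodMk
        (tendsto_const_pure.mono_right (pure_le_nhdsWithin hpf))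
    have hbig : (fun s ↦ σ s - σ t) =O[𝓝 t] fun s : ℝ ↦ s - t := h7.hasDerivAt.isBigO_sub
    have ho' := (ho.comp_tendsto ht).trans_isBigO hbig
    have hρ0 : HasDerivAt (fun s ↦ ρ (σ s)) 0 t := by
      refine (hasDerivAt_const t (0 : ℝ)).congr_of_eventuallyEq ?_
      filter_upwards [h6] with s hs using hs.eq_zero
    have hρ1 : HasDerivAt (fun s ↦ ρ (σ s)) (fderiv ℝ ρ (σ t) (deriv σ t)) t :=
      (h5.contDiffAt.differentiableAt two_ne_zero).hasFDerivAt.comp_hasDerivAt t h7.hasDerivAt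
    have horth := hρ1.unique hρ0
    rw [fderiv_eq_inner_gradient, Complex.inner] at horth
    set N := gradient ρ (σ t) with hN
    have hN0 : Complex.normSq N ≠ 0 := (Complex.normSq_pos.2 h5.gradient_ne_zero).ne'
    -- `ρ` vanishes along the curve, so the velocity is orthogonal to `N = ∇ρ` and is therefore a
    -- real multiple of `i N`.
    have hpar : deriv σ t = ((conj N * deriv σ t).im / Complex.normSq N) • (Complex.I * N) := by
      have e1 : conj N * deriv σ t = ((conj N * deriv σ t).im : ℂ) * Complex.I := by
        apply Complex.ext
        · rw [mul_comm, horth]; simp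
        · simp
      have e2 : (Complex.normSq N : ℂ) * deriv σ t = N * (conj N * deriv σ t) := by
        rw [← Complex.mul_conj]; ring
      rw [Complex.real_smul, Complex.ofReal_div]
      have e3 : (Complex.normSq N : ℂ) ≠ 0 := by exact_mod_cast hN0
      rw [e1] at e2
      field_simp
      rw [mul_comm, e2, mul_comm (conj N) (deriv σ t)]
      ring
    have hLσ : L (σ t) (deriv σ t) = 0 := by
      rw [hpar, map_smul, h4, smul_zero]
    have hfin : (fun s ↦ L (σ t) (σ s - σ t)) =o[𝓝 t] fun s : ℝ ↦ s - t := by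
      have : HasDerivAt (fun s ↦ L (σ t) (σ s)) 0 t := by
        rw [← hLσ]; exact (L (σ t)).hasFDerivAt.comp_hasDerivAt t h7.hasDerivAt
      simpa [hasDerivAt_iff_isLittleO, ← map_sub] using this
    rw [hasDerivAt_iff_isLittleO]
    refine (ho'.add hfin).congr_left fun s ↦ ?_
    simp
  obtain ⟨δ, hδ, hball⟩ := Metric.eventually_nhds_iff_ball.1 hev
  filter_upwards [h.eventually_exists_boundaryCurve_eq hΩ hδ] with q hq
  obtain ⟨t, ht, rfl⟩ := hq
  have hc := (convex_ball (0 : ℝ) δ).is_const_of_fderivWithin_eq_zero (𝕜 := ℝ)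
    (f := fun t ↦ b (σ t)) (x := t) (y := 0)
    (fun s hs ↦ (hball s hs).differentiableAt.differentiableWithinAt)
    (fun s hs ↦ by
      rw [fderivWithin_of_isOpen isOpen_ball hs, (hball s hs).hasFDerivAt.fderiv]
      ext
      simp)
    (by simpa using ht) (mem_ball_self hδ)
  simp only [hσ] at hc
  rwa [h.boundaryCurve_zero] at hc

/-- The outward unit normal does not depend on the defining function. -/
theorem normal_unique {ρ' : ℂ → ℝ} (h : IsDefiningFunctionAt Ω p ρ) (h' : IsDefiningFunctionAt Ω p ρ')
    (hΩ : IsOpen Ω) :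
    ‖gradient ρ p‖⁻¹ • gradient ρ p = ‖gradient ρ' p‖⁻¹ • gradient ρ' p := by
  have hd : ∀ᶠ z in 𝓝 p, DifferentiableAt ℝ ρ' z :=
    (h'.contDiffAt.eventually (by simp)).mono fun y hy ↦ hy.differentiableAt two_ne_zero
  have hL : Tendsto (fderiv ℝ ρ') (𝓝 p) (𝓝 (fderiv ℝ ρ' p)) :=
    (h'.contDiffAt.fderiv_right (m := 1) (by norm_num)).continuousAt.tendsto
  have hb : ∀ᶠ q in 𝓝[frontier Ω] p, Tendsto ρ' (𝓝[Ω] q) (𝓝 0) := by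
    filter_upwards [(h'.eventually hΩ).filter_mono nhdsWithin_le_nhds, self_mem_nhdsWithin]
      with q h1 h2
    have := (h1 h2).contDiffAt.continuousAt.tendsto
    rw [(h1 h2).eq_zero] at this
    exact this.mono_left nhdsWithin_le_nhds
  -- `ρ'` itself vanishes on the boundary, so its gradient has no tangential part and is a real
  -- multiple of that of `ρ`.
  have htan := h.tangential_eq_zero hΩ (hd.filter_mono nhdsWithin_le_nhds)
    (hL.mono_left nhdsWithin_le_nhds) hb
  set N := gradient ρ p with hN
  set N' := gradient ρ' p with hN'
  rw [fderiv_eq_inner_gradient, ← hN', Complex.inner] at htan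
  have hNpos : 0 < Complex.normSq N := Complex.normSq_pos.2 h.gradient_ne_zero
  have hNc : (Complex.normSq N : ℂ) ≠ 0 := by exact_mod_cast hNpos.ne'
  set r := (conj N * N').re with hr
  have hpar : (Complex.normSq N : ℂ) * N' = (r : ℂ) * N := by
    have e1 : conj N * N' = (r : ℂ) := by
      apply Complex.ext
      · simp [hr]
      · simp only [Complex.mul_re, Complex.mul_im, Complex.I_re, Complex.I_im, Complex.conj_re,
          Complex.conj_im, Complex.ofReal_im] at htan ⊢
        linarith
    rw [← e1, ← Complex.mul_conj]; ring
  -- With a negative multiple, `ρ'` would become positive along `p - s N` while `ρ` becomes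
  -- negative, yet both are negative exactly on `Ω` near `p`.
  have hrpos : 0 < r := by
    have hr0 : r ≠ 0 := by
      intro h0
      rw [h0, Complex.ofReal_zero, zero_mul] at hpar
      rcases mul_eq_zero.1 hpar with h1 | h1
      · exact hNc h1
      · exact h'.gradient_ne_zero h1
    refine lt_of_le_of_ne ?_ hr0.symm
    have hline : HasDerivAt (fun s : ℝ ↦ p - s * N) (-N) 0 := by
      have := (((hasDerivAt_id (0 : ℝ)).ofReal_comp).mul_const N).const_sub p
      simpa using this
    have hl0 : p - ((0 : ℝ) : ℂ) * N = p := by simp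
    have hdρ : ∀ {τ : ℂ → ℝ}, IsDefiningFunctionAt Ω p τ →
        HasDerivAt (fun s : ℝ ↦ τ (p - s * N)) (-(inner ℝ (gradient τ p) N)) 0 := by
      intro τ hτ
      have h1 : HasFDerivAt τ (fderiv ℝ τ p) (p - ((0 : ℝ) : ℂ) * N) := by
        rw [hl0]; exact (hτ.contDiffAt.differentiableAt two_ne_zero).hasFDerivAt
      have := h1.comp_hasDerivAt (0 : ℝ) hline
      rw [map_neg, fderiv_eq_inner_gradient] at this
      exact this
    have hlt : Tendsto (fun s : ℝ ↦ p - s * N) (𝓝 0) (𝓝 p) := by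
      have := hline.continuousAt.tendsto
      rwa [hl0] at this
    by_contra! hneg
    have h1 := hdρ h
    have h2 := hdρ h'
    have i1 : -(inner ℝ (gradient ρ p) N) < 0 := by
      rw [← hN, real_inner_self_eq_norm_sq]
      have := norm_pos_iff.2 h.gradient_ne_zero
      have : 0 < ‖N‖ := this
      nlinarith
    have i2 : 0 < -(inner ℝ (gradient ρ' p) N) := by
      have : inner ℝ N' N = r := by
        rw [hr, Complex.inner, Complex.mul_re, Complex.mul_re]; simp
      rw [← hN', this]; linarith
    have s1 := (hasDerivAt_iff_tendsto_slope_zero.1 h1).eventually (gt_mem_nhds i1)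
    have s2 := (hasDerivAt_iff_tendsto_slope_zero.1 h2).eventually (lt_mem_nhds i2)
    have m1 := (hlt.eventually h.mem_iff).filter_mono (nhdsWithin_le_nhds (s := Ioi 0))
    have m2 := (hlt.eventually h'.mem_iff).filter_mono (nhdsWithin_le_nhds (s := Ioi 0))
    have hsub : 𝓝[>] (0 : ℝ) ≤ 𝓝[≠] 0 := nhdsWithin_mono _ fun x hx ↦ ne_of_gt hx
    obtain ⟨s, a1, a2, a3, a4, a5⟩ := ((s1.filter_mono hsub).and ((s2.filter_mono hsub).and
      (m1.and (m2.and self_mem_nhdsWithin)))).exists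
    have hs : 0 < s := a5
    simp only [zero_add, hl0, h.eq_zero, h'.eq_zero, sub_zero, smul_eq_mul] at a1 a2
    have b1 : ρ (p - s * N) < 0 := by
      by_contra! hh
      exact absurd a1 (not_lt.2 (mul_nonneg (inv_pos.2 hs).le hh))
    have b2 : 0 < ρ' (p - s * N) := by
      by_contra! hh
      exact absurd a2 (not_lt.2 (mul_nonpos_of_nonneg_of_nonpos (inv_pos.2 hs).le hh))
    exact absurd (a4.1 (a3.2 b1)) (not_lt.2 b2.le)
  have hk : N' = (r / Complex.normSq N) • N := by
    rw [Complex.real_smul, Complex.ofReal_div]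
    field_simp
    linear_combination hpar
  have hkpos : 0 < r / Complex.normSq N := div_pos hrpos hNpos
  have hNn : 0 < ‖N‖ := norm_pos_iff.2 h.gradient_ne_zero
  rw [hk, norm_smul, Real.norm_of_nonneg hkpos.le, smul_smul]
  congr 1
  field_simp

end IsDefiningFunctionAt

/-- If the boundary derivative of `f` vanishes in all tangential directions along a connected
boundary arc, the boundary values of `f` are constant there. -/
theorem exists_boundary_const {E : Type*} [NormedAddCommGroup E] [NormedSpace ℝ E] [CompleteSpace E]
    {Ω V : Set ℂ} (hΩ : IsOpen Ω) (hV : IsOpen V) (hpre : IsPreconnected (frontier Ω ∩ V))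
    (hsm : ∀ p ∈ frontier Ω ∩ V, ∃ ρ, IsDefiningFunctionAt Ω p ρ) {f : ℂ → E} {L : ℂ → ℂ →L[ℝ] E}
    (hd : ∀ z ∈ Ω ∩ V, DifferentiableAt ℝ f z)
    (hL : ∀ p ∈ frontier Ω ∩ V, Tendsto (fderiv ℝ f) (𝓝[Ω] p) (𝓝 (L p)))
    (htan : ∀ p ∈ frontier Ω ∩ V, ∀ n, IsOutwardUnitNormal Ω p n → L p (Complex.I * n) = 0) :
    ∃ k, ∀ p ∈ frontier Ω ∩ V, Tendsto f (𝓝[Ω] p) (𝓝 k) := by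
  have hdd : ∀ p ∈ frontier Ω ∩ V, ∀ᶠ z in 𝓝[Ω] p, DifferentiableAt ℝ f z := fun p hp ↦ by
    filter_upwards [mem_nhdsWithin_of_mem_nhds (hV.mem_nhds hp.2), self_mem_nhdsWithin] with z h1 h2
    exact hd z ⟨h2, h1⟩
  have hex : ∀ p, ∃ c, p ∈ frontier Ω ∩ V → Tendsto f (𝓝[Ω] p) (𝓝 c) := by
    intro p
    by_cases hp : p ∈ frontier Ω ∩ V
    · obtain ⟨ρ, hρ⟩ := hsm p hp
      obtain ⟨c, hc⟩ := IsDefiningFunctionAt.exists_tendsto_of_isLittleO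
        (frontier_subset_closure hp.1) (hρ.isLittleO_of_tendsto_fderiv (hdd p hp) (hL p hp))
      exact ⟨c, fun _ ↦ hc⟩
    · exact ⟨0, fun h ↦ absurd h hp⟩
  choose b hb using hex
  rcases (frontier Ω ∩ V).eq_empty_or_nonempty with hemp | ⟨p₀, hp₀⟩
  · exact ⟨0, fun p hp ↦ by rw [hemp] at hp; exact absurd hp (notMem_empty p)⟩
  refine ⟨b p₀, fun p hp ↦ ?_⟩
  have heq : b p = b p₀ := by
    -- Boundary values are locally constant, and the arc is preconnected.
    refine hpre.induction₂ (fun x y ↦ b x = b y) (fun x hx ↦ ?_)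
      (fun _ _ _ _ _ _ h1 h2 ↦ h1.trans h2) (fun _ _ _ _ h ↦ h.symm) hp hp₀
    obtain ⟨ρ, hρ⟩ := hsm x hx
    have hmem : ∀ᶠ q in 𝓝[frontier Ω] x, q ∈ frontier Ω ∩ V := by
      filter_upwards [mem_nhdsWithin_of_mem_nhds (hV.mem_nhds hx.2), self_mem_nhdsWithin]
        with q h1 h2 using ⟨h2, h1⟩
    have := hρ.boundary_eventuallyConst hΩ (f := f) (b := b) (L := L)
      (hmem.mono fun q hq ↦ hdd q hq) (hmem.mono fun q hq ↦ hL q hq)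
      (hmem.mono fun q hq ↦ hb q hq) (by
        filter_upwards [hmem, (hρ.eventually hΩ).filter_mono nhdsWithin_le_nhds] with q h1 h2
        have hq := h2 h1.1
        have h3 := htan q h1 _ ⟨ρ, hq, rfl⟩
        rw [mul_smul_comm, map_smul] at h3
        exact (smul_eq_zero.1 h3).resolve_left
          (inv_ne_zero (norm_ne_zero_iff.2 hq.gradient_ne_zero)))
    filter_upwards [this.filter_mono (nhdsWithin_mono x inter_subset_left)] with q hq
    exact hq.symm
  rw [← heq]
  exact hb p hp

end HeleShaw

namespace HeleShaw
open Filter Set Metric ComplexConjugate Asymptotics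

/-! ### The complex arctangent near the closed unit disk -/

theorem one_add_sq_eq (w : ℂ) :
    1 + w ^ 2 = (1 + w * Complex.I) * (1 - w * Complex.I) := by
  linear_combination w ^ 2 * Complex.I_sq

theorem arctan_ratio_re (w : ℂ) : ((1 + w * Complex.I) / (1 - w * Complex.I)).re =
    (1 - ‖w‖ ^ 2) / Complex.normSq (1 - w * Complex.I) := by
  rw [Complex.div_re, ← Complex.normSq_eq_norm_sq, Complex.normSq_apply w, ← add_div]
  congr 1
  simp
  ring

theorem arctan_ratio_im (w : ℂ) : ((1 + w * Complex.I) / (1 - w * Complex.I)).im =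
    2 * w.re / Complex.normSq (1 - w * Complex.I) := by
  rw [Complex.div_im, ← sub_div]
  congr 1
  simp
  ring

/-- The ratio has real part with the sign of `1 - ‖w‖²` and imaginary part with the sign of `Re w`,
so under either hypothesis the logarithm in `Complex.arctan` is off its cut. -/
theorem arctan_ratio_mem_slitPlane {w : ℂ} (h0 : 1 + w ^ 2 ≠ 0) (hw : ‖w‖ < 1 ∨ w.re ≠ 0) :
    (1 + w * Complex.I) / (1 - w * Complex.I) ∈ Complex.slitPlane := by
  rw [one_add_sq_eq] at h0
  have h2 := Complex.normSq_pos.2 (right_ne_zero_of_mul h0)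
  rw [Complex.mem_slitPlane_iff, arctan_ratio_re, arctan_ratio_im]
  rcases hw with hw | hw
  · exact .inl (div_pos (by nlinarith [norm_nonneg w]) h2)
  · exact .inr (div_ne_zero (by simpa using hw) h2.ne')

theorem hasDerivAt_arctan {w : ℂ} (h0 : 1 + w ^ 2 ≠ 0) (hw : ‖w‖ < 1 ∨ w.re ≠ 0) :
    HasDerivAt Complex.arctan (1 + w ^ 2)⁻¹ w := by
  have hs := arctan_ratio_mem_slitPlane h0 hw
  rw [one_add_sq_eq] at h0 ⊢
  have h1 := left_ne_zero_of_mul h0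
  have h2 := right_ne_zero_of_mul h0
  have d1 : HasDerivAt (fun w : ℂ ↦ 1 + w * Complex.I) (1 * Complex.I) w :=
    ((hasDerivAt_id w).mul_const Complex.I).const_add 1
  have d2 : HasDerivAt (fun w : ℂ ↦ 1 - w * Complex.I) (-(1 * Complex.I)) w :=
    ((hasDerivAt_id w).mul_const Complex.I).const_sub 1
  have := (((d1.div d2 h2).clog hs).const_mul (-Complex.I / 2))
  refine this.congr_deriv ?_
  simp only [Pi.div_apply]
  field_simp
  rw [Complex.I_sq]
  ring

theorem eq_or_eq_neg_I_of_sq {w : ℂ} (hw : w ^ 2 = -1) : w = Complex.I ∨ w = -Complex.I := by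
  rw [← sq_eq_sq_iff_eq_or_eq_neg, hw, Complex.I_sq]

theorem one_add_sq_ne_zero_of_re_pos {w : ℂ} (hw : 0 < w.re) : 1 + w ^ 2 ≠ 0 := fun h ↦ by
  rcases eq_or_eq_neg_I_of_sq (eq_neg_of_add_eq_zero_right h) with h | h <;> simp [h] at hw

theorem one_add_sq_ne_zero_of_norm_lt {w : ℂ} (hw : ‖w‖ < 1) : 1 + w ^ 2 ≠ 0 := fun h ↦ by
  have : ‖w ^ 2‖ = 1 := by rw [eq_neg_of_add_eq_zero_right h, norm_neg, norm_one]
  rw [norm_pow] at this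
  nlinarith [norm_nonneg w]

/-- Negating `w` inverts the ratio, and `log` respects inversion off the negative axis; for `‖w‖ ≤
1` the real part of the ratio is nonnegative. -/
theorem arctan_neg_of_norm_le {w : ℂ} (hw : ‖w‖ ≤ 1) :
    Complex.arctan (-w) = -Complex.arctan w := by
  have hinv : (1 + -w * Complex.I) / (1 - -w * Complex.I) =
      ((1 + w * Complex.I) / (1 - w * Complex.I))⁻¹ := by
    rw [inv_div]; ring_nf
  rw [Complex.arctan, Complex.arctan, hinv, Complex.log_inv, mul_neg]
  rw [Ne, Complex.arg_eq_pi_iff, not_and_or, arctan_ratio_re]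
  exact .inl (not_lt.2 (div_nonneg (by nlinarith [norm_nonneg w]) (Complex.normSq_nonneg _)))

/-- The map `killingMap` as a function of the square root of its argument. -/
noncomputable def killingMapSqrt (w : ℂ) : ℂ :=
  15 / 32 * (1 + w ^ 2) ^ 2 * ((w ^ 2)⁻¹ - (1 - w ^ 2) * (w ^ 3)⁻¹ * Complex.arctan w) - 5 / 8

theorem killingMap_zero : killingMap 0 = 0 := if_pos rfl

theorem killingMap_eq {z : ℂ} (hz : z ≠ 0) : killingMap z = killingMapSqrt (z ^ (1 / 2 : ℂ)) := by
  have h : z ^ (-(3 / 2) : ℂ) = ((z ^ (1 / 2 : ℂ)) ^ 3)⁻¹ := by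
    rw [Complex.cpow_neg, show (3 / 2 : ℂ) = (1 / 2 : ℂ) * (3 : ℕ) by norm_num,
      Complex.cpow_mul_nat]
  rw [killingMap, if_neg hz, killingMapSqrt, cpow_half_sq, h]

theorem killingMapSqrt_neg {w : ℂ} (hw : ‖w‖ ≤ 1) : killingMapSqrt (-w) = killingMapSqrt w := by
  rw [killingMapSqrt, killingMapSqrt, arctan_neg_of_norm_le hw, neg_sq,
    show (-w) ^ 3 = -w ^ 3 by ring, inv_neg]
  ring

/-- The expression is even in the root, so on the closed disk either square root may be used. This
matters on the negative axis and at the cusp. -/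
theorem killingMap_sq {w : ℂ} (hw : ‖w‖ ≤ 1) (h0 : w ≠ 0) :
    killingMap (w ^ 2) = killingMapSqrt w := by
  rw [killingMap_eq (pow_ne_zero 2 h0)]
  rcases sq_eq_sq_iff_eq_or_eq_neg.1 (cpow_half_sq (w ^ 2)) with h | h
  · rw [h]
  · rw [h, killingMapSqrt_neg hw]

theorem killingMap_sq_of_re_pos {w : ℂ} (hw : 0 < w.re) :
    killingMap (w ^ 2) = killingMapSqrt w := by
  rw [killingMap_eq (Complex.slitPlane_ne_zero (sq_mem_slitPlane hw)), sq_cpow_half hw]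

theorem killingMap_neg_one : killingMap (-1) = -5 / 8 := by
  rw [killingMap, if_neg (by norm_num)]
  norm_num

/-- The derivative of `killingMapSqrt` along the Euler field. -/
theorem hasDerivAt_killingMapSqrt {w : ℂ} (hw0 : w ≠ 0) (h1 : 1 + w ^ 2 ≠ 0)
    (hw : ‖w‖ < 1 ∨ w.re ≠ 0) :
    HasDerivAt killingMapSqrt (15 / 32 * (1 + w ^ 2) / w ^ 2 * (-3 * (1 - w ^ 2) / w +
      (2 * (1 - w ^ 2) ^ 2 + (1 + w ^ 2) ^ 2) / w ^ 2 * Complex.arctan w)) w := by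
  have hT := hasDerivAt_arctan h1 hw
  have p2 := hasDerivAt_pow 2 w
  have p3 := hasDerivAt_pow 3 w
  have := ((((p2.const_add 1).pow 2).const_mul (15 / 32 : ℂ)).mul
    ((p2.inv (pow_ne_zero 2 hw0)).sub (((p2.const_sub 1).mul (p3.inv (pow_ne_zero 3 hw0))).mul
      hT))).sub_const (5 / 8)
  refine this.congr_deriv ?_
  simp only [Pi.mul_apply, Pi.inv_apply, Pi.sub_apply, Pi.pow_apply]
  field_simp
  ring

/-- There is no bound on `‖w‖`: the map continues holomorphically to the slit plane, hence across
every point of the circle except `-1`. -/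
theorem hasDerivAt_killingMap {w : ℂ} (hw : 0 < w.re) :
    HasDerivAt killingMap (15 / 64 * (1 + w ^ 2) / w ^ 3 * (-3 * (1 - w ^ 2) / w +
      (2 * (1 - w ^ 2) ^ 2 + (1 + w ^ 2) ^ 2) / w ^ 2 * Complex.arctan w)) (w ^ 2) := by
  have hw0 : w ≠ 0 := by rintro rfl; exact lt_irrefl _ hw
  have hz := sq_mem_slitPlane hw
  have h1 : HasDerivAt (fun z : ℂ ↦ z ^ (1 / 2 : ℂ)) (1 / (2 * (w ^ 2) ^ (1 / 2 : ℂ))) (w ^ 2) :=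
    hasDerivAt_of_sq_eq (continuousAt_cpow_const hz) cpow_half_sq (hasDerivAt_id _)
      (by rwa [sq_cpow_half hw])
  rw [sq_cpow_half hw] at h1
  have h3 := (hasDerivAt_killingMapSqrt hw0
    (one_add_sq_ne_zero_of_re_pos hw) (.inr hw.ne')).comp_of_eq (w ^ 2) h1 (sq_cpow_half hw).symm
  refine (h3.congr_of_eventuallyEq ?_).congr_deriv ?_
  · filter_upwards [isOpen_ne.mem_nhds (Complex.slitPlane_ne_zero hz)] with z h0
    exact killingMap_eq h0
  · field_simp
    ring

theorem differentiableAt_killingMap {z : ℂ} (hz : z ∈ Complex.slitPlane) :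
    DifferentiableAt ℂ killingMap z := by
  have := hasDerivAt_killingMap (cpow_half_re_pos hz)
  rw [cpow_half_sq] at this
  exact this.differentiableAt

/-! ### The power series -/

/-- The numbers `1 / (2 n - 1) + 1 / (2 n + 1)`. -/
noncomputable def oddRecipSum (n : ℕ) : ℂ := 4 * n / (4 * (n : ℂ) ^ 2 - 1)

/-- The Taylor coefficients of `killingMap`, up to sign. -/
noncomputable def killingCoeff (k : ℕ) : ℂ :=
  15 / 16 * ((k : ℂ) / (((k : ℂ) ^ 2 - 1 / 4) * ((k : ℂ) ^ 2 - 9 / 4)))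

theorem two_mul_natCast_add_ne (n : ℕ) (m : ℤ) (hm : m % 2 = 1) : (2 * (n : ℂ) + m) ≠ 0 := by
  have : (2 * (n : ℤ) + m) ≠ 0 := by omega
  exact_mod_cast this

theorem four_mul_sq_sub_one_ne_zero (n : ℕ) : 4 * (n : ℂ) ^ 2 - 1 ≠ 0 := by
  have h1 := two_mul_natCast_add_ne n 1 (by norm_num)
  have h2 := two_mul_natCast_add_ne n (-1) (by norm_num)
  push_cast at h1 h2
  have := mul_ne_zero h1 h2
  intro h
  apply this
  linear_combination h

theorem four_mul_sq_sub_nine_ne_zero (n : ℕ) : 4 * (n : ℂ) ^ 2 - 9 ≠ 0 := by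
  have h1 := two_mul_natCast_add_ne n 3 (by norm_num)
  have h2 := two_mul_natCast_add_ne n (-3) (by norm_num)
  push_cast at h1 h2
  have := mul_ne_zero h1 h2
  intro h
  apply this
  linear_combination h

theorem killingCoeff_eq (k : ℕ) :
    killingCoeff k = 15 * k / ((4 * (k : ℂ) ^ 2 - 1) * (4 * (k : ℂ) ^ 2 - 9)) := by
  have h1 := four_mul_sq_sub_one_ne_zero k
  have h2 := four_mul_sq_sub_nine_ne_zero k
  have h3 : (k : ℂ) ^ 2 - 1 / 4 ≠ 0 := fun h ↦ h1 (by linear_combination 4 * h)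
  have h4 : (k : ℂ) ^ 2 - 9 / 4 ≠ 0 := fun h ↦ h2 (by linear_combination 4 * h)
  rw [killingCoeff, ← mul_div_assoc, div_eq_div_iff (mul_ne_zero h3 h4) (mul_ne_zero h1 h2)]
  ring

theorem hasSum_shift {f g : ℕ → ℂ} {S : ℂ} (h : HasSum f S) (h0 : g 0 = 0)
    (hs : ∀ n, g (n + 1) = f n) : HasSum g S := by
  have := (hasSum_nat_add_iff (f := g) (g := S) 1).1 (by simpa only [hs] using h)
  simpa [h0] using this

/-- Multiplying the series of `arctan w / w` by `1 - w²` gives the coefficients `1 / (2n + 1) + 1 /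
(2n - 1)` for `n ≥ 1`. The constant term `1` is removed. -/
theorem hasSum_oddRecipSum {w : ℂ} (hw : ‖w‖ < 1) (h0 : w ≠ 0) :
    HasSum (fun n ↦ oddRecipSum n * (-w ^ 2) ^ n) ((1 - w ^ 2) * Complex.arctan w / w - 1) := by
  have hA : HasSum (fun n : ℕ ↦ (-w ^ 2) ^ n / (2 * n + 1)) (Complex.arctan w / w) := by
    have := (Complex.hasSum_arctan hw).div_const w
    refine this.congr_fun fun n ↦ ?_
    rw [pow_succ w (2 * n), pow_mul, neg_pow (w ^ 2)]
    push_cast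
    field_simp
  have hB : HasSum (fun n : ℕ ↦ if n = 0 then 0 else (-w ^ 2) ^ n / (2 * (n : ℂ) - 1))
      (-w ^ 2 * (Complex.arctan w / w)) := by
    refine hasSum_shift (hA.mul_left (-w ^ 2)) (if_pos rfl) fun n ↦ ?_
    rw [if_neg n.succ_ne_zero, pow_succ]
    push_cast
    ring
  have hC := (hA.add hB).sub (hasSum_ite_eq (0 : ℕ) (1 : ℂ))
  convert! hC using 1
  · ext n
    rcases eq_or_ne n 0 with rfl | hn
    · simp [oddRecipSum]
    · rw [if_neg hn, if_neg hn, oddRecipSum]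
      have h1 := two_mul_natCast_add_ne n 1 (by norm_num)
      have h2 := two_mul_natCast_add_ne n (-1) (by norm_num)
      push_cast at h1 h2
      have h3 := four_mul_sq_sub_one_ne_zero n
      rw [← sub_eq_add_neg] at h2
      rw [sub_zero, div_add_div _ _ h1 h2, div_mul_eq_mul_div, div_eq_div_iff h3 (mul_ne_zero h1 h2)]
      ring
  · ring

/-- With `S` the sum of the previous lemma the bracket in `killingMap` is `-S / ζ`, and `(1 + ζ)²`
turns it into `S / (-ζ) - 2 S - ζ S`, a second difference of the `oddRecipSum n`. The constant term
`(15/32)(4/3) = 5/8` is what the final `- 5/8` cancels. -/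
theorem hasSum_killingMap {ζ : ℂ} (hζ : ‖ζ‖ < 1) :
    HasSum (fun k ↦ killingCoeff k * (-ζ) ^ k) (killingMap ζ) := by
  rcases eq_or_ne ζ 0 with rfl | h0
  · rw [killingMap_zero]
    have : HasSum (fun _ : ℕ ↦ (0 : ℂ)) 0 := hasSum_zero
    refine this.congr_fun fun k ↦ ?_
    rcases eq_or_ne k 0 with rfl | hk
    · simp [killingCoeff]
    · simp [hk]
  set w := ζ ^ (1 / 2 : ℂ) with hw
  have hw2 : w ^ 2 = ζ := cpow_half_sq ζ
  have hw0 : w ≠ 0 := fun h ↦ h0 (by rw [← hw2, h]; simp)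
  have hw1 : ‖w‖ < 1 := by
    rw [← hw2, norm_pow] at hζ
    nlinarith [norm_nonneg w]
  have hS := hasSum_oddRecipSum hw1 hw0
  rw [hw2] at hS
  set S := (1 - ζ) * Complex.arctan w / w - 1 with hSdef
  have hS1 : HasSum (fun n ↦ oddRecipSum (n + 1) * (-ζ) ^ n) (S / (-ζ)) := by
    have := ((hasSum_nat_add_iff' 1).2 hS).div_const (-ζ)
    simp only [Finset.range_one, Finset.sum_singleton] at this
    rw [show oddRecipSum 0 = 0 by simp [oddRecipSum], zero_mul, sub_zero] at this
    refine this.congr_fun fun n ↦ ?_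
    rw [pow_succ]
    field_simp
  have hS2 : HasSum (fun n : ℕ ↦ if n = 0 then 0 else oddRecipSum (n - 1) * (-ζ) ^ n)
      (-ζ * S) := by
    refine hasSum_shift (hS.mul_left (-ζ)) (if_pos rfl) fun n ↦ ?_
    rw [if_neg n.succ_ne_zero, pow_succ, Nat.add_sub_cancel]
    ring
  have h := (((hS1.sub (hS.mul_left 2)).add hS2).mul_left (15 / 32)).sub
    (hasSum_ite_eq (0 : ℕ) (5 / 8 : ℂ))
  convert! h using 1
  · ext n
    rcases n with _ | n
    · norm_num [killingCoeff, oddRecipSum]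
    · rw [if_neg n.succ_ne_zero, if_neg n.succ_ne_zero, Nat.add_sub_cancel, sub_zero,
        ← mul_assoc 2, ← sub_mul, ← add_mul, ← mul_assoc, killingCoeff_eq]
      congr 1
      simp only [oddRecipSum]
      have h1 := two_mul_natCast_add_ne n 1 (by norm_num)
      have h2 := two_mul_natCast_add_ne n (-1) (by norm_num)
      have h3 := two_mul_natCast_add_ne n 3 (by norm_num)
      have h5 := two_mul_natCast_add_ne n 5 (by norm_num)
      push_cast at h1 h2 h3 h5 ⊢
      rw [← sub_eq_add_neg] at h2
      rw [show 4 * ((n : ℂ) + 1) ^ 2 - 1 = (2 * n + 1) * (2 * n + 3) by ring,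
        show 4 * ((n : ℂ) + 1) ^ 2 - 9 = (2 * n - 1) * (2 * n + 5) by ring,
        show 4 * ((n : ℂ) + 1 + 1) ^ 2 - 1 = (2 * n + 3) * (2 * n + 5) by ring,
        show 4 * (n : ℂ) ^ 2 - 1 = (2 * n - 1) * (2 * n + 1) by ring]
      rw [mul_comm 2] at h1 h2 h3 h5
      field_simp
      ring
  · rw [killingMap_eq h0, killingMapSqrt, ← hw, hw2, show w ^ 3 = ζ * w by rw [← hw2]; ring, hSdef]
    field_simp
    ring

/-- The coefficients decay like `k⁻³`; the weaker summable bound is enough for termwise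
differentiation. At `k = 0` both sides are zero, since `0⁻¹ = 0`. -/
theorem norm_killingCoeff_mul_le (k : ℕ) {ζ : ℂ} (hζ : ζ ∈ ball (0 : ℂ) 1) :
    ‖killingCoeff k * (-ζ) ^ k‖ ≤ 15 * ((k : ℝ) ^ 2)⁻¹ := by
  rw [mem_ball_zero_iff] at hζ
  have h1 : ‖(-ζ) ^ k‖ ≤ 1 := by
    rw [norm_pow, norm_neg]
    exact pow_le_one₀ (norm_nonneg _) hζ.le
  have h2 : ‖killingCoeff k‖ ≤ 15 * ((k : ℝ) ^ 2)⁻¹ := by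
    have : killingCoeff k = ((15 * k / ((4 * (k : ℝ) ^ 2 - 1) * (4 * (k : ℝ) ^ 2 - 9)) : ℝ) : ℂ) := by
      rw [killingCoeff_eq]; push_cast; rfl
    rw [this, Complex.norm_real, Real.norm_eq_abs]
    rcases k with _ | _ | k
    · simp
    · norm_num
    · have hk : (2 : ℝ) ≤ ((k + 1 + 1 : ℕ) : ℝ) := by push_cast; linarith [(k.cast_nonneg : (0 : ℝ) ≤ k)]
      set x : ℝ := ((k + 1 + 1 : ℕ) : ℝ)
      have e1 : 3 * x ^ 2 ≤ 4 * x ^ 2 - 1 := by nlinarith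
      have e3 : x ≤ 4 * x ^ 2 - 9 := by nlinarith
      have e4 : 0 < x := by linarith
      rw [abs_of_nonneg (by apply div_nonneg (by positivity); apply mul_nonneg <;> nlinarith),
        ← div_eq_mul_inv, div_le_div_iff₀ (by apply mul_pos <;> nlinarith) (by positivity)]
      nlinarith [mul_le_mul e1 e3 e4.le (by nlinarith), pow_pos e4 3]
  rw [norm_mul]
  calc _ ≤ ‖killingCoeff k‖ * 1 := by gcongr
    _ ≤ _ := by rwa [mul_one]

theorem summable_majorant : Summable fun k : ℕ ↦ 15 * ((k : ℝ) ^ 2)⁻¹ :=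
  (Real.summable_nat_pow_inv.2 one_lt_two).mul_left 15

theorem differentiable_killingCoeff_mul (k : ℕ) :
    DifferentiableOn ℂ (fun ζ : ℂ ↦ killingCoeff k * (-ζ) ^ k) (ball 0 1) := by fun_prop

theorem killingMap_eq_tsum {ζ : ℂ} (hζ : ζ ∈ ball (0 : ℂ) 1) :
    killingMap ζ = ∑' k, killingCoeff k * (-ζ) ^ k :=
  (hasSum_killingMap (mem_ball_zero_iff.1 hζ)).tsum_eq.symm

theorem differentiableOn_killingMap : DifferentiableOn ℂ killingMap (ball 0 1) :=
  (Complex.differentiableOn_tsum_of_summable_norm summable_majorant differentiable_killingCoeff_mul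
    isOpen_ball fun k _ hζ ↦ norm_killingCoeff_mul_le k hζ).congr fun _ hζ ↦ killingMap_eq_tsum hζ

theorem deriv_killingMap_zero : deriv killingMap 0 = 1 := by
  have h0 : (0 : ℂ) ∈ ball (0 : ℂ) 1 := mem_ball_self one_pos
  have h := Complex.hasSum_deriv_of_summable_norm summable_majorant differentiable_killingCoeff_mul
    isOpen_ball (fun k _ hζ ↦ norm_killingCoeff_mul_le k hζ) h0
  have he : (fun ζ ↦ ∑' k, killingCoeff k * (-ζ) ^ k) =ᶠ[𝓝 0] killingMap := by
    filter_upwards [isOpen_ball.mem_nhds h0] with ζ hζ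
    exact (killingMap_eq_tsum hζ).symm
  rw [he.deriv_eq] at h
  refine h.unique ?_
  have h1 : ∀ k, deriv (fun ζ : ℂ ↦ killingCoeff k * (-ζ) ^ k) 0 = if k = 1 then 1 else 0 := by
    intro k
    have : HasDerivAt (fun ζ : ℂ ↦ killingCoeff k * (-ζ) ^ k)
        (killingCoeff k * (k * (-0) ^ (k - 1) * (-1))) 0 :=
      ((hasDerivAt_neg (0 : ℂ)).pow k).const_mul _
    rw [this.deriv]
    rcases k with _ | _ | k
    · simp [killingCoeff]
    · norm_num [killingCoeff]
    · simp
  simp only [h1]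
  exact hasSum_ite_eq 1 1

theorem killingMap_conj {ζ : ℂ} (hζ : ζ ∈ ball (0 : ℂ) 1) :
    killingMap (conj ζ) = conj (killingMap ζ) := by
  refine (hasSum_killingMap (ζ := conj ζ) (by simpa using hζ)).unique ?_
  have := (hasSum_killingMap (mem_ball_zero_iff.1 hζ)).map (starRingEnd ℂ) Complex.continuous_conj
  convert! this using 2 with n
  simp [killingCoeff, Complex.conj_ofNat]

/-! ### The Euler derivative in the root coordinate -/

/-- The Euler derivative of `killingMap`, as a function of the square root. -/
noncomputable def killingEuler (w : ℂ) : ℂ :=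
  15 / 64 * (1 + w ^ 2) / w * (-3 * (1 - w ^ 2) / w +
    (2 * (1 - w ^ 2) ^ 2 + (1 + w ^ 2) ^ 2) / w ^ 2 * Complex.arctan w)

theorem mul_deriv_killingMap {w : ℂ} (hw : 0 < w.re) :
    w ^ 2 * deriv killingMap (w ^ 2) = killingEuler w := by
  have hw0 : w ≠ 0 := by rintro rfl; exact lt_irrefl _ hw
  rw [(hasDerivAt_killingMap hw).deriv, killingEuler]
  field_simp

/-- Obtained by differentiating the even function `killingMap (w²)`, so `Re w` may have any sign.
The version for the right half-plane misses the negative axis, which is needed for limits at `-1`.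
-/
theorem mul_deriv_killingMap_of_norm_lt {w : ℂ} (hw : ‖w‖ < 1) (hw0 : w ≠ 0) :
    w ^ 2 * deriv killingMap (w ^ 2) = killingEuler w := by
  have h1 := hasDerivAt_killingMapSqrt hw0 (one_add_sq_ne_zero_of_norm_lt hw) (.inl hw)
  have h2 : HasDerivAt killingMap (deriv killingMap (w ^ 2)) (w ^ 2) :=
    (differentiableOn_killingMap.differentiableAt
      (isOpen_ball.mem_nhds (sq_mem_ball hw))).hasDerivAt
  have h3 := h2.comp w (hasDerivAt_pow 2 w)
  have h4 : killingMap ∘ (fun w ↦ w ^ 2) =ᶠ[𝓝 w] killingMapSqrt := by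
    filter_upwards [isOpen_ne.mem_nhds hw0,
      isOpen_ball.mem_nhds (mem_ball_zero_iff.2 hw)] with v hv0 hv
    exact killingMap_sq (mem_ball_zero_iff.1 hv).le hv0
  have h5 := (h3.congr_of_eventuallyEq h4.symm).unique h1
  rw [killingEuler]
  have h6 := congrArg (fun x ↦ w / 2 * x) h5
  simp only [Nat.cast_ofNat, Nat.add_one_sub_one, pow_one] at h6
  rw [show w / 2 * (deriv killingMap (w ^ 2) * (2 * w)) = w ^ 2 * deriv killingMap (w ^ 2) by ring]
    at h6
  rw [h6]
  field_simp
  ring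

end HeleShaw

namespace HeleShaw
open Filter Set Metric ComplexConjugate Asymptotics

/-! ### The cusp -/

/-- `log ((1 - v) / (1 + v))` with `v = (1 - u) ^ (1 / 2)`. -/
noncomputable def cuspLog (u : ℂ) : ℂ :=
  Complex.log ((1 - (1 - u) ^ (1 / 2 : ℂ)) / (1 + (1 - u) ^ (1 / 2 : ℂ)))

theorem one_sub_cpow_half_re_pos {u : ℂ} (hu : ‖u‖ < 1) : 0 < ((1 - u) ^ (1 / 2 : ℂ)).re := by
  apply cpow_half_re_pos
  rw [sub_eq_add_neg]
  exact Complex.mem_slitPlane_of_norm_lt_one (by rwa [norm_neg])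

theorem one_sub_cpow_half_norm_lt {u : ℂ} (hu : ‖u‖ < 1) : ‖(1 - u) ^ (1 / 2 : ℂ)‖ < 2 := by
  have h1 : ‖(1 - u) ^ (1 / 2 : ℂ)‖ ^ 2 ≤ 1 + ‖u‖ := by
    rw [← norm_pow, cpow_half_sq]
    exact (norm_sub_le _ _).trans (by rw [norm_one])
  nlinarith [norm_nonneg ((1 - u) ^ (1 / 2 : ℂ))]

theorem I_mul_one_sub_cpow_half_sq (u : ℂ) :
    (Complex.I * (1 - u) ^ (1 / 2 : ℂ)) ^ 2 = -1 + u := by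
  rw [mul_pow, Complex.I_sq, cpow_half_sq]; ring

theorem arctan_cusp (u : ℂ) :
    Complex.arctan (Complex.I * (1 - u) ^ (1 / 2 : ℂ)) = -Complex.I / 2 * cuspLog u := by
  have h : Complex.I * (1 - u) ^ (1 / 2 : ℂ) * Complex.I = -(1 - u) ^ (1 / 2 : ℂ) := by
    linear_combination (1 - u) ^ (1 / 2 : ℂ) * Complex.I_sq
  rw [Complex.arctan, cuspLog, h, sub_neg_eq_add, ← sub_eq_add_neg]

/-- Use the root `i v` of `-1 + u`, with `v = (1 - u) ^ (1/2)`. It need not be the principal one,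
and `‖-1 + u‖ ≤ 1` is what permits the evenness argument. -/
theorem killingMap_cusp {u : ℂ} (hu : ‖u‖ < 1) (hu' : ‖-1 + u‖ ≤ 1) :
    killingMap (-1 + u) = 15 / 32 * u ^ 2 * (-(1 - u)⁻¹ -
      (2 - u) / (2 * ((1 - u) ^ (1 / 2 : ℂ)) ^ 3) * cuspLog u) - 5 / 8 := by
  have hre := one_sub_cpow_half_re_pos hu
  have hsq := I_mul_one_sub_cpow_half_sq u
  have hv0 : (1 - u) ^ (1 / 2 : ℂ) ≠ 0 := fun h ↦ by rw [h] at hre; exact lt_irrefl _ hre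
  rw [← hsq, killingMap_sq, killingMapSqrt, arctan_cusp, hsq]
  · have h1 : 1 - u ≠ 0 := by rw [← cpow_half_sq (1 - u)]; exact pow_ne_zero 2 hv0
    have h2 : -1 + u ≠ 0 := fun h ↦ h1 (by linear_combination -h)
    generalize (1 - u) ^ (1 / 2 : ℂ) = v at *
    have h3 : (Complex.I * v) ^ 3 = -Complex.I * v ^ 3 := by
      linear_combination Complex.I * v ^ 3 * Complex.I_sq
    rw [h3, show -1 + u = -(1 - u) by ring, inv_neg]
    field_simp
    ring
  · rw [← abs_norm, ← sq_le_one_iff_abs_le_one, ← norm_pow, hsq]; exact hu'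
  · exact mul_ne_zero Complex.I_ne_zero hv0

/-- `(1 - v) / (1 + v) = u / (1 + v)²` with `1 ≤ |1 + v| ≤ 3`, while each imaginary part is at most
`π` in absolute value. A bounded error is negligible against `log u`, so branches need not be
tracked. -/
theorem norm_cuspLog_sub_log_le {u : ℂ} (hu : ‖u‖ < 1) (h0 : u ≠ 0) :
    ‖cuspLog u - Complex.log u‖ ≤ 2 * Real.log 3 + 2 * Real.pi := by
  have hre := one_sub_cpow_half_re_pos hu
  have hn := one_sub_cpow_half_norm_lt hu
  set v := (1 - u) ^ (1 / 2 : ℂ) with hv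
  have hv2 : v ^ 2 = 1 - u := cpow_half_sq _
  have h1 : 1 ≤ ‖1 + v‖ := by
    have := Complex.re_le_norm (1 + v)
    rw [Complex.add_re, Complex.one_re] at this
    linarith
  have h2 : ‖1 + v‖ ≤ 3 := (norm_add_le _ _).trans (by rw [norm_one]; linarith)
  have hne : 1 + v ≠ 0 := fun h ↦ by rw [h, norm_zero] at h1; linarith
  have heq : (1 - v) / (1 + v) = u / (1 + v) ^ 2 := by
    rw [div_eq_div_iff hne (pow_ne_zero 2 hne)]
    linear_combination (-(1 + v)) * hv2
  refine (Complex.norm_le_abs_re_add_abs_im _).trans (add_le_add ?_ ?_)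
  · rw [Complex.sub_re, cuspLog, ← hv, heq, Complex.log_re, Complex.log_re, norm_div, norm_pow,
      Real.log_div (norm_ne_zero_iff.2 h0) (pow_ne_zero 2 (norm_ne_zero_iff.2 hne)), Real.log_pow,
      sub_sub_cancel_left, abs_neg, abs_of_nonneg (mul_nonneg (by norm_num) (Real.log_nonneg h1))]
    push_cast
    have := Real.log_le_log (by linarith) h2
    linarith
  · rw [Complex.sub_im]
    have a1 := Complex.neg_pi_lt_log_im ((1 - v) / (1 + v))
    have a2 := Complex.log_im_le_pi ((1 - v) / (1 + v))
    have a3 := Complex.neg_pi_lt_log_im u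
    have a4 := Complex.log_im_le_pi u
    rw [cuspLog, ← hv, abs_le]
    constructor <;> linarith

theorem tendsto_norm_log_nhdsNE_zero : Tendsto (fun u : ℂ ↦ ‖Complex.log u‖) (𝓝[≠] 0) atTop := by
  have h1 : Tendsto (fun u : ℂ ↦ -Real.log ‖u‖) (𝓝[≠] 0) atTop :=
    tendsto_neg_atBot_atTop.comp (Real.tendsto_log_nhdsGT_zero.comp (tendsto_norm_nhdsNE_zero))
  refine tendsto_atTop_mono (fun u ↦ ?_) h1
  rw [← Complex.log_re]
  exact (neg_le_abs _).trans (Complex.abs_re_le_norm _)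

theorem eventually_norm_lt_one : ∀ᶠ u : ℂ in 𝓝[≠] 0, ‖u‖ < 1 ∧ u ≠ 0 :=
  ((eventually_norm_sub_lt 0 one_pos).filter_mono nhdsWithin_le_nhds |>.mono fun u hu ↦ by
    simpa using hu).and self_mem_nhdsWithin

theorem cuspLog_isEquivalent : cuspLog ~[𝓝[≠] 0] Complex.log := by
  have h1 : (fun u ↦ cuspLog u - Complex.log u) =O[𝓝[≠] 0] fun _ ↦ (1 : ℝ) := by
    refine IsBigO.of_bound (2 * Real.log 3 + 2 * Real.pi) ?_
    filter_upwards [eventually_norm_lt_one] with u hu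
    rw [norm_one, mul_one]
    exact norm_cuspLog_sub_log_le hu.1 hu.2
  exact h1.trans_isLittleO
    ((isLittleO_const_left.2 (.inr tendsto_norm_log_nhdsNE_zero)))

theorem tendsto_one_sub_cpow_half :
    Tendsto (fun u : ℂ ↦ (1 - u) ^ (1 / 2 : ℂ)) (𝓝[≠] 0) (𝓝 1) := by
  have : ContinuousAt (fun u : ℂ ↦ (1 - u) ^ (1 / 2 : ℂ)) 0 :=
    (continuousAt_cpow_const (by simp)).comp (by fun_prop)
  have := this.tendsto
  rw [sub_zero, Complex.one_cpow] at this
  exact this.mono_left nhdsWithin_le_nhds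

theorem cusp_factor_isEquivalent :
    (fun u : ℂ ↦ -(1 - u)⁻¹ - (2 - u) / (2 * ((1 - u) ^ (1 / 2 : ℂ)) ^ 3) * cuspLog u)
      ~[𝓝[≠] 0] fun u ↦ -Complex.log u := by
  have hid : Tendsto (fun u : ℂ ↦ u) (𝓝[≠] 0) (𝓝 0) := tendsto_id.mono_left nhdsWithin_le_nhds
  have h1 : Tendsto (fun u : ℂ ↦ (2 - u) / (2 * ((1 - u) ^ (1 / 2 : ℂ)) ^ 3)) (𝓝[≠] 0) (𝓝 1) := by
    have := (hid.const_sub 2).div ((tendsto_one_sub_cpow_half.pow 3).const_mul 2) (by norm_num)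
    norm_num at this
    norm_num
    exact this
  have h2 := (((isEquivalent_const_iff_tendsto one_ne_zero).2 h1).mul cuspLog_isEquivalent).neg
  have h3 : (fun u : ℂ ↦ -(1 - u)⁻¹) =o[𝓝[≠] 0] fun u ↦ -Complex.log u := by
    have : Tendsto (fun u : ℂ ↦ -(1 - u)⁻¹) (𝓝[≠] 0) (𝓝 (-(1 - 0)⁻¹)) :=
      ((hid.const_sub 1).inv₀ (by norm_num)).neg
    refine (this.isBigO_one ℝ).trans_isLittleO (IsLittleO.neg_right ?_)
    exact isLittleO_const_left.2 (.inr tendsto_norm_log_nhdsNE_zero)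
  have h4 : (fun u : ℂ ↦ -((2 - u) / (2 * ((1 - u) ^ (1 / 2 : ℂ)) ^ 3) * cuspLog u))
      ~[𝓝[≠] 0] fun u ↦ -Complex.log u := by
    refine h2.trans_eventuallyEq (.of_eq ?_)
    funext u; simp
  refine (h3.add_isEquivalent h4).congr_left (.of_eq ?_)
  funext u
  simp [sub_eq_add_neg]

theorem killingMap_isEquivalent_cusp :
    (fun u : ℂ ↦ killingMap (-1 + u) - killingMap (-1))
      ~[𝓝[{u : ℂ | -1 + u ∈ closedBall (0 : ℂ) 1}] 0]
      (fun u : ℂ ↦ -(15 / 32) * u ^ 2 * Complex.log u) := by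
  have hins : {u : ℂ | -1 + u ∈ closedBall (0 : ℂ) 1} =
      insert 0 ({u : ℂ | -1 + u ∈ closedBall (0 : ℂ) 1} \ {0}) := by
    rw [insert_sdiff_singleton, insert_eq_of_mem]
    simp
  rw [hins]
  -- The point `u = 0` lies in the approach set; both sides vanish there.
  refine IsLittleO.insert ?_ (by simp)
  have h1 : (fun u : ℂ ↦ 15 / 32 * u ^ 2 * (-(1 - u)⁻¹ -
      (2 - u) / (2 * ((1 - u) ^ (1 / 2 : ℂ)) ^ 3) * cuspLog u)) ~[𝓝[≠] 0]
      fun u ↦ 15 / 32 * u ^ 2 * (-Complex.log u) :=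
    (IsEquivalent.refl (u := fun u : ℂ ↦ 15 / 32 * u ^ 2)).mul cusp_factor_isEquivalent
  have hle : 𝓝[{u : ℂ | -1 + u ∈ closedBall (0 : ℂ) 1} \ {0}] 0 ≤ 𝓝[≠] (0 : ℂ) :=
    nhdsWithin_mono _ fun u hu ↦ hu.2
  have h2 := h1.mono hle
  refine IsLittleO.congr' h2 ?_ (.of_eq ?_)
  · filter_upwards [hle eventually_norm_lt_one, self_mem_nhdsWithin] with u hu hu'
    have := hu'.1
    simp only [mem_ofPred_eq, mem_closedBall_zero_iff] at this
    simp only [Pi.sub_apply]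
    rw [killingMap_cusp hu.1 this, killingMap_neg_one]
    ring
  · funext u; ring

theorem tendsto_mul_cuspLog : Tendsto (fun u ↦ u * cuspLog u) (𝓝[≠] 0) (𝓝 0) := by
  have h1 : Tendsto (fun u : ℂ ↦ ‖u‖ * |Real.log ‖u‖| +
      (2 * Real.log 3 + 3 * Real.pi) * ‖u‖) (𝓝[≠] 0) (𝓝 0) := by
    have hc : Continuous fun u : ℂ ↦ |‖u‖ * Real.log ‖u‖| + (2 * Real.log 3 + 3 * Real.pi) * ‖u‖ :=
      ((Real.continuous_mul_log.comp continuous_norm).abs).add (by fun_prop)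
    have := (hc.tendsto 0).mono_left (nhdsWithin_le_nhds (s := {0}ᶜ))
    simp only [abs_mul, abs_norm] at this
    simpa using this
  refine squeeze_zero_norm' ?_ h1
  filter_upwards [eventually_norm_lt_one] with u hu
  have h2 := norm_cuspLog_sub_log_le hu.1 hu.2
  have h3 : ‖Complex.log u‖ ≤ |Real.log ‖u‖| + Real.pi := by
    refine (Complex.norm_le_abs_re_add_abs_im _).trans (add_le_add (by rw [Complex.log_re]) ?_)
    rw [Complex.log_im]
    exact Complex.abs_arg_le_pi u
  have h4 : ‖cuspLog u‖ ≤ |Real.log ‖u‖| + (2 * Real.log 3 + 3 * Real.pi) := by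
    have := norm_add_le (cuspLog u - Complex.log u) (Complex.log u)
    rw [sub_add_cancel] at this
    linarith
  rw [norm_mul]
  nlinarith [norm_nonneg u]

theorem tendsto_one_add_nhdsWithin {S : Set ℂ} :
    Tendsto (fun z : ℂ ↦ 1 + z) (𝓝[S \ {-1}] (-1)) (𝓝[≠] 0) := by
  refine tendsto_nhdsWithin_iff.2 ⟨?_, ?_⟩
  · have : Continuous fun z : ℂ ↦ 1 + z := by fun_prop
    have := this.tendsto (-1)
    rw [add_neg_cancel] at this
    exact this.mono_left nhdsWithin_le_nhds
  · filter_upwards [self_mem_nhdsWithin] with z hz h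
    exact hz.2 (eq_neg_of_add_eq_zero_right h)

theorem continuousWithinAt_killingMap_neg_one :
    ContinuousWithinAt killingMap (closedBall 0 1) (-1) := by
  rw [← continuousWithinAt_sdiff_self, ContinuousWithinAt, killingMap_neg_one]
  have hid : Tendsto (fun u : ℂ ↦ u) (𝓝[≠] 0) (𝓝 0) := tendsto_id.mono_left nhdsWithin_le_nhds
  have h1 : Tendsto (fun u : ℂ ↦ 15 / 32 * (-(u ^ 2 * (1 - u)⁻¹) -
      (2 - u) / (2 * ((1 - u) ^ (1 / 2 : ℂ)) ^ 3) * (u * (u * cuspLog u))) - 5 / 8) (𝓝[≠] 0)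
      (𝓝 (-5 / 8)) := by
    have := ((((hid.pow 2).mul ((hid.const_sub 1).inv₀ (by norm_num))).neg.sub
      (((hid.const_sub 2).div ((tendsto_one_sub_cpow_half.pow 3).const_mul 2) (by norm_num)).mul
        (hid.mul tendsto_mul_cuspLog))).const_mul (15 / 32)).sub_const (5 / 8)
    convert! this using 2
    norm_num
  refine (h1.comp tendsto_one_add_nhdsWithin).congr' ?_
  filter_upwards [tendsto_one_add_nhdsWithin.eventually eventually_norm_lt_one,
    self_mem_nhdsWithin] with z hz hz'
  have hz1 : -1 + (1 + z) = z := by ring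
  have := killingMap_cusp hz.1 (by rw [hz1]; exact mem_closedBall_zero_iff.1 hz'.1)
  rw [hz1] at this
  rw [this, Function.comp_apply]
  ring

/-- The factor `1 + w² = u` in `killingEuler` absorbs the logarithm, since `u * cuspLog u → 0`. -/
theorem tendsto_mul_deriv_killingMap_neg_one :
    Tendsto (fun z ↦ z * deriv killingMap z) (𝓝[ball 0 1] (-1)) (𝓝 0) := by
  have hid : Tendsto (fun u : ℂ ↦ u) (𝓝[≠] 0) (𝓝 0) := tendsto_id.mono_left nhdsWithin_le_nhds
  have hv : Tendsto (fun u : ℂ ↦ Complex.I * (1 - u) ^ (1 / 2 : ℂ)) (𝓝[≠] 0) (𝓝 (Complex.I * 1)) :=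
    tendsto_one_sub_cpow_half.const_mul _
  have h1 : Tendsto (fun u : ℂ ↦ 15 / 64 / (Complex.I * (1 - u) ^ (1 / 2 : ℂ)) *
      (u * (-3 * (2 - u) / (Complex.I * (1 - u) ^ (1 / 2 : ℂ))) +
      (2 * (2 - u) ^ 2 + u ^ 2) / (-1 + u) * (-Complex.I / 2 * (u * cuspLog u)))) (𝓝[≠] 0)
      (𝓝 0) := by
    have := (((tendsto_const_nhds (x := (15 / 64 : ℂ))).div hv (by simp)).mul
      ((hid.mul (((hid.const_sub 2).const_mul (-3)).div hv (by simp))).add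
      ((((((hid.const_sub 2).pow 2).const_mul 2).add (hid.pow 2)).div (hid.const_add (-1))
        (by norm_num)).mul (tendsto_mul_cuspLog.const_mul (-Complex.I / 2)))))
    convert! this using 2
    norm_num
  have hb : ball (0 : ℂ) 1 \ {-1} = ball 0 1 := sdiff_singleton_eq_self (by simp)
  have hT := tendsto_one_add_nhdsWithin (S := ball 0 1)
  rw [hb] at hT
  refine (h1.comp hT).congr' ?_
  filter_upwards [hT.eventually eventually_norm_lt_one, self_mem_nhdsWithin] with z hz hz'
  have hz1 : -1 + (1 + z) = z := by ring
  have hsq := I_mul_one_sub_cpow_half_sq (1 + z)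
  rw [hz1] at hsq
  have hre := one_sub_cpow_half_re_pos hz.1
  have harc := arctan_cusp (1 + z)
  simp only [Function.comp_apply]
  rw [hz1]
  generalize (1 - (1 + z)) ^ (1 / 2 : ℂ) = v at *
  have hv0 : v ≠ 0 := fun h ↦ by rw [h] at hre; exact lt_irrefl _ hre
  have hlt : ‖Complex.I * v‖ < 1 := by
    rw [← abs_norm, ← sq_lt_one_iff_abs_lt_one, ← norm_pow, hsq]
    exact mem_ball_zero_iff.1 hz'
  have := mul_deriv_killingMap_of_norm_lt hlt (mul_ne_zero Complex.I_ne_zero hv0)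
  rw [hsq] at this
  rw [this, killingEuler, hsq, harc]
  ring

/-! ### Boundary values -/

theorem mem_slitPlane_of_norm_eq_one {z : ℂ} (h : ‖z‖ = 1) (h1 : z ≠ -1) :
    z ∈ Complex.slitPlane := by
  by_contra hs
  rw [Complex.mem_slitPlane_iff, not_or, not_lt, not_not] at hs
  apply h1
  have h2 : z.re ^ 2 + z.im ^ 2 = 1 := by
    rw [← one_pow 2, ← h, ← Complex.normSq_eq_norm_sq, Complex.normSq_apply]; ring
  rw [hs.2] at h2
  apply Complex.ext
  · rw [Complex.neg_re, Complex.one_re]; nlinarith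
  · rw [hs.2]; simp

theorem continuousOn_killingMap : ContinuousOn killingMap (closedBall 0 1) := fun z hz ↦ by
  rcases eq_or_ne z (-1) with rfl | h1
  · exact continuousWithinAt_killingMap_neg_one
  rcases (mem_closedBall_zero_iff.1 hz).lt_or_eq with h | h
  · exact (differentiableOn_killingMap.differentiableAt
      (isOpen_ball.mem_nhds (mem_ball_zero_iff.2 h))).continuousAt.continuousWithinAt
  · exact (differentiableAt_killingMap
      (mem_slitPlane_of_norm_eq_one h h1)).continuousAt.continuousWithinAt

end HeleShaw

namespace HeleShaw
open Filter Set Metric ComplexConjugate Asymptotics InnerProductSpace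

/-! ### The explicit map on the unit circle -/

/-- Real form of the imaginary part of `arctan` on the unit circle. -/
noncomputable def circleLog (c s : ℝ) : ℝ := Real.log ((1 + s) / c) / 2

/-- On the right half of the unit circle the ratio inside the logarithm is `i c / (1 + s)`, of
constant argument `π/2`. -/
theorem arctan_circle {c s : ℝ} (h : c ^ 2 + s ^ 2 = 1) (hc : 0 < c) :
    Complex.arctan (c + s * Complex.I) = Real.pi / 4 + circleLog c s * Complex.I := by
  have hs : 0 < 1 + s := by nlinarith
  have hr : (1 + (c + s * Complex.I) * Complex.I) / (1 - (c + s * Complex.I) * Complex.I) =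
      ((c / (1 + s) : ℝ) : ℂ) * Complex.I := by
    have h2 : (1 : ℂ) - (c + s * Complex.I) * Complex.I ≠ 0 := fun h0 ↦ by
      have := congrArg Complex.re h0
      simp at this
      linarith
    have h3 : (1 + s : ℂ) ≠ 0 := by exact_mod_cast hs.ne'
    have h' : (c : ℂ) ^ 2 + s ^ 2 = 1 := by exact_mod_cast h
    push_cast
    rw [div_eq_iff h2]
    field_simp
    linear_combination (Complex.I * c * s + s + c ^ 2 + s ^ 2) * Complex.I_sq - h'
  rw [Complex.arctan, hr, Complex.log_mul_eq_add_log_iff _ Complex.I_ne_zero |>.2,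
    Complex.log_I, ← Complex.ofReal_log (by positivity), circleLog,
    show c / (1 + s) = ((1 + s) / c)⁻¹ by rw [inv_div], Real.log_inv]
  · push_cast
    linear_combination (-(Real.pi : ℂ) / 4) * Complex.I_sq
  · rw [Complex.arg_ofReal_of_nonneg (by positivity), Complex.arg_I]
    constructor <;> linarith [Real.pi_pos]
  · exact_mod_cast (by positivity : c / (1 + s) ≠ 0)

theorem one_add_sq_circle {c s : ℝ} (h : c ^ 2 + s ^ 2 = 1) :
    1 + (c + s * Complex.I : ℂ) ^ 2 = 2 * c * (c + s * Complex.I) := by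
  have h' : (c : ℂ) ^ 2 + s ^ 2 = 1 := by exact_mod_cast h
  linear_combination s ^ 2 * Complex.I_sq - h'

theorem one_sub_sq_circle {c s : ℝ} (h : c ^ 2 + s ^ 2 = 1) :
    1 - (c + s * Complex.I : ℂ) ^ 2 = -2 * s * Complex.I * (c + s * Complex.I) := by
  have h' : (c : ℂ) ^ 2 + s ^ 2 = 1 := by exact_mod_cast h
  linear_combination s ^ 2 * Complex.I_sq - h'

/-- The logarithm occurs in the real part only. The imaginary part, a multiple of `c² s`, is what
the uniqueness argument reproduces. -/
theorem killingMap_circle {c s : ℝ} (h : c ^ 2 + s ^ 2 = 1) (hc : 0 < c) :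
    killingMap ((c + s * Complex.I) ^ 2) =
      ((15 / 8 * c ^ 2 * (1 - 2 * s * circleLog c s) - 5 / 8 : ℝ) : ℂ) +
        ((15 * Real.pi / 16 * c ^ 2 * s : ℝ) : ℂ) * Complex.I := by
  have hre : 0 < (c + s * Complex.I : ℂ).re := by simpa using hc
  have hw0 : (c + s * Complex.I : ℂ) ≠ 0 := fun h ↦ by rw [h] at hre; exact lt_irrefl _ hre
  rw [killingMap_sq_of_re_pos hre, killingMapSqrt, arctan_circle h hc]
  rw [one_add_sq_circle h, one_sub_sq_circle h]
  push_cast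
  field_simp
  linear_combination 61440 * c ^ 2 * s * circleLog c s * Complex.I_sq

theorem killingEuler_circle {c s : ℝ} (h : c ^ 2 + s ^ 2 = 1) (hc : 0 < c) :
    killingEuler (c + s * Complex.I) = ((15 / 32 * c * (Real.pi * (c ^ 2 - 2 * s ^ 2)) : ℝ) : ℂ) +
      ((15 / 32 * c * (6 * s + 4 * (c ^ 2 - 2 * s ^ 2) * circleLog c s) : ℝ) : ℂ) * Complex.I := by
  have hre : 0 < (c + s * Complex.I : ℂ).re := by simpa using hc
  have hw0 : (c + s * Complex.I : ℂ) ≠ 0 := fun h ↦ by rw [h] at hre; exact lt_irrefl _ hre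
  rw [killingEuler, arctan_circle h hc]
  rw [one_add_sq_circle h, one_sub_sq_circle h]
  push_cast
  field_simp
  linear_combination (2048 * c * s ^ 2 * Complex.I * circleLog c s + 512 * c * s ^ 2 * Real.pi) * Complex.I_sq

/-- The logarithms cancel. This is the free boundary condition on the circle, and its positivity is
starlikeness. -/
theorem re_conj_killingMap_mul_killingEuler {c s : ℝ} (h : c ^ 2 + s ^ 2 = 1) (hc : 0 < c) :
    (conj (killingMap ((c + s * Complex.I) ^ 2)) * killingEuler (c + s * Complex.I)).re =
      75 * Real.pi / 128 * c := by
  rw [killingMap_circle h hc, killingEuler_circle h hc]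
  simp only [map_add, map_mul, Complex.conj_ofReal, Complex.conj_I, Complex.mul_re, Complex.add_re,
    Complex.add_im, Complex.mul_im, Complex.ofReal_re, Complex.ofReal_im, Complex.I_re,
    Complex.I_im, Complex.neg_re, Complex.neg_im]
  linear_combination 15 * Real.pi / 32 * c * (15 / 8 * c ^ 2 + 5 / 4) * h

theorem exists_circle_eq {z : ℂ} (hz : ‖z‖ = 1) (h1 : z ≠ -1) :
    ∃ c s : ℝ, c ^ 2 + s ^ 2 = 1 ∧ 0 < c ∧ z = (c + s * Complex.I) ^ 2 := by
  have hs := mem_slitPlane_of_norm_eq_one hz h1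
  refine ⟨(z ^ (1 / 2 : ℂ)).re, (z ^ (1 / 2 : ℂ)).im, ?_, cpow_half_re_pos hs, ?_⟩
  · rw [← cpow_half_sq z, norm_pow, ← Complex.normSq_eq_norm_sq, Complex.normSq_apply] at hz
    linarith
  · rw [Complex.re_add_im, cpow_half_sq]

theorem killingMap_circle_ne_zero {z : ℂ} (hz : ‖z‖ = 1) : killingMap z ≠ 0 := by
  rcases eq_or_ne z (-1) with rfl | h1
  · rw [killingMap_neg_one]; norm_num
  obtain ⟨c, s, h, hc, rfl⟩ := exists_circle_eq hz h1
  intro h0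
  have := re_conj_killingMap_mul_killingEuler h hc
  rw [h0, map_zero, zero_mul, Complex.zero_re] at this
  have : 0 < 75 * Real.pi / 128 * c := by positivity
  linarith

/-- The minimum principle for the real part on the unit disk. -/
theorem re_pos_of_boundary {H : ℂ → ℂ} (hd : DifferentiableOn ℂ H (ball 0 1))
    (hb : ∀ z : ℂ, ‖z‖ = 1 → ∃ l : ℂ, 0 ≤ l.re ∧ Tendsto H (𝓝[ball 0 1] z) (𝓝 l))
    (h0 : 0 < (H 0).re) {z : ℂ} (hz : z ∈ ball (0 : ℂ) 1) : 0 < (H z).re := by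
  have hnn : ∀ z ∈ ball (0 : ℂ) 1, -(H z).re ≤ 0 := by
    have hh : HarmonicOnNhd (fun z ↦ -(H z).re) (ball 0 1) := fun z hz ↦ by
      have := (hd.analyticAt (isOpen_ball.mem_nhds hz)).neg.harmonicAt_re
      exact this
    refine harmonic_nonpos_of_frontier isOpen_ball isBounded_ball hh fun w hw ε hε ↦ ?_
    rw [frontier_ball _ one_ne_zero, mem_sphere_zero_iff_norm] at hw
    obtain ⟨l, hl, ht⟩ := hb w hw
    have := ((Complex.continuous_re.tendsto l).comp ht).neg
    filter_upwards [this.eventually (gt_mem_nhds (show -l.re < ε by linarith))] with v hv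
    exact hv.le
  by_contra! hcon
  have hz0 : (H z).re = 0 := le_antisymm hcon (by linarith [hnn z hz])
  -- An interior zero of `Re H` would be a maximum of `|exp (-H)|`, making `Re H` constant against
  -- `h0`.
  have heq := Complex.eqOn_of_isPreconnected_of_isMaxOn_norm (convex_ball (0 : ℂ) 1).isPreconnected
    isOpen_ball (f := fun z ↦ Complex.exp (-H z)) hd.neg.cexp hz (fun v hv ↦ by
      simp only [Function.comp_apply, mem_ofPred_eq, Complex.norm_exp, Complex.neg_re]
      rw [hz0, neg_zero]
      exact Real.exp_le_exp.2 (hnn v hv))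
  have := congrArg norm (heq (mem_ball_self one_pos))
  simp only [Function.const_apply, Complex.norm_exp, Complex.neg_re, hz0] at this
  have := Real.exp_injective this
  linarith

theorem killingMap_tendsto_circle {z : ℂ} (hz : ‖z‖ = 1) :
    Tendsto killingMap (𝓝[ball 0 1] z) (𝓝 (killingMap z)) :=
  (continuousOn_killingMap z (mem_closedBall_zero_iff.2 hz.le)).mono_left
    (nhdsWithin_mono _ ball_subset_closedBall)

theorem killingMap_eq_mul_dslope (z : ℂ) : killingMap z = z * dslope killingMap 0 z := by
  have := sub_smul_dslope killingMap 0 z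
  rw [killingMap_zero, sub_zero, sub_zero, smul_eq_mul] at this
  exact this.symm

theorem differentiableOn_dslope_killingMap :
    DifferentiableOn ℂ (dslope killingMap 0) (ball 0 1) :=
  (Complex.differentiableOn_dslope (isOpen_ball.mem_nhds (mem_ball_self one_pos))).2
    differentiableOn_killingMap

theorem tendsto_id_ball (z : ℂ) : Tendsto (fun z : ℂ ↦ z) (𝓝[ball 0 1] z) (𝓝 z) :=
  tendsto_id.mono_left nhdsWithin_le_nhds

theorem tendsto_dslope_killingMap {z : ℂ} (hz : ‖z‖ = 1) :
    Tendsto (dslope killingMap 0) (𝓝[ball 0 1] z) (𝓝 (killingMap z / z)) := by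
  have hz0 : z ≠ 0 := by rintro rfl; simp at hz
  refine ((killingMap_tendsto_circle hz).div (tendsto_id_ball z) hz0).congr' ?_
  filter_upwards [(isOpen_ne.mem_nhds hz0 : _ ∈ 𝓝 z) |> mem_nhdsWithin_of_mem_nhds] with v hv
  rw [Pi.div_apply, killingMap_eq_mul_dslope, mul_div_cancel_left₀ _ hv]

/-- On the circle `(1 - ζ²) / ζ = -2 i Im ζ`, and `Im f` has the sign of `Im ζ`. Hence `(1 - ζ²) f /
ζ` has nonnegative boundary real part and, with value `1` at the origin, positive real part inside.
-/
theorem dslope_killingMap_ne_zero {z : ℂ} (hz : z ∈ ball (0 : ℂ) 1) :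
    dslope killingMap 0 z ≠ 0 := by
  intro h
  have := re_pos_of_boundary (H := fun z ↦ (1 - z ^ 2) * dslope killingMap 0 z)
    (by have := differentiableOn_dslope_killingMap; fun_prop) (fun z hz ↦ ?_)
    (by simp [dslope_same, deriv_killingMap_zero]) hz
  · simp [h] at this
  · refine ⟨_, ?_, (((tendsto_id_ball z).pow 2).const_sub 1).mul (tendsto_dslope_killingMap hz)⟩
    rcases eq_or_ne z (-1) with rfl | h1
    · simp
    obtain ⟨c, s, h, hc, rfl⟩ := exists_circle_eq hz h1
    have hre : 0 < (c + s * Complex.I : ℂ).re := by simpa using hc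
    have hw0 : (c + s * Complex.I : ℂ) ≠ 0 := fun h ↦ by rw [h] at hre; exact lt_irrefl _ hre
    rw [killingMap_circle h hc]
    have : ((1 : ℂ) - ((c + s * Complex.I) ^ 2) ^ 2) / (c + s * Complex.I) ^ 2 =
        ((-4 * c * s : ℝ) : ℂ) * Complex.I := by
      rw [div_eq_iff (pow_ne_zero 2 hw0)]
      have e1 := one_add_sq_circle h
      have e2 := one_sub_sq_circle h
      generalize (c + s * Complex.I : ℂ) = w at *
      rw [show 1 - (w ^ 2) ^ 2 = (1 + w ^ 2) * (1 - w ^ 2) by ring, e1, e2]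
      push_cast
      ring
    rw [mul_div_left_comm, this]
    simp only [Complex.mul_re, Complex.add_re, Complex.add_im, Complex.mul_im, Complex.ofReal_re,
      Complex.ofReal_im, Complex.I_re, Complex.I_im]
    have : 0 ≤ 15 * Real.pi / 4 * c ^ 3 * s ^ 2 := by positivity
    linarith

theorem continuousAt_deriv_killingMap {z : ℂ} (hz : z ∈ Complex.slitPlane) :
    ContinuousAt (deriv killingMap) z := by
  have h : DifferentiableOn ℂ killingMap Complex.slitPlane := fun z hz ↦
    (differentiableAt_killingMap hz).differentiableWithinAt
  exact ((h.deriv Complex.isOpen_slitPlane).differentiableAt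
    (Complex.isOpen_slitPlane.mem_nhds hz)).continuousAt

theorem re_euler_quotient_circle {z : ℂ} (hz : ‖z‖ = 1) (h1 : z ≠ -1) :
    0 < (z * deriv killingMap z / killingMap z).re := by
  have hK := killingMap_circle_ne_zero hz
  obtain ⟨c, s, h, hc, rfl⟩ := exists_circle_eq hz h1
  have hre : 0 < (c + s * Complex.I : ℂ).re := by simpa using hc
  have h2 := re_conj_killingMap_mul_killingEuler h hc
  rw [mul_deriv_killingMap hre, div_eq_mul_inv, Complex.inv_def, ← mul_assoc,
    Complex.re_mul_ofReal, mul_comm (killingEuler _), h2]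
  have := Complex.normSq_pos.2 hK
  positivity

/-- Away from the origin this quotient is `ζ f' / f`, whose boundary real part is `Re (conj f · ζ
f') / |f|²`: positive off `-1`, with limit `0` at the cusp. The minimum principle and the value `1`
at the origin finish. -/
theorem re_euler_quotient_pos {z : ℂ} (hz : z ∈ ball (0 : ℂ) 1) :
    0 < (deriv killingMap z / dslope killingMap 0 z).re := by
  refine re_pos_of_boundary (H := fun z ↦ deriv killingMap z / dslope killingMap 0 z)
    ((differentiableOn_killingMap.deriv isOpen_ball).div differentiableOn_dslope_killingMap
      fun z hz ↦ dslope_killingMap_ne_zero hz) (fun z hz ↦ ?_)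
    (by simp [dslope_same, deriv_killingMap_zero]) hz
  have hz0 : z ≠ 0 := by rintro rfl; simp at hz
  have hne : ∀ᶠ v in 𝓝[ball 0 1] z, v ≠ 0 := mem_nhdsWithin_of_mem_nhds (isOpen_ne.mem_nhds hz0)
  have key : ∃ l : ℂ, 0 ≤ (l / killingMap z).re ∧
      Tendsto (fun v ↦ v * deriv killingMap v) (𝓝[ball 0 1] z) (𝓝 l) := by
    rcases eq_or_ne z (-1) with rfl | h1
    · exact ⟨0, by simp, tendsto_mul_deriv_killingMap_neg_one⟩
    · exact ⟨_, (re_euler_quotient_circle hz h1).le, (tendsto_id_ball z).mul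
        ((continuousAt_deriv_killingMap
          (mem_slitPlane_of_norm_eq_one hz h1)).tendsto.mono_left nhdsWithin_le_nhds)⟩
  obtain ⟨l, hl, ht⟩ := key
  refine ⟨_, hl, (ht.div (killingMap_tendsto_circle hz) (killingMap_circle_ne_zero hz)).congr' ?_⟩
  filter_upwards [hne] with v hv
  rw [Pi.div_apply, killingMap_eq_mul_dslope, mul_div_mul_left _ _ hv]

theorem deriv_killingMap_ne_zero {z : ℂ} (hz : z ∈ ball (0 : ℂ) 1) : deriv killingMap z ≠ 0 := by
  intro h
  have := re_euler_quotient_pos hz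
  rw [h, zero_div] at this
  exact lt_irrefl _ this

/-! ### Univalence of starlike functions -/

/-- A holomorphic function on a convex set whose derivative has positive real part is injective. -/
theorem injOn_of_re_deriv_pos {T T' : ℂ → ℂ} {U : Set ℂ} (hU : Convex ℝ U)
    (hT : ∀ t ∈ U, HasDerivAt T (T' t) t) (hpos : ∀ t ∈ U, 0 < (T' t).re) : InjOn T U := by
  intro a ha b hb hab
  by_contra hne
  have hd : b - a ≠ 0 := sub_ne_zero.2 (Ne.symm hne)
  have hmem : ∀ r ∈ Icc (0 : ℝ) 1, a + r * (b - a) ∈ U := fun r hr ↦ by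
    have := hU.add_smul_sub_mem ha hb hr
    rwa [Complex.real_smul] at this
  have hder : ∀ r ∈ Icc (0 : ℝ) 1, HasDerivAt (fun r : ℝ ↦ (T (a + r * (b - a)) / (b - a)).re)
      (T' (a + r * (b - a))).re r := fun r hr ↦ by
    have h1 : HasDerivAt (fun z : ℂ ↦ a + z * (b - a)) (1 * (b - a)) (r : ℂ) :=
      ((hasDerivAt_id _).mul_const _).const_add _
    have h2 := ((hT _ (hmem r hr)).comp (r : ℂ) h1).div_const (b - a)
    have h3 := h2.real_of_complex
    refine h3.congr_deriv ?_
    rw [one_mul, mul_div_cancel_right₀ _ hd]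
  -- Rolle for the real part of `T / (b - a)` along the segment, whose derivative is exactly `Re
  -- T'`.
  obtain ⟨r, hr, h0⟩ := exists_hasDerivAt_eq_zero (zero_lt_one' ℝ)
    (fun r hr ↦ (hder r hr).continuousAt.continuousWithinAt) (by simp [hab])
    (fun r hr ↦ hder r (Ioo_subset_Icc_self hr))
  have := hpos _ (hmem r (Ioo_subset_Icc_self hr))
  linarith

theorem exists_eq_exp_of_ne_zero {g : ℂ → ℂ} {c : ℂ} {r : ℝ} (hg : DifferentiableOn ℂ g (ball c r))
    (hne : ∀ z ∈ ball c r, g z ≠ 0) :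
    ∃ L : ℂ → ℂ, ∀ z ∈ ball c r, g z = Complex.exp (L z) ∧ HasDerivAt L (deriv g z / g z) z := by
  rcases le_or_gt r 0 with hr | hr
  · exact ⟨0, by simp [ball_eq_empty.2 hr]⟩
  obtain ⟨L, hL⟩ := ((hg.deriv isOpen_ball).div hg hne).isExactOn_ball
  have hc : c ∈ ball c r := mem_ball_self hr
  have hd : ∀ z ∈ ball c r, HasDerivAt (fun z ↦ g z * Complex.exp (-L z)) 0 z := fun z hz ↦ by
    have h1 := (hg.differentiableAt (isOpen_ball.mem_nhds hz)).hasDerivAt.mul (hL z hz).neg.cexp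
    refine h1.congr_deriv ?_
    have := hne z hz
    simp only [Pi.div_apply, Pi.neg_apply]
    field_simp
    ring
  refine ⟨fun z ↦ L z + (Complex.log (g c) - L c), fun z hz ↦ ⟨?_, (hL z hz).add_const _⟩⟩
  have h2 := isOpen_ball.is_const_of_deriv_eq_zero (convex_ball c r).isPreconnected
    (fun z hz ↦ (hd z hz).differentiableAt.differentiableWithinAt) (fun z hz ↦ (hd z hz).deriv) hz hc
  rw [Complex.exp_neg, Complex.exp_neg, ← div_eq_mul_inv, ← div_eq_mul_inv,
    div_eq_div_iff (Complex.exp_ne_zero _) (Complex.exp_ne_zero _)] at h2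
  rw [Complex.exp_add, Complex.exp_sub, Complex.exp_log (hne c hc)]
  have := Complex.exp_ne_zero (L c)
  field_simp
  linear_combination h2

/-- In the variable `t = log z` the function `t + L (exp t)` is a logarithm of `f`, with derivative
`z f' / f` of positive real part on the convex set `Re t < 0`, hence injective. Equal values of `f`
give logarithms differing by `2 π i n`, and shifting `log b` by this period stays in the half-plane.
-/
theorem injOn_of_re_euler_pos {f : ℂ → ℂ} (hf : DifferentiableOn ℂ f (ball 0 1))
    (hfg : ∀ z, f z = z * dslope f 0 z) (hne : ∀ z ∈ ball (0 : ℂ) 1, dslope f 0 z ≠ 0)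
    (hpos : ∀ z ∈ ball (0 : ℂ) 1, 0 < (deriv f z / dslope f 0 z).re) : InjOn f (ball 0 1) := by
  have hg : DifferentiableOn ℂ (dslope f 0) (ball 0 1) :=
    (Complex.differentiableOn_dslope (isOpen_ball.mem_nhds (mem_ball_self one_pos))).2 hf
  obtain ⟨L, hL⟩ := exists_eq_exp_of_ne_zero hg hne
  have hexp : ∀ t : ℂ, t.re < 0 → Complex.exp t ∈ ball (0 : ℂ) 1 := fun t ht ↦ by
    rw [mem_ball_zero_iff, Complex.norm_exp]
    exact Real.exp_lt_one_iff.2 ht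
  have hder : ∀ z ∈ ball (0 : ℂ) 1, deriv f z = dslope f 0 z + z * deriv (dslope f 0) z :=
    fun z hz ↦ by
      have h1 := (hasDerivAt_id z).mul (hg.differentiableAt (isOpen_ball.mem_nhds hz)).hasDerivAt
      exact (h1.congr_of_eventuallyEq (f₁ := f) (.of_eq (funext hfg))).deriv.trans (by simp)
  have hinj : InjOn (fun t ↦ t + L (Complex.exp t)) {t : ℂ | t.re < 0} := by
    refine injOn_of_re_deriv_pos (T' := fun t ↦ 1 + deriv (dslope f 0) (Complex.exp t) /
      dslope f 0 (Complex.exp t) * Complex.exp t) (convex_halfSpace_re_lt 0) (fun t ht ↦ ?_)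
      fun t ht ↦ ?_
    · exact (hasDerivAt_id t).add ((hL _ (hexp t ht)).2.comp t (Complex.hasDerivAt_exp t))
    · have h1 := hpos _ (hexp t ht)
      rw [hder _ (hexp t ht), add_div, div_self (hne _ (hexp t ht))] at h1
      rwa [div_mul_eq_mul_div, mul_comm (deriv _ _)]
  intro a ha b hb hab
  by_cases ha0 : a = 0
  · rw [hfg a, hfg b, ha0, zero_mul] at hab
    rw [ha0]
    exact ((mul_eq_zero.1 hab.symm).resolve_right (hne b hb)).symm
  by_cases hb0 : b = 0
  · rw [hfg a, hfg b, hb0, zero_mul] at hab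
    rw [hb0]
    exact (mul_eq_zero.1 hab).resolve_right (hne a ha)
  have hre : ∀ z ∈ ball (0 : ℂ) 1, z ≠ 0 → (Complex.log z).re < 0 := fun z hz h0 ↦ by
    rw [Complex.log_re]
    exact Real.log_neg (norm_pos_iff.2 h0) (mem_ball_zero_iff.1 hz)
  have hfe : ∀ z ∈ ball (0 : ℂ) 1, z ≠ 0 → f z = Complex.exp (Complex.log z + L z) :=
    fun z hz h0 ↦ by rw [hfg, (hL z hz).1, Complex.exp_add, Complex.exp_log h0]
  rw [hfe a ha ha0, hfe b hb hb0, Complex.exp_eq_exp_iff_exists_int] at hab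
  obtain ⟨n, hn⟩ := hab
  have hper : Complex.exp (Complex.log b + n * (2 * Real.pi * Complex.I)) = b := by
    rw [Complex.exp_add, Complex.exp_int_mul_two_pi_mul_I, mul_one, Complex.exp_log hb0]
  have h2 : (Complex.log b + n * (2 * Real.pi * Complex.I)).re < 0 := by
    have := hre b hb hb0
    simpa using this
  have h3 := hinj (show (Complex.log a).re < 0 from hre a ha ha0) h2 (by
    simp only [hper, Complex.exp_log ha0]
    linear_combination hn)
  rw [← hper, ← h3, Complex.exp_log ha0]

theorem injOn_killingMap : InjOn killingMap (ball 0 1) :=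
  injOn_of_re_euler_pos differentiableOn_killingMap killingMap_eq_mul_dslope
    (fun _ ↦ dslope_killingMap_ne_zero) fun _ ↦ re_euler_quotient_pos

theorem isSymmetricConformal_killingMap {c : ℝ} (hc : 0 < c) :
    IsSymmetricConformal fun z ↦ (c : ℂ) * killingMap z where
  diff := differentiableOn_killingMap.const_mul _
  inj := fun a ha b hb hab ↦ injOn_killingMap ha hb
    (mul_left_cancel₀ (Complex.ofReal_ne_zero.2 hc.ne') hab)
  zero := by rw [killingMap_zero, mul_zero]
  deriv_ne_zero := fun z hz ↦ by
    rw [deriv_const_mul _ (differentiableOn_killingMap.differentiableAt (isOpen_ball.mem_nhds hz))]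
    exact mul_ne_zero (Complex.ofReal_ne_zero.2 hc.ne') (deriv_killingMap_ne_zero hz)
  deriv_zero := ⟨c, hc, by
    rw [deriv_const_mul _ (differentiableOn_killingMap.differentiableAt
      (isOpen_ball.mem_nhds (mem_ball_self one_pos))), deriv_killingMap_zero, mul_one]⟩
  conj_map := fun z hz ↦ by rw [killingMap_conj hz, map_mul, Complex.conj_ofReal]

end HeleShaw

namespace HeleShaw
open Filter Set Metric ComplexConjugate Asymptotics InnerProductSpace

/-! ### Injectivity of the explicit map on the closed disk -/

theorem two_mul_circleLog {c s : ℝ} (h : c ^ 2 + s ^ 2 = 1) (hc : 0 < c) :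
    2 * circleLog c s = (Real.log (1 + s) - Real.log (1 - s)) / 2 := by
  have h1 : 0 < 1 + s := by nlinarith
  have h2 : 0 < 1 - s := by nlinarith
  have h3 : 2 * Real.log c = Real.log (1 + s) + Real.log (1 - s) := by
    rw [← Real.log_mul h1.ne' h2.ne', show (1 + s) * (1 - s) = c ^ 2 by linarith, Real.log_pow]
    push_cast; rfl
  rw [circleLog, Real.log_div h1.ne' hc.ne']
  linarith

/-- The cotangent of the argument of `killingMap` on the upper half of the unit circle, up to a
constant. -/
noncomputable def circleCot (s : ℝ) : ℝ :=
  1 / s - (Real.log (1 + s) - Real.log (1 - s)) / 2 - 1 / (3 * ((1 - s ^ 2) * s))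

theorem hasDerivAt_circleCot {s : ℝ} (h0 : 0 < s) (h1 : s < 1) :
    HasDerivAt circleCot (-2 / (3 * s ^ 2 * (1 - s ^ 2) ^ 2)) s := by
  have hs := hasDerivAt_id' s
  have e1 : 1 + s ≠ 0 := by positivity
  have e2 : 1 - s ≠ 0 := by linarith
  have e3 : (1 - s ^ 2) ≠ 0 := by nlinarith
  have hL := ((hs.const_add 1).log e1).sub ((hs.const_sub 1).log e2) |>.div_const 2
  have hM := (((hs.pow 2).const_sub 1).mul hs).const_mul 3
  have := ((hs.inv h0.ne').sub hL).sub (hM.inv (mul_ne_zero three_ne_zero (mul_ne_zero e3 h0.ne')))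
  refine (this.congr_of_eventuallyEq (.of_eq ?_)).congr_deriv ?_
  · funext t
    simp [circleCot]
  · simp only [Pi.mul_apply, Pi.pow_apply, Nat.cast_ofNat]
    rw [show (1 : ℝ) - s ^ 2 = (1 + s) * (1 - s) by ring]
    field_simp
    ring

theorem circleCot_strictAntiOn : StrictAntiOn circleCot (Ioo 0 1) := by
  refine strictAntiOn_of_deriv_neg (convex_Ioo 0 1)
    (fun s hs ↦ (hasDerivAt_circleCot hs.1 hs.2).continuousAt.continuousWithinAt) fun s hs ↦ ?_
  rw [interior_Ioo] at hs
  rw [(hasDerivAt_circleCot hs.1 hs.2).deriv]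
  have := hs.1
  have : 0 < 1 - s ^ 2 := by nlinarith [hs.2]
  exact div_neg_of_neg_of_pos (by norm_num) (by positivity)

/-- The ratio of real to imaginary part of the map is a constant multiple of `circleCot s`, which is
strictly decreasing: the argument is monotone on the upper half circle. The common `s` then gives
the common `c`. -/
theorem eq_of_circle_values {c s c' s' : ℝ} (h : c ^ 2 + s ^ 2 = 1) (hc : 0 < c) (hs : 0 < s)
    (h' : c' ^ 2 + s' ^ 2 = 1) (hc' : 0 < c') (hs' : 0 < s')
    (hre : c ^ 2 * (1 - 2 * s * circleLog c s) = c' ^ 2 * (1 - 2 * s' * circleLog c' s'))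
    (him : c ^ 2 * s = c' ^ 2 * s') : c = c' ∧ s = s' := by
  have key : ∀ c s : ℝ, c ^ 2 + s ^ 2 = 1 → 0 < c → 0 < s →
      circleCot s = (c ^ 2 * (1 - 2 * s * circleLog c s) - 1 / 3) / (c ^ 2 * s) := by
    intro c s h hc hs
    rw [circleCot, ← two_mul_circleLog h hc, show 1 - s ^ 2 = c ^ 2 by linarith]
    field_simp
  have hlt : ∀ c s : ℝ, c ^ 2 + s ^ 2 = 1 → 0 < c → s < 1 := fun c s h hc ↦ by nlinarith
  have hss : s = s' := circleCot_strictAntiOn.injOn ⟨hs, hlt c s h hc⟩ ⟨hs', hlt c' s' h' hc'⟩ (by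
    rw [key c s h hc hs, key c' s' h' hc' hs', hre, him])
  subst hss
  refine ⟨?_, rfl⟩
  have : c ^ 2 = c' ^ 2 := by linarith
  exact (pow_left_inj₀ hc.le hc'.le two_ne_zero).1 this

/-- The imaginary part has the sign of `s`, so the two halves of the circle have disjoint images;
the lower half reduces to the upper by oddness of `circleLog` in `s`. The points `s = 0` and `-1`
are separated by their real values. -/
theorem killingMap_injOn_sphere : InjOn killingMap (sphere 0 1) := by
  have h1 : ∀ z : ℂ, ‖z‖ = 1 → z ≠ -1 → killingMap z ≠ killingMap (-1) := by
    intro z hz hz1 heq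
    obtain ⟨c, s, h, hc, rfl⟩ := exists_circle_eq hz hz1
    rw [killingMap_circle h hc, killingMap_neg_one] at heq
    have him := congrArg Complex.im heq
    have hre := congrArg Complex.re heq
    rw [show (-5 / 8 : ℂ) = ((-5 / 8 : ℝ) : ℂ) by norm_num] at him hre
    simp only [Complex.mul_re, Complex.add_re, Complex.add_im, Complex.mul_im, Complex.ofReal_re,
      Complex.ofReal_im, Complex.I_re, Complex.I_im] at him hre
    have hs : s = 0 := by
      have : 15 * Real.pi / 16 * c ^ 2 * s = 0 := by linarith
      exact (mul_eq_zero.1 this).resolve_left (by positivity)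
    subst hs
    have : c ^ 2 = 0 := by linarith
    exact hc.ne' (by simpa using this)
  intro z hz z' hz' heq
  rw [mem_sphere_zero_iff_norm] at hz hz'
  by_cases e1 : z = -1
  · by_contra hne
    exact h1 z' hz' (fun h ↦ hne (e1.trans h.symm)) (by rw [← heq, e1])
  by_cases e2 : z' = -1
  · exact absurd (by rw [heq, e2]) (h1 z hz e1)
  obtain ⟨c, s, h, hc, rfl⟩ := exists_circle_eq hz e1
  obtain ⟨c', s', h', hc', rfl⟩ := exists_circle_eq hz' e2
  rw [killingMap_circle h hc, killingMap_circle h' hc'] at heq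
  have him := congrArg Complex.im heq
  have hre := congrArg Complex.re heq
  simp only [Complex.mul_re, Complex.add_re, Complex.add_im, Complex.mul_im, Complex.ofReal_re,
    Complex.ofReal_im, Complex.I_re, Complex.I_im] at him hre
  replace him : c ^ 2 * s = c' ^ 2 * s' := by
    have hp : 15 * Real.pi / 16 ≠ 0 := by positivity
    exact mul_left_cancel₀ hp (by linarith)
  replace hre : c ^ 2 * (1 - 2 * s * circleLog c s) = c' ^ 2 * (1 - 2 * s' * circleLog c' s') := by
    linarith
  have hcs : c = c' ∧ s = s' := by
    rcases lt_trichotomy s 0 with hs | hs | hs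
    · have hs' : s' < 0 := by
        by_contra! hcon
        have : 0 ≤ c' ^ 2 * s' := by positivity
        have : c ^ 2 * s < 0 := mul_neg_of_pos_of_neg (by positivity) hs
        linarith
      have hodd : ∀ c s : ℝ, c ^ 2 + s ^ 2 = 1 → 0 < c → circleLog c (-s) = -circleLog c s := by
        intro c s h hc
        have e1 := two_mul_circleLog h hc
        have e2 := two_mul_circleLog (s := -s) (by rwa [neg_sq]) hc
        rw [sub_neg_eq_add, ← sub_eq_add_neg] at e2
        linarith
      have := eq_of_circle_values (s := -s) (s' := -s') (by rwa [neg_sq]) hc (by linarith)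
        (by rwa [neg_sq]) hc' (by linarith) (by rw [hodd c s h hc, hodd c' s' h' hc']; linarith)
        (by linarith)
      exact ⟨this.1, neg_injective this.2⟩
    · subst hs
      have hs' : s' = 0 := by
        rw [mul_zero] at him
        exact (mul_eq_zero.1 him.symm).resolve_left (by positivity)
      subst hs'
      exact ⟨(pow_left_inj₀ hc.le hc'.le two_ne_zero).1 (by linarith), rfl⟩
    · have hs' : 0 < s' := by
        by_contra! hcon
        have : c' ^ 2 * s' ≤ 0 := mul_nonpos_of_nonneg_of_nonpos (by positivity) hcon
        have : 0 < c ^ 2 * s := by positivity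
        linarith
      exact eq_of_circle_values h hc hs h' hc' hs' hre him
  rw [hcs.1, hcs.2]

/-- Boundary values of a univalent function are not attained inside. -/
theorem ne_of_tendsto_of_injOn {f : ℂ → ℂ} {U : Set ℂ} (hU : IsOpen U)
    (hd : DifferentiableOn ℂ f U) (hinj : InjOn f U) (hder : ∀ z ∈ U, deriv f z ≠ 0)
    {z b v : ℂ} (hz : z ∈ U) (hb : b ∈ frontier U) (hv : Tendsto f (𝓝[U] b) (𝓝 v)) :
    f z ≠ v := by
  rintro rfl
  have hne : z ≠ b := by
    rintro rfl
    rw [hU.frontier_eq] at hb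
    exact hb.2 hz
  have : (𝓝[U] b).NeBot := mem_closure_iff_nhdsWithin_neBot.1 (frontier_subset_closure hb)
  obtain ⟨O₁, O₂, hO₁, hO₂, hz₁, hb₂, hdisj⟩ := t2_separation hne
  have hopen : IsOpen (f '' (U ∩ O₁)) := by
    refine isOpen_image_of_deriv_ne_zero (hU.inter hO₁) (hd.mono inter_subset_left)
      fun w hw ↦ hder w hw.1
  have hmem : f '' (U ∩ O₁) ∈ 𝓝 (f z) := hopen.mem_nhds ⟨z, ⟨hz, hz₁⟩, rfl⟩
  obtain ⟨x, ⟨⟨y, hy, hyx⟩, hx⟩, hxU⟩ := ((hv.eventually hmem).and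
    (mem_nhdsWithin_of_mem_nhds (hO₂.mem_nhds hb₂))|>.and self_mem_nhdsWithin).exists
  have := hinj hy.1 hxU hyx
  subst this
  exact disjoint_left.1 hdisj hy.2 hx

theorem killingMap_injOn_closedBall : InjOn killingMap (closedBall 0 1) := by
  have key : ∀ z ∈ ball (0 : ℂ) 1, ∀ b : ℂ, ‖b‖ = 1 → killingMap z ≠ killingMap b :=
    fun z hz b hb ↦ ne_of_tendsto_of_injOn isOpen_ball differentiableOn_killingMap injOn_killingMap
      (fun _ ↦ deriv_killingMap_ne_zero) hz
      (by rw [frontier_ball _ one_ne_zero]; exact mem_sphere_zero_iff_norm.2 hb)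
      (killingMap_tendsto_circle hb)
  intro a ha b hb hab
  rcases (mem_closedBall_zero_iff.1 ha).lt_or_eq with h1 | h1 <;>
    rcases (mem_closedBall_zero_iff.1 hb).lt_or_eq with h2 | h2
  · exact injOn_killingMap (mem_ball_zero_iff.2 h1) (mem_ball_zero_iff.2 h2) hab
  · exact absurd hab (key a (mem_ball_zero_iff.2 h1) b h2)
  · exact absurd hab.symm (key b (mem_ball_zero_iff.2 h2) a h1)
  · exact killingMap_injOn_sphere (mem_sphere_zero_iff_norm.2 h1) (mem_sphere_zero_iff_norm.2 h2) hab

end HeleShaw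

namespace HeleShaw
open Filter Set Metric ComplexConjugate Asymptotics InnerProductSpace

/-! ### Conformal maps that extend univalently to the closed disk -/

/-- A symmetric conformal map of the unit disk with a univalent extension to the closed disk, which
is conformal on the circle except at `-1`, and which maps the circle across the negative half-axis
at `-1` only. -/
structure IsJordanConformal (F : ℂ → ℂ) : Prop extends IsSymmetricConformal F where
  continuousOn : ContinuousOn F (closedBall 0 1)
  injOn : InjOn F (closedBall 0 1)
  analyticAt : ∀ z : ℂ, ‖z‖ = 1 → z ≠ -1 → AnalyticAt ℂ F z
  circle_deriv_ne_zero : ∀ z : ℂ, ‖z‖ = 1 → z ≠ -1 → deriv F z ≠ 0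
  circle_mem_slitPlane : ∀ z : ℂ, ‖z‖ = 1 → z ≠ -1 → F z ∈ Complex.slitPlane
  map_neg_one : ∃ a : ℝ, 0 < a ∧ F (-1) = -a

namespace IsJordanConformal

variable {F : ℂ → ℂ}

theorem frontier_image (hF : IsJordanConformal F) :
    frontier (F '' ball 0 1) = F '' sphere 0 1 := by
  have hcl : closure (F '' ball 0 1) = F '' closedBall 0 1 := by
    refine subset_antisymm (closure_minimal (image_mono ball_subset_closedBall) ?_) ?_
    · exact ((isCompact_closedBall (0 : ℂ) 1).image_of_continuousOn hF.continuousOn).isClosed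
    · have := hF.continuousOn
      rw [← closure_ball (0 : ℂ) one_ne_zero] at this ⊢
      exact this.image_closure
  rw [hF.isOpen_image.frontier_eq, hcl, ← hF.injOn.image_sdiff_subset ball_subset_closedBall,
    closedBall_sdiff_ball]

theorem isBounded_image (hF : IsJordanConformal F) : Bornology.IsBounded (F '' ball 0 1) :=
  ((isCompact_closedBall (0 : ℂ) 1).image_of_continuousOn hF.continuousOn).isBounded.subset
    (image_mono ball_subset_closedBall)

theorem isSimplyConnected_image (hF : IsJordanConformal F) :
    IsSimplyConnected (F '' ball 0 1) := by
  have hb : IsSimplyConnected (ball (0 : ℂ) 1) := by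
    have := (convex_ball (0 : ℂ) 1).contractibleSpace ⟨0, mem_ball_self one_pos⟩
    rw [IsSimplyConnected]
    infer_instance
  have he : Topology.IsOpenEmbedding ((ball (0 : ℂ) 1).domRestrict F) := by
    refine .of_continuous_injective_isOpenMap hF.diff.continuousOn.domRestrict hF.inj.injective ?_
    intro O hO
    obtain ⟨U, hU, rfl⟩ := hO
    rw [image_domRestrict]
    exact isOpen_image_of_deriv_ne_zero (hU.inter isOpen_ball) (hF.diff.mono inter_subset_right)
      fun z hz ↦ hF.deriv_ne_zero z hz.2
  have := he.isEmbedding.toHomeomorph.toHomotopyEquiv.simplyConnectedSpace_iff.1 hb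
  rwa [range_domRestrict] at this

theorem conj_mem_image (hF : IsJordanConformal F) :
    ∀ z ∈ F '' ball 0 1, conj z ∈ F '' ball 0 1 := by
  rintro _ ⟨z, hz, rfl⟩
  exact ⟨conj z, conj_mem_ball hz, hF.conj_map z hz⟩

/-- By injectivity on the closed disk, the disk minus a neighbourhood of `ζ` has a compact image
that misses `F ζ`. So the inverse is continuous up to the boundary. -/
theorem eventually_preimage_mem (hF : IsJordanConformal F) {ζ : ℂ} {N : Set ℂ} (hN : N ∈ 𝓝 ζ)
    (hζ : ζ ∈ closedBall (0 : ℂ) 1) :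
    ∀ᶠ z in 𝓝 (F ζ), ∀ w ∈ closedBall (0 : ℂ) 1, F w = z → w ∈ N := by
  obtain ⟨O, hON, hO, hζO⟩ := _root_.mem_nhds_iff.1 hN
  have hK : IsCompact (F '' (closedBall 0 1 \ O)) :=
    ((isCompact_closedBall (0 : ℂ) 1).diff hO).image_of_continuousOn
      (hF.continuousOn.mono sdiff_subset)
  have hmem : F ζ ∉ F '' (closedBall 0 1 \ O) := by
    rintro ⟨w, hw, he⟩
    exact hw.2 (hF.injOn hw.1 hζ he ▸ hζO)
  filter_upwards [hK.isClosed.isOpen_compl.mem_nhds hmem] with z hz w hw he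
  by_contra hwN
  exact hz ⟨w, ⟨hw, fun h ↦ hwN (hON h)⟩, he⟩

theorem tendsto_invFunOn (hF : IsJordanConformal F) {ζ : ℂ} (hζ : ζ ∈ closedBall (0 : ℂ) 1) :
    Tendsto (Function.invFunOn F (ball 0 1)) (𝓝[F '' ball 0 1] (F ζ)) (𝓝 ζ) := by
  intro N hN
  rw [mem_map]
  filter_upwards [(hF.eventually_preimage_mem hN hζ).filter_mono nhdsWithin_le_nhds,
    self_mem_nhdsWithin] with z hz hz'
  exact hz _ (ball_subset_closedBall (Function.invFunOn_mem hz')) (Function.invFunOn_eq hz')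

/-- Take `ρ = log |G|` for the holomorphic local inverse `G` of `F` across the circle; its gradient
is the conjugate of the derivative of `log G`. `eventually_preimage_mem` excludes preimages
elsewhere in the disk, so near `F ζ` the domain is exactly `|G| < 1`. -/
theorem exists_isDefiningFunctionAt (hF : IsJordanConformal F) {ζ : ℂ} (hζ : ‖ζ‖ = 1)
    (h1 : ζ ≠ -1) : ∃ ρ, IsDefiningFunctionAt (F '' ball 0 1) (F ζ) ρ ∧
      gradient ρ (F ζ) = conj (ζ * deriv F ζ)⁻¹ := by
  have han := hF.analyticAt ζ hζ h1
  have hd := hF.circle_deriv_ne_zero ζ hζ h1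
  have hs := mem_slitPlane_of_norm_eq_one hζ h1
  have hζ0 := Complex.slitPlane_ne_zero hs
  have hζc : ζ ∈ closedBall (0 : ℂ) 1 := mem_closedBall_zero_iff.2 hζ.le
  set G := han.hasStrictDerivAt.localInverse F (deriv F ζ) ζ hd with hG
  have hGζ : G (F ζ) = ζ :=
    HasStrictFDerivAt.localInverse_apply_image (han.hasStrictDerivAt.hasStrictFDerivAt_equiv hd)
  have hGd : HasStrictDerivAt G (deriv F ζ)⁻¹ (F ζ) := han.hasStrictDerivAt.to_localInverse hd
  have hr : ∀ᶠ z in 𝓝 (F ζ), F (G z) = z := 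
    (han.hasStrictDerivAt.hasStrictFDerivAt_equiv hd).eventually_right_inverse
  have hl : ∀ᶠ w in 𝓝 ζ, G (F w) = w := 
    (han.hasStrictDerivAt.hasStrictFDerivAt_equiv hd).eventually_left_inverse
  have hGc : Tendsto G (𝓝 (F ζ)) (𝓝 ζ) := by
    have := hGd.hasDerivAt.continuousAt.tendsto
    rwa [hGζ] at this
  have hGC : ContDiffAt ℂ 2 G (F ζ) :=
    han.contDiffAt.to_localInverse
      (han.hasStrictDerivAt.hasStrictFDerivAt_equiv hd).hasFDerivAt two_ne_zero
  have hder : HasDerivAt (fun z ↦ Complex.log (G z)) ((deriv F ζ)⁻¹ / ζ) (F ζ) := by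
    have := hGd.hasDerivAt.clog (by rw [hGζ]; exact hs)
    rwa [hGζ] at this
  have hgrad : gradient (fun z ↦ (Complex.log (G z)).re) (F ζ) = conj (ζ * deriv F ζ)⁻¹ := by
    rw [(hasGradientAt_re hder).gradient, mul_inv_rev, div_eq_mul_inv]
  refine ⟨fun z ↦ (Complex.log (G z)).re, ⟨?_, ?_, ?_, ?_⟩, hgrad⟩
  · have : ContDiffAt ℂ 2 (fun z ↦ Complex.log (G z)) (F ζ) :=
      (Complex.contDiffAt_log (by rw [hGζ]; exact hs)).comp (F ζ) hGC
    exact Complex.reCLM.contDiff.contDiffAt.comp (F ζ) (this.restrict_scalars ℝ)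
  · simp only [hGζ, Complex.log_re, hζ, Real.log_one]
  · rw [hgrad]
    simp [hζ0, hd]
  · filter_upwards [hr, hF.eventually_preimage_mem hl hζc,
      hGc.eventually (isOpen_ne.mem_nhds hζ0)] with z hz1 hz2 hz0
    rw [Complex.log_re, Real.log_neg_iff (norm_pos_iff.2 hz0)]
    refine ⟨?_, fun h ↦ ⟨G z, mem_ball_zero_iff.2 h, hz1⟩⟩
    rintro ⟨w, hw, rfl⟩
    have : G (F w) = w := hz2 w (ball_subset_closedBall hw) rfl
    rw [this]
    exact mem_ball_zero_iff.1 hw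

theorem outwardUnitNormal_eq (hF : IsJordanConformal F) {ζ n : ℂ} (hζ : ‖ζ‖ = 1) (h1 : ζ ≠ -1)
    (hn : IsOutwardUnitNormal (F '' ball 0 1) (F ζ) n) :
    n = ‖ζ * deriv F ζ‖⁻¹ • (ζ * deriv F ζ) := by
  obtain ⟨ρ', hρ', rfl⟩ := hn
  obtain ⟨ρ, hρ, hg⟩ := hF.exists_isDefiningFunctionAt hζ h1
  have hd := hF.circle_deriv_ne_zero ζ hζ h1
  have hζ0 := Complex.slitPlane_ne_zero (mem_slitPlane_of_norm_eq_one hζ h1)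
  rw [hρ'.normal_unique hρ hF.isOpen_image, hg]
  generalize hv : ζ * deriv F ζ = v
  have hv0 : v ≠ 0 := hv ▸ mul_ne_zero hζ0 hd
  have hn0 : (‖v‖ : ℂ) ≠ 0 := by exact_mod_cast norm_ne_zero_iff.2 hv0
  rw [Complex.norm_conj, norm_inv, inv_inv, Complex.inv_def, map_mul, Complex.conj_conj,
    Complex.conj_ofReal, Complex.normSq_eq_norm_sq, Complex.real_smul, Complex.real_smul]
  push_cast
  field_simp

theorem frontier_inter_slitPlane (hF : IsJordanConformal F) {p : ℂ}
    (hp : p ∈ frontier (F '' ball 0 1) ∩ Complex.slitPlane) :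
    ∃ ζ : ℂ, ‖ζ‖ = 1 ∧ ζ ≠ -1 ∧ F ζ = p := by
  obtain ⟨hp, hs⟩ := hp
  rw [hF.frontier_image] at hp
  obtain ⟨ζ, hζ, rfl⟩ := hp
  refine ⟨ζ, mem_sphere_zero_iff_norm.1 hζ, ?_, rfl⟩
  rintro rfl
  obtain ⟨a, ha, he⟩ := hF.map_neg_one
  rw [he, Complex.mem_slitPlane_iff] at hs
  simp at hs
  linarith

theorem isRegion (hF : IsJordanConformal F) : IsRegion (F '' ball 0 1) where
  isOpen := hF.isOpen_image
  isBounded := hF.isBounded_image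
  isSimplyConnected := hF.isSimplyConnected_image
  zero_mem := ⟨0, mem_ball_self one_pos, hF.zero⟩
  conj_mem := hF.conj_mem_image
  jordan := by
    refine ⟨fun z ↦ F z, ?_, fun z z' h ↦ ?_, ?_⟩
    · exact hF.continuousOn.comp_continuous continuous_subtype_val fun z ↦
        mem_closedBall_zero_iff.2 z.norm_coe.le
    · exact Subtype.ext (hF.injOn (mem_closedBall_zero_iff.2 z.norm_coe.le)
        (mem_closedBall_zero_iff.2 z'.norm_coe.le) h)
    · rw [hF.frontier_image]
      ext p
      constructor
      · rintro ⟨z, rfl⟩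
        exact ⟨z, mem_sphere_zero_iff_norm.2 z.norm_coe, rfl⟩
      · rintro ⟨z, hz, rfl⟩
        exact ⟨⟨z, hz⟩, rfl⟩
  tip := by
    obtain ⟨a, ha, he⟩ := hF.map_neg_one
    refine ⟨a, ha, ?_⟩
    rw [hF.frontier_image]
    ext p
    constructor
    · rintro ⟨⟨z, hz, rfl⟩, hs⟩
      by_cases h1 : z = -1
      · rw [h1, he]; rfl
      · exact absurd (hF.circle_mem_slitPlane z (mem_sphere_zero_iff_norm.1 hz) h1) hs
    · rintro rfl
      refine ⟨⟨-1, by simp, he⟩, ?_⟩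
      rw [Complex.mem_slitPlane_iff]
      simp [ha.le]
  smooth := fun p hp ↦ by
    obtain ⟨ζ, hζ, h1, rfl⟩ := hF.frontier_inter_slitPlane hp
    obtain ⟨ρ, hρ, -⟩ := hF.exists_isDefiningFunctionAt hζ h1
    exact ⟨ρ, hρ⟩

/-- The normal is along `ζ F'`. After multiplication by `|ζ F'|`, the normal derivative is `Re (c
(w⁻¹ + w) / 2) = c Re w` on `|w| = 1`, and `⟪p, n⟫` becomes `k Re w`; hence the rate `c / k`. -/
theorem isSolution (hF : IsJordanConformal F) {k : ℝ} (hk : k ≠ 0)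
    (hE : ∀ w : ℂ, ‖w‖ = 1 → 0 < w.re →
      (conj (F (w ^ 2)) * (w ^ 2 * deriv F (w ^ 2))).re = k * w.re) :
    IsSolution (F '' ball 0 1) := by
  obtain ⟨c, hc, hcF⟩ := hF.toIsSymmetricConformal.exists_cpow_isEquivalent
  refine ⟨hF.isRegion, sourcePotential F c, hF.toIsSymmetricConformal.isPotential_sourcePotential hcF,
    c / k, fun p hp n hn ↦ ?_⟩
  obtain ⟨ζ, hζ, h1, rfl⟩ := hF.frontier_inter_slitPlane hp
  have hs := mem_slitPlane_of_norm_eq_one hζ h1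
  have hd := hF.circle_deriv_ne_zero ζ hζ h1
  have hdc : ContinuousAt (deriv F) ζ := (hF.analyticAt ζ hζ h1).deriv.continuousAt
  have hn' := hF.outwardUnitNormal_eq hζ h1 hn
  set w := ζ ^ (1 / 2 : ℂ) with hw
  have hw2 : w ^ 2 = ζ := cpow_half_sq ζ
  have hwre : 0 < w.re := cpow_half_re_pos hs
  have hwn : ‖w‖ = 1 := by
    rw [← hw2, norm_pow] at hζ
    nlinarith [norm_nonneg w]
  have hw0 : w ≠ 0 := by rintro h; rw [h] at hwre; exact lt_irrefl _ hwre
  refine ⟨conj (c * (1 + w ^ 2) / (2 * w ^ 3 * deriv F (w ^ 2))), ?_, ?_⟩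
  · have hT := hF.tendsto_invFunOn (mem_closedBall_zero_iff.2 hζ.le)
    have hT2 : Tendsto (sqrtInv F) (𝓝[F '' ball 0 1] (F ζ)) (𝓝 w) :=
      (continuousAt_cpow_const hs).tendsto.comp hT
    have hT3 : Tendsto (fun z ↦ conj (c * (1 + sqrtInv F z ^ 2) /
        (2 * sqrtInv F z ^ 3 * deriv F (sqrtInv F z ^ 2)))) (𝓝[F '' ball 0 1] (F ζ))
        (𝓝 (conj (c * (1 + w ^ 2) / (2 * w ^ 3 * deriv F (w ^ 2))))) := by
      refine (Complex.continuous_conj.tendsto _).comp ?_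
      refine (((hT2.pow 2).const_add 1).const_mul (c : ℂ)).div (((hT2.pow 3).const_mul 2).mul ?_) ?_
      · have : ContinuousAt (deriv F) (w ^ 2) := by rwa [hw2]
        exact this.tendsto.comp (hT2.pow 2)
      · rw [hw2]
        exact mul_ne_zero (mul_ne_zero two_ne_zero (pow_ne_zero 3 hw0)) hd
    refine hT3.congr' ?_
    filter_upwards [self_mem_nhdsWithin,
      mem_nhdsWithin_of_mem_nhds (Complex.isOpen_slitPlane.mem_nhds hp.2)] with z hz hzs
    have hm := hF.toIsSymmetricConformal.sqrtInv_mem ⟨hz, hzs⟩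
    rw [← hF.toIsSymmetricConformal.gradient_sourcePotential c hm,
      hF.toIsSymmetricConformal.apply_sqrtInv ⟨hz, hzs⟩]
  · have hE' := hE w hwn hwre
    rw [hw2] at hE'
    rw [hn', inner_smul_right, inner_smul_right, Complex.inner, Complex.inner,
      mul_comm _ (conj (F ζ)), hE', hw2, Complex.conj_conj, mul_comm (ζ * deriv F ζ)]
    have : (c * (1 + ζ) / (2 * w ^ 3 * deriv F ζ) * (ζ * deriv F ζ)).re = c * w.re := by
      have e : c * (1 + ζ) / (2 * w ^ 3 * deriv F ζ) * (ζ * deriv F ζ) = (c / 2 : ℝ) * (w⁻¹ + w) := by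
        rw [← hw2] at hd ⊢
        push_cast
        field_simp
      rw [e, Complex.re_ofReal_mul, Complex.add_re, Complex.inv_re, Complex.normSq_eq_norm_sq, hwn]
      ring
    rw [this]
    field_simp

end IsJordanConformal

theorem isJordanConformal_killingMap {c : ℝ} (hc : 0 < c) :
    IsJordanConformal fun z ↦ (c : ℂ) * killingMap z where
  toIsSymmetricConformal := isSymmetricConformal_killingMap hc
  continuousOn := continuousOn_killingMap.const_mul _
  injOn := fun a ha b hb hab ↦ killingMap_injOn_closedBall ha hb
    (mul_left_cancel₀ (Complex.ofReal_ne_zero.2 hc.ne') hab)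
  analyticAt := fun z hz h1 ↦ by
    have : DifferentiableOn ℂ (fun z ↦ (c : ℂ) * killingMap z) Complex.slitPlane := fun z hz ↦
      ((differentiableAt_killingMap hz).const_mul _).differentiableWithinAt
    exact this.analyticAt (Complex.isOpen_slitPlane.mem_nhds (mem_slitPlane_of_norm_eq_one hz h1))
  circle_deriv_ne_zero := fun z hz h1 ↦ by
    rw [deriv_const_mul _ (differentiableAt_killingMap (mem_slitPlane_of_norm_eq_one hz h1))]
    refine mul_ne_zero (Complex.ofReal_ne_zero.2 hc.ne') fun h ↦ ?_
    have := re_euler_quotient_circle hz h1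
    rw [h, mul_zero, zero_div] at this
    exact lt_irrefl _ this
  circle_mem_slitPlane := fun z hz h1 ↦ by
    obtain ⟨x, s, h, hx, rfl⟩ := exists_circle_eq hz h1
    rw [killingMap_circle h hx, Complex.mem_slitPlane_iff]
    simp only [Complex.mul_re, Complex.add_re, Complex.add_im, Complex.mul_im, Complex.ofReal_re,
      Complex.ofReal_im, Complex.I_re, Complex.I_im]
    by_cases hs : s = 0
    · left
      subst hs
      have : x ^ 2 = 1 := by linarith
      rw [this]
      linarith
    · right
      have : c * (15 * Real.pi / 16 * x ^ 2 * s) ≠ 0 := by positivity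
      intro h0
      apply this
      linarith
  map_neg_one := ⟨5 / 8 * c, by positivity, by rw [killingMap_neg_one]; push_cast; ring⟩

theorem isSolution_killingMap {c : ℝ} (hc : 0 < c) :
    IsSolution ((fun z ↦ (c : ℂ) * killingMap z) '' ball 0 1) := by
  refine (isJordanConformal_killingMap hc).isSolution (k := c ^ 2 * (75 * Real.pi / 128))
    (by positivity) fun w hw hre ↦ ?_
  have hs := sq_mem_slitPlane hre
  have h := re_conj_killingMap_mul_killingEuler (c := w.re) (s := w.im) (by
    rw [← one_pow 2, ← hw, ← Complex.normSq_eq_norm_sq, Complex.normSq_apply]; ring) hre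
  rw [Complex.re_add_im, ← mul_deriv_killingMap hre] at h
  rw [deriv_const_mul _ (differentiableAt_killingMap hs), map_mul, Complex.conj_ofReal]
  have : (c : ℂ) * conj (killingMap (w ^ 2)) * (w ^ 2 * (c * deriv killingMap (w ^ 2))) =
      ((c ^ 2 : ℝ) : ℂ) * (conj (killingMap (w ^ 2)) * (w ^ 2 * deriv killingMap (w ^ 2))) := by
    push_cast; ring
  rw [this, Complex.re_ofReal_mul, h]
  ring

end HeleShaw

namespace HeleShaw
open Filter Set Metric ComplexConjugate Asymptotics InnerProductSpace

/-! ### Uniqueness of the potential -/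

theorem frontier_inter_slitPlane_subset {Ω : Set ℂ} (hΩ : IsOpen Ω) {p : ℂ}
    (hp : p ∈ frontier (Ω ∩ Complex.slitPlane)) : p ∈ frontier Ω ∨ p ∈ Ω \ Complex.slitPlane := by
  rw [(hΩ.inter Complex.isOpen_slitPlane).frontier_eq] at hp
  by_cases h : p ∈ Ω
  · exact .inr ⟨h, fun hs ↦ hp.2 ⟨h, hs⟩⟩
  · left
    rw [hΩ.frontier_eq]
    exact ⟨closure_mono inter_subset_left hp.1, h⟩

theorem cpow_neg_half_re_nonneg {z : ℂ} (hz : z ∈ Complex.slitPlane) :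
    0 ≤ (z ^ (-(1 / 2) : ℂ)).re := by
  rw [Complex.cpow_neg, Complex.inv_re]
  exact div_nonneg (cpow_half_re_pos hz).le (Complex.normSq_nonneg _)

/-- `Re z ^ (-1/2)` is nonnegative and harmonic on the slit plane, and the difference of two
potentials is small compared with it at the origin. So it is the barrier for the source; all other
boundary limits are zero. -/
theorem IsPotential.le {Ω : Set ℂ} (hΩ : IsOpen Ω) (hb : Bornology.IsBounded Ω) {Φ Ψ : ℂ → ℝ}
    (h : IsPotential Ω Φ) (h' : IsPotential Ω Ψ) {z : ℂ} (hz : z ∈ Ω ∩ Complex.slitPlane) :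
    Φ z ≤ Ψ z := by
  have hV := hΩ.inter Complex.isOpen_slitPlane
  have hB : HarmonicOnNhd (fun z : ℂ ↦ (z ^ (-(1 / 2) : ℂ)).re) (Ω ∩ Complex.slitPlane) :=
    fun z hz ↦ AnalyticAt.harmonicAt_re
      ((analyticAt_id (𝕜 := ℂ) (z := z)).cpow analyticAt_const hz.2)
  have key := harmonic_nonpos_of_barrier hV (hb.subset inter_subset_left)
    (h.harmonic.sub h'.harmonic) hB (fun p hp ε hε η hη ↦ ?_) z hz
  · simpa using key
  have hB₀ : ∀ᶠ z in 𝓝[Ω ∩ Complex.slitPlane] p, 0 ≤ (z ^ (-(1 / 2) : ℂ)).re := by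
    filter_upwards [self_mem_nhdsWithin] with z hz
    exact cpow_neg_half_re_nonneg hz.2
  have hzero : Tendsto Φ (𝓝[Ω ∩ Complex.slitPlane] p) (𝓝 0) →
      Tendsto Ψ (𝓝[Ω ∩ Complex.slitPlane] p) (𝓝 0) →
      ∀ᶠ z in 𝓝[Ω ∩ Complex.slitPlane] p, (Φ - Ψ) z ≤ ε + η * (z ^ (-(1 / 2) : ℂ)).re := by
    intro h1 h2
    have := h1.sub h2
    rw [sub_zero] at this
    filter_upwards [this.eventually (gt_mem_nhds hε), hB₀] with z hz hz'
    have := mul_nonneg hη.le hz'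
    rw [Pi.sub_apply]
    linarith
  rcases frontier_inter_slitPlane_subset hΩ hp with hp' | hp'
  · exact hzero (h.zero_on_boundary p hp') (h'.zero_on_boundary p hp')
  by_cases hp0 : p = 0
  · subst hp0
    have h1 := (h.at_zero.isLittleO.sub h'.at_zero.isLittleO).neg_right
    filter_upwards [h1.bound hη, hB₀] with z hz hz'
    simp only [Pi.sub_apply, sub_sub_sub_cancel_right, neg_neg] at hz
    rw [Real.norm_of_nonneg hz'] at hz
    have := le_abs_self (Φ z - Ψ z)
    rw [Real.norm_eq_abs] at hz
    rw [Pi.sub_apply]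
    linarith
  · exact hzero (h.zero_on_axis p hp' hp0) (h'.zero_on_axis p hp' hp0)

theorem IsPotential.eq {Ω : Set ℂ} (hΩ : IsOpen Ω) (hb : Bornology.IsBounded Ω) {Φ Ψ : ℂ → ℝ}
    (h : IsPotential Ω Φ) (h' : IsPotential Ω Ψ) {z : ℂ} (hz : z ∈ Ω ∩ Complex.slitPlane) :
    Φ z = Ψ z :=
  le_antisymm (h.le hΩ hb h' hz) (h'.le hΩ hb h hz)

/-! ### The Hopf boundary point lemma -/

/-- Harnack's inequality for negative harmonic functions on a disk. -/
theorem harmonic_le_of_neg {u : ℂ → ℝ} {c z : ℂ} {r : ℝ} (hu : HarmonicOnNhd u (ball c r))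
    (hneg : ∀ z ∈ ball c r, u z < 0) (hz : z ∈ ball c r) :
    u z * (r + dist z c) ≤ u c * (r - dist z c) := by
  have hr : 0 < r := dist_nonneg.trans_lt hz
  have hc : c ∈ ball c r := mem_ball_self hr
  obtain ⟨F, hF, hFu⟩ := HarmonicOnNhd.exists_analyticOnNhd_ball_re_eq hu
  have hne : ∀ z ∈ ball c r, F z + conj (F c) ≠ 0 := fun z hz h ↦ by
    have h1 := congrArg Complex.re h
    have h2 : (F z).re = u z := hFu hz
    have h3 : (F c).re = u c := hFu hc
    simp only [Complex.add_re, Complex.conj_re, Complex.zero_re, h2, h3] at h1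
    linarith [hneg z hz, hneg c hc]
  have hmain : ∀ z ∈ ball c r, Complex.normSq (F z - F c) =
      Complex.normSq (F z + conj (F c)) - 4 * (u z * u c) := fun z hz ↦ by
    have h2 : (F z).re = u z := hFu hz
    have h3 : (F c).re = u c := hFu hc
    rw [← h2, ← h3, Complex.normSq_apply, Complex.normSq_apply]
    simp
    ring
  -- The Cayley transform sends the left half-plane to the disk and `F c` to `0`, so Schwarz
  -- applies.
  have hmaps : MapsTo (fun z ↦ (F z - F c) / (F z + conj (F c))) (ball c r) (ball 0 1) := by
    intro z hz
    rw [mem_ball_zero_iff, norm_div, div_lt_one (norm_pos_iff.2 (hne z hz)), ← sq_lt_sq₀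
      (norm_nonneg _) (norm_nonneg _), ← Complex.normSq_eq_norm_sq, ← Complex.normSq_eq_norm_sq,
      hmain z hz]
    linarith [mul_pos_of_neg_of_neg (hneg z hz) (hneg c hc)]
  have hd : DifferentiableOn ℂ (fun z ↦ (F z - F c) / (F z + conj (F c))) (ball c r) :=
    (hF.differentiableOn.sub_const _).div (hF.differentiableOn.add_const _) hne
  have hs := Complex.dist_le_div_mul_dist_of_mapsTo_ball hd (by
    simpa using (hmaps.mono_right ball_subset_closedBall)) hz
  rw [sub_self, zero_div, dist_zero_right, norm_div, div_le_iff₀ (norm_pos_iff.2 (hne z hz))] at hs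
  set d := dist z c with hd'
  have hd0 : 0 ≤ d := dist_nonneg
  have hdr : d < r := hz
  have hN := hmain z hz
  rw [Complex.normSq_eq_norm_sq, Complex.normSq_eq_norm_sq] at hN
  set A := ‖F z - F c‖
  set B := ‖F z + conj (F c)‖ with hB
  have hB1 : -(u z + u c) ≤ B := by
    have h2 : (F z).re = u z := hFu hz
    have h3 : (F c).re = u c := hFu hc
    have := (abs_le.1 (Complex.abs_re_le_norm (F z + conj (F c)))).1
    simp only [Complex.add_re, Complex.conj_re, h2, h3] at this
    linarith
  have hs' : r * A ≤ d * B := by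
    have := mul_le_mul_of_nonneg_left hs hr.le
    refine this.trans_eq ?_
    field_simp
  have hx := hneg z hz
  have hy := hneg c hc
  have hA0 : 0 ≤ A := norm_nonneg _
  have h1 : r ^ 2 * (B ^ 2 - 4 * (u z * u c)) ≤ d ^ 2 * B ^ 2 := by
    rw [← hN]
    nlinarith [mul_nonneg hr.le hA0]
  have h2 : (r ^ 2 - d ^ 2) * (u z + u c) ^ 2 ≤ r ^ 2 * (4 * (u z * u c)) := by
    have : (u z + u c) ^ 2 ≤ B ^ 2 := by nlinarith
    nlinarith [mul_le_mul_of_nonneg_left this (show 0 ≤ r ^ 2 - d ^ 2 by nlinarith)]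
  -- The inequality `h2` says that the product of `u z (r + d) - u c (r - d)` and `u z (r - d) - u c
  -- (r + d)` is nonpositive; if the first factor is positive, so is the second.
  by_contra! hcon
  have h3 : u c * (r + d) < u z * (r - d) := by
    nlinarith
  nlinarith [mul_pos (sub_pos.2 hcon) (sub_pos.2 h3)]

/-- A domain with a `C²` boundary has an interior tangent disk. -/
theorem IsDefiningFunctionAt.exists_ball_subset {Ω : Set ℂ} {p : ℂ} {ρ : ℂ → ℝ}
    (h : IsDefiningFunctionAt Ω p ρ) {W : Set ℂ} (hW : W ∈ 𝓝 p) :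
    ∃ (r : ℝ) (n : ℂ), 0 < r ∧ ‖n‖ = 1 ∧ ball (p - r * n) r ⊆ Ω ∩ W := by
  obtain ⟨C, s, hs, hlip⟩ :=
    (h.contDiffAt.fderiv_right (m := 1) (by norm_num)).exists_lipschitzOnWith
  have hev := (((h.contDiffAt.eventually (by simp)).and h.mem_iff).and hW).and hs
  obtain ⟨δ, hδ, hball⟩ := Metric.mem_nhds_iff.1 hev
  set N := gradient ρ p with hN
  have hN0 : 0 < ‖N‖ := norm_pos_iff.2 h.gradient_ne_zero
  have hNc : (‖N‖ : ℂ) ≠ 0 := by exact_mod_cast hN0.ne'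
  -- The first bound keeps the tangent disk in the good ball. The second makes the linear term,
  -- which exceeds `‖x‖² ‖N‖ / (2 r)` in absolute value on the disk, dominate the Taylor error `C
  -- ‖x‖²`.
  set r := min (δ / 4) (‖N‖ / (2 * (C + 1))) with hr
  have hr0 : 0 < r := lt_min (by positivity) (by positivity)
  have hr1 : r ≤ δ / 4 := min_le_left _ _
  have hr2 : 2 * r * (C + 1) ≤ ‖N‖ := by
    have : r ≤ ‖N‖ / (2 * (C + 1)) := min_le_right _ _
    rw [le_div_iff₀ (by positivity)] at this
    linarith
  refine ⟨r, ‖N‖⁻¹ • N, hr0, by rw [norm_smul, norm_inv, norm_norm, inv_mul_cancel₀ hN0.ne'],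
    fun z hz ↦ ?_⟩
  set x := z - p with hx
  have hxr : ‖x + r * (‖N‖⁻¹ • N)‖ < r := by
    rw [mem_ball, dist_eq_norm] at hz
    rwa [hx, show z - p + r * (‖N‖⁻¹ • N) = z - (p - r * (‖N‖⁻¹ • N)) by ring]
  have hxn : ‖x‖ < 2 * r := by
    have h1 : ‖(r : ℂ) * (‖N‖⁻¹ • N)‖ = r := by
      rw [norm_mul, norm_smul, norm_inv, norm_norm, inv_mul_cancel₀ hN0.ne', mul_one,
        Complex.norm_real, Real.norm_of_nonneg hr0.le]
    have := norm_sub_le (x + r * (‖N‖⁻¹ • N)) (r * (‖N‖⁻¹ • N))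
    rw [add_sub_cancel_right, h1] at this
    linarith
  have hzδ : z ∈ ball p δ := by
    rw [mem_ball, dist_eq_norm]
    linarith
  have hinner : ‖x‖ ^ 2 * ‖N‖ < -(2 * r * inner ℝ N x) := by
    have h1 : ‖x + r * (‖N‖⁻¹ • N)‖ ^ 2 < r ^ 2 := by
      have := norm_nonneg (x + r * (‖N‖⁻¹ • N))
      nlinarith
    have h2 : (r : ℂ) * (‖N‖⁻¹ • N) = (r * ‖N‖⁻¹) • N := by
      rw [Complex.real_smul, Complex.real_smul]; push_cast; ring
    rw [h2, norm_add_sq_real, inner_smul_right, norm_smul, norm_mul, norm_inv, norm_norm,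
      inv_mul_cancel_right₀ hN0.ne', Real.norm_of_nonneg hr0.le, real_inner_comm] at h1
    have h3 : ‖x‖ ^ 2 < -(2 * (r * ‖N‖⁻¹ * inner ℝ N x)) := by linarith
    have h4 := mul_lt_mul_of_pos_right h3 hN0
    refine h4.trans_eq ?_
    field_simp
  have htaylor : ‖ρ z - ρ p - fderiv ℝ ρ p (z - p)‖ ≤ C * ‖x‖ * ‖z - p‖ := by
    have hsub : closedBall p ‖x‖ ⊆ ball p δ := closedBall_subset_ball (by linarith)
    refine (convex_closedBall p ‖x‖).norm_image_sub_le_of_norm_hasFDerivWithin_le'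
      (f' := fderiv ℝ ρ) (fun y hy ↦ ?_) (fun y hy ↦ ?_) (mem_closedBall_self (norm_nonneg _)) ?_
    · exact ((hball (hsub hy)).1.1.1.differentiableAt two_ne_zero).hasFDerivAt.hasFDerivWithinAt
    · have := hlip.dist_le_mul y (hball (hsub hy)).2 p (mem_of_mem_nhds hs)
      rw [dist_eq_norm] at this
      exact this.trans (mul_le_mul_of_nonneg_left hy C.2)
    · rw [mem_closedBall, dist_eq_norm]
  rw [h.eq_zero, sub_zero, fderiv_eq_inner_gradient, ← hN, ← hx, Real.norm_eq_abs] at htaylor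
  have h5 := (abs_le.1 htaylor).2
  refine ⟨((hball hzδ).1.1.2).2 ?_, (hball hzδ).1.2⟩
  have h6 : 2 * r * ρ z < 0 := by
    have : 2 * r * (C * ‖x‖ * ‖x‖) ≤ ‖x‖ ^ 2 * ‖N‖ := by
      have : (2 * r * C) ≤ ‖N‖ := by linarith
      nlinarith [sq_nonneg ‖x‖]
    nlinarith
  by_contra! hcon
  have : 0 ≤ 2 * r * ρ z := by positivity
  linarith

/-- A negative harmonic function has a nonzero boundary gradient wherever it vanishes. -/
theorem IsDefiningFunctionAt.gradient_limit_ne_zero {Ω : Set ℂ} {p : ℂ} {ρ : ℂ → ℝ}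
    (h : IsDefiningFunctionAt Ω p ρ) {W : Set ℂ} (hW : W ∈ 𝓝 p) {u : ℂ → ℝ}
    (hu : HarmonicOnNhd u (Ω ∩ W)) (hneg : ∀ z ∈ Ω ∩ W, u z < 0) (h0 : Tendsto u (𝓝[Ω] p) (𝓝 0))
    {L : ℂ →L[ℝ] ℝ} (hL : Tendsto (fderiv ℝ u) (𝓝[Ω] p) (𝓝 L)) : L ≠ 0 := by
  rintro rfl
  obtain ⟨r, n, hr, hn, hsub⟩ := h.exists_ball_subset hW
  have hd : ∀ᶠ z in 𝓝[Ω] p, DifferentiableAt ℝ u z := by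
    filter_upwards [self_mem_nhdsWithin, mem_nhdsWithin_of_mem_nhds hW] with z hz hz'
    exact (hu z ⟨hz, hz'⟩).1.differentiableAt two_ne_zero
  set c := p - r * n with hc
  have hc0 : u c < 0 := hneg c (hsub (mem_ball_self hr))
  -- If the gradient limit were zero, `u` would be `o(s)` at depth `s` on the normal. Harnack gives
  -- `-u ≥ (-u c) s / (2 r - s)`, which beats the slope `-u c / (4 r)` chosen here.
  have ho := (isLittleO_iff.1 (h.isLittleO_of_tendsto_fderiv hd hL))
    (show 0 < -u c / (4 * r) by apply div_pos <;> linarith)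
  obtain ⟨t, ht, htt⟩ := Filter.mem_prod_same_iff.1 ho
  have hpath : Tendsto (fun s : ℝ ↦ p - s * n) (𝓝[Ioo 0 r] 0) (𝓝[Ω] p) := by
    refine tendsto_nhdsWithin_iff.2 ⟨?_, ?_⟩
    · have : Continuous fun s : ℝ ↦ p - s * n := by fun_prop
      have := this.tendsto 0
      rw [Complex.ofReal_zero, zero_mul, sub_zero] at this
      exact this.mono_left nhdsWithin_le_nhds
    · filter_upwards [self_mem_nhdsWithin] with s hs
      refine (hsub ?_).1
      rw [mem_ball, dist_eq_norm, hc, show p - s * n - (p - r * n) = ((r - s : ℝ) : ℂ) * n by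
        push_cast; ring, norm_mul, hn, mul_one, Complex.norm_real,
        Real.norm_of_nonneg (by linarith [hs.2])]
      linarith [hs.1]
  have hne : (𝓝[Ioo 0 r] (0 : ℝ)).NeBot := by
    rw [← mem_closure_iff_nhdsWithin_neBot, closure_Ioo hr.ne]
    exact ⟨le_rfl, hr.le⟩
  have hpΩ : (𝓝[Ω] p).NeBot := (hne.map _).mono hpath
  obtain ⟨s, hs, hs'⟩ := ((hpath.eventually ht).and self_mem_nhdsWithin).exists
  have hle : ‖u (p - s * n)‖ ≤ -u c / (4 * r) * s := by
    have h1 : ∀ᶠ q in 𝓝[Ω] p, ‖u (p - s * n) - u q‖ ≤ -u c / (4 * r) * ‖(p - s * n) - q‖ := by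
      filter_upwards [ht] with q hq
      have := htt (mk_mem_prod hs hq)
      simpa using this
    have t1 : Tendsto (fun q ↦ ‖u (p - s * n) - u q‖) (𝓝[Ω] p) (𝓝 ‖u (p - s * n) - 0‖) :=
      (h0.const_sub _).norm
    have t2 : Tendsto (fun q ↦ -u c / (4 * r) * ‖(p - s * n) - q‖) (𝓝[Ω] p)
        (𝓝 (-u c / (4 * r) * ‖(p - s * n) - p‖)) :=
      ((tendsto_id.mono_left nhdsWithin_le_nhds).const_sub _).norm.const_mul _
    have := le_of_tendsto_of_tendsto t1 t2 h1
    rwa [sub_zero, sub_sub_cancel_left, norm_neg, norm_mul, hn, mul_one, Complex.norm_real,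
      Real.norm_of_nonneg hs'.1.le] at this
  have hdist : dist (p - s * n) c = r - s := by
    rw [dist_eq_norm, hc, show p - s * n - (p - r * n) = ((r - s : ℝ) : ℂ) * n by
        push_cast; ring, norm_mul, hn, mul_one, Complex.norm_real,
        Real.norm_of_nonneg (by linarith [hs'.2])]
  have hH := harmonic_le_of_neg (hu.mono hsub) (fun z hz ↦ hneg z (hsub hz))
    (show p - s * n ∈ ball c r by rw [mem_ball, hdist]; linarith [hs'.1])
  rw [hdist, show r + (r - s) = 2 * r - s by ring, sub_sub_cancel] at hH
  have h3 := (abs_le.1 hle).1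
  have h4 : -u c / (4 * r) * s * (4 * r) = -u c * s := by field_simp
  have h5 : u c * s ≤ u (p - s * n) * (4 * r) := by
    have := mul_le_mul_of_nonneg_right h3 (show (0 : ℝ) ≤ 4 * r by linarith)
    linarith
  have h6 : u c * s < 0 := mul_neg_of_neg_of_pos hc0 hs'.1
  have h7 := mul_le_mul_of_nonneg_right h5 (show 0 ≤ 2 * r - s by linarith [hs'.2])
  have h8 := mul_le_mul_of_nonneg_right hH (show (0 : ℝ) ≤ 4 * r by linarith)
  have h9 := mul_neg_of_neg_of_pos h6 (show 0 < 2 * r + s by linarith [hs'.1])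
  linarith

end HeleShaw

namespace HeleShaw
open Filter Set Metric ComplexConjugate Asymptotics InnerProductSpace

/-! ### The free boundary condition in conformal coordinates -/

theorem isPreconnected_compl_singleton_circle (z : Circle) : IsPreconnected ({z}ᶜ : Set Circle) := by
  obtain ⟨θ, rfl⟩ := Circle.exp_surjective z
  have : ({Circle.exp θ}ᶜ : Set Circle) = Circle.exp '' Ioo θ (θ + 2 * Real.pi) := by
    ext w
    simp only [mem_compl_iff, mem_singleton_iff, mem_image]
    constructor
    · intro hw
      obtain ⟨t, rfl⟩ := Circle.exp_surjective w
      have hmem := toIcoMod_mem_Ico Real.two_pi_pos θ t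
      have heq : Circle.exp (toIcoMod Real.two_pi_pos θ t) = Circle.exp t :=
        Circle.exp_eq_exp.2 ⟨-toIcoDiv Real.two_pi_pos θ t, by
          rw [toIcoMod]; push_cast; rw [zsmul_eq_mul]; ring⟩
      refine ⟨_, ⟨lt_of_le_of_ne hmem.1 fun h ↦ hw ?_, hmem.2⟩, heq⟩
      rw [← heq, ← h]
    · rintro ⟨t, ht, rfl⟩ h
      obtain ⟨m, hm⟩ := Circle.exp_eq_exp.1 h
      have hπ := Real.two_pi_pos
      have h1 : (0 : ℝ) < m := by
        by_contra! hle
        have := mul_nonpos_of_nonpos_of_nonneg hle hπ.le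
        linarith [ht.1]
      have h2 : (m : ℝ) < 1 := by
        by_contra! hle
        have := mul_le_mul_of_nonneg_right hle hπ.le
        linarith [ht.2]
      have h3 : 0 < m := by exact_mod_cast h1
      have h4 : m < 1 := by exact_mod_cast h2
      omega
  rw [this]
  exact isPreconnected_Ioo.image _ Circle.exp.continuous.continuousOn

theorem nhdsWithin_inter_slitPlane (Ω : Set ℂ) {p : ℂ} (hp : p ∈ Complex.slitPlane) :
    𝓝[Ω ∩ Complex.slitPlane] p = 𝓝[Ω] p :=
  nhdsWithin_inter_of_mem' (mem_nhdsWithin_of_mem_nhds (Complex.isOpen_slitPlane.mem_nhds hp))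

/-- Only the tip is removed from the Jordan curve, so what remains is a continuous image of the
circle without one point. -/
theorem IsRegion.isPreconnected_boundary {Ω : Set ℂ} (h : IsRegion Ω) :
    IsPreconnected (frontier Ω ∩ Complex.slitPlane) ∧
      (frontier Ω ∩ Complex.slitPlane).Nonempty := by
  obtain ⟨γ, hγ, hinj, hrange⟩ := h.jordan
  obtain ⟨a, ha, htip⟩ := h.tip
  have hmem : -(a : ℂ) ∈ frontier Ω \ Complex.slitPlane := by rw [htip]; rfl
  obtain ⟨z₀, hz₀⟩ : -(a : ℂ) ∈ range γ := by rw [hrange]; exact hmem.1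
  have heq : frontier Ω ∩ Complex.slitPlane = γ '' {z₀}ᶜ := by
    rw [← Set.sdiff_sdiff_right_self, htip, ← hrange, ← hz₀, image_compl_eq_range_sdiff_image hinj,
      image_singleton]
  rw [heq]
  refine ⟨(isPreconnected_compl_singleton_circle z₀).image _ hγ.continuousOn, Nonempty.image _ ?_⟩
  refine ⟨Circle.exp Real.pi * z₀, fun h ↦ ?_⟩
  have h1 := congrArg (fun z : Circle ↦ (z : ℂ)) (mul_eq_right.1 h)
  norm_num [Circle.coe_exp] at h1

/-- The holomorphic function whose real part is a multiple of the source potential. -/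
noncomputable def complexPotential (F : ℂ → ℂ) (z : ℂ) : ℂ := (sqrtInv F z)⁻¹ - sqrtInv F z

theorem IsSymmetricConformal.hasDerivAt_complexPotential {F : ℂ → ℂ} (hF : IsSymmetricConformal F)
    {w : ℂ} (hw : w ∈ rightHalfDisk) :
    HasDerivAt (complexPotential F) (-(1 + w ^ 2) / (2 * w ^ 3 * deriv F (w ^ 2))) (F (w ^ 2)) := by
  convert! hF.hasDerivAt_sourcePotential (-1) hw using 1
  · ext z; simp [complexPotential]
  · ring

theorem IsSymmetricConformal.differentiableAt_complexPotential {F : ℂ → ℂ}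
    (hF : IsSymmetricConformal F) {z : ℂ} (hz : z ∈ F '' ball 0 1 ∩ Complex.slitPlane) :
    DifferentiableAt ℂ (complexPotential F) z := by
  obtain ⟨w, hw, rfl⟩ := hF.exists_sq hz
  exact (hF.hasDerivAt_complexPotential hw).differentiableAt

theorem IsSymmetricConformal.deriv_complexPotential {F : ℂ → ℂ} (hF : IsSymmetricConformal F)
    {c : ℝ} (hc : c ≠ 0) {z : ℂ} (hz : z ∈ F '' ball 0 1 ∩ Complex.slitPlane) :
    deriv (complexPotential F) z = -(c : ℂ)⁻¹ * conj (gradient (sourcePotential F c) z) := by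
  obtain ⟨w, hw, rfl⟩ := hF.exists_sq hz
  have : (c : ℂ) ≠ 0 := by exact_mod_cast hc
  rw [hF.gradient_sourcePotential c hw, (hF.hasDerivAt_complexPotential hw).deriv, Complex.conj_conj]
  field_simp

theorem IsSymmetricConformal.sourcePotential_neg {F : ℂ → ℂ} (hF : IsSymmetricConformal F)
    {c : ℝ} (hc : 0 < c) {z : ℂ} (hz : z ∈ F '' ball 0 1 ∩ Complex.slitPlane) :
    sourcePotential F c z < 0 := by
  have hw := hF.sqrtInv_mem hz
  rw [sourcePotential_eq, inv_sub_re]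
  have hw0 : 0 < ‖sqrtInv F z‖ := norm_pos_iff.2 (ne_zero_of_mem_rightHalfDisk hw)
  have : 1 < (‖sqrtInv F z‖ ^ 2)⁻¹ := (one_lt_inv₀ (by positivity)).2 (by nlinarith [hw.1])
  have := mul_pos hc (mul_pos hw.2 (sub_pos.2 this))
  linarith

/-- The conformal map `F` of the disk onto a solution of the Hele-Shaw problem, with the free
boundary condition expressed through the complex potential. -/
structure IsSelfSimilarFlow (F : ℂ → ℂ) (ν a : ℝ) : Prop where
  conformal : IsSymmetricConformal F
  isBounded : Bornology.IsBounded (F '' ball 0 1)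
  tip_pos : 0 < a
  tip : frontier (F '' ball 0 1) \ Complex.slitPlane = {-(a : ℂ)}
  smooth : ∀ p ∈ frontier (F '' ball 0 1) ∩ Complex.slitPlane,
    ∃ ρ : ℂ → ℝ, IsDefiningFunctionAt (F '' ball 0 1) p ρ
  isPreconnected : IsPreconnected (frontier (F '' ball 0 1) ∩ Complex.slitPlane)
  rate_ne_zero : ν ≠ 0
  deriv_limit : ∀ p ∈ frontier (F '' ball 0 1) ∩ Complex.slitPlane, ∃ e ≠ 0,
    Tendsto (deriv (complexPotential F)) (𝓝[F '' ball 0 1] p) (𝓝 e) ∧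
    ∀ n, IsOutwardUnitNormal (F '' ball 0 1) p n → e * n = (ν * (conj p * n).re : ℝ)

theorem IsSolution.exists_isSelfSimilarFlow {Ω : Set ℂ} (h : IsSolution Ω) :
    ∃ F ν a, IsSelfSimilarFlow F ν a ∧ F '' ball 0 1 = Ω := by
  obtain ⟨hR, Φ, hΦ, μ, hμ⟩ := h
  obtain ⟨F, hF, hΩ⟩ := exists_isSymmetricConformal hR.isOpen hR.isSimplyConnected hR.isBounded
    hR.zero_mem hR.conj_mem
  obtain ⟨a, ha, htip⟩ := hR.tip
  obtain ⟨c, hc, hcF⟩ := hF.exists_cpow_isEquivalent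
  subst hΩ
  set Ω := F '' ball 0 1 with hΩ
  have hV : IsOpen (Ω ∩ Complex.slitPlane) := hR.isOpen.inter Complex.isOpen_slitPlane
  have hΦeq : ∀ z ∈ Ω ∩ Complex.slitPlane, Φ z = sourcePotential F c z := fun z hz ↦
    hΦ.eq hR.isOpen hR.isBounded (hF.isPotential_sourcePotential hcF) hz
  have hevV : ∀ p ∈ frontier Ω ∩ Complex.slitPlane, ∀ᶠ z in 𝓝[Ω] p, z ∈ Ω ∩ Complex.slitPlane :=
    fun p hp ↦ by
      rw [← nhdsWithin_inter_slitPlane Ω hp.2]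
      exact self_mem_nhdsWithin
  have key : ∀ p ∈ frontier Ω ∩ Complex.slitPlane, ∃ g ≠ 0,
      Tendsto (fun z ↦ gradient Φ z) (𝓝[Ω] p) (𝓝 g) ∧
      ∀ n, IsOutwardUnitNormal Ω p n → conj g * n = (μ * (conj p * n).re : ℝ) := by
    intro p hp
    obtain ⟨ρ, hρ⟩ := hR.smooth p hp
    obtain ⟨g, hg, hgn⟩ := hμ p hp _ ⟨ρ, hρ, rfl⟩
    have hL : Tendsto (fderiv ℝ Φ) (𝓝[Ω] p) (𝓝 (InnerProductSpace.toDual ℝ ℂ g)) := by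
      have := ((InnerProductSpace.toDual ℝ ℂ).continuous.tendsto g).comp hg
      refine this.congr fun z ↦ ?_
      exact toDual_gradient
    have hd : ∀ᶠ z in 𝓝[Ω] p, DifferentiableAt ℝ Φ z := (hevV p hp).mono fun z hz ↦
      (hΦ.harmonic z hz).1.differentiableAt two_ne_zero
    have h0 : ∀ᶠ q in 𝓝[frontier Ω] p, Tendsto Φ (𝓝[Ω] q) (𝓝 0) := by
      filter_upwards [self_mem_nhdsWithin, mem_nhdsWithin_of_mem_nhds
        (Complex.isOpen_slitPlane.mem_nhds hp.2)] with q hq hqs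
      rw [← nhdsWithin_inter_slitPlane Ω hqs]
      exact hΦ.zero_on_boundary q hq
    -- The Hopf lemma, as the source potential is negative inside.
    have hg0 : g ≠ 0 := by
      rintro rfl
      refine hρ.gradient_limit_ne_zero (Complex.isOpen_slitPlane.mem_nhds hp.2) hΦ.harmonic
        (fun z hz ↦ ?_) (h0.self_of_nhdsWithin hp.1) hL (map_zero _)
      rw [hΦeq z hz]
      exact hF.sourcePotential_neg hc hz
    -- `Φ` vanishes on the boundary, so `g` is normal and `conj g * n` is real: the scalar boundary
    -- condition becomes a complex equation.
    have htan := hρ.tangential_eq_zero hR.isOpen hd hL h0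
    rw [InnerProductSpace.toDual_apply_apply] at htan
    refine ⟨g, hg0, hg, fun n hn ↦ ?_⟩
    obtain ⟨ρ', hρ', rfl⟩ := hn
    rw [← hρ.normal_unique hρ' hR.isOpen]
    have h1 : inner ℝ g (Complex.I * (‖gradient ρ p‖⁻¹ • gradient ρ p)) = 0 := by
      rw [mul_smul_comm, inner_smul_right, htan, mul_zero]
    set n := ‖gradient ρ p‖⁻¹ • gradient ρ p
    rw [Complex.inner] at h1 hgn
    rw [Complex.inner] at hgn
    apply Complex.ext
    · rw [Complex.ofReal_re, mul_comm, hgn, mul_comm n]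
    · rw [Complex.ofReal_im]
      simp only [Complex.mul_re, Complex.mul_im, Complex.I_re, Complex.I_im] at h1 ⊢
      linarith
  have hcc : (c : ℂ) ≠ 0 := by exact_mod_cast hc.ne'
  obtain ⟨hpre, hne⟩ := hR.isPreconnected_boundary
  -- The rate comes from `W' = -c⁻¹ conj ∇Φ`.
  refine ⟨F, -(μ / c), a, ⟨hF, hR.isBounded, ha, htip, hR.smooth, hpre, ?_, ?_⟩, rfl⟩
  · obtain ⟨p, hp⟩ := hne
    obtain ⟨ρ, hρ⟩ := hR.smooth p hp
    obtain ⟨g, hg0, hg, hgn⟩ := key p hp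
    have := hgn _ ⟨ρ, hρ, rfl⟩
    rw [neg_ne_zero, div_ne_zero_iff]
    refine ⟨?_, hc.ne'⟩
    rintro rfl
    rw [zero_mul, Complex.ofReal_zero] at this
    rcases mul_eq_zero.1 this with h1 | h1
    · exact hg0 (by simpa using h1)
    · refine (smul_ne_zero (inv_ne_zero (norm_ne_zero_iff.2 hρ.gradient_ne_zero))
        hρ.gradient_ne_zero) h1
  · intro p hp
    obtain ⟨g, hg0, hg, hgn⟩ := key p hp
    refine ⟨-(c : ℂ)⁻¹ * conj g, ?_, ?_, fun n hn ↦ ?_⟩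
    · simpa [hcc] using hg0
    · have := ((Complex.continuous_conj.tendsto g).comp hg).const_mul (-(c : ℂ)⁻¹)
      refine this.congr' ?_
      filter_upwards [hevV p hp] with z hz
      rw [hF.deriv_complexPotential hc.ne' hz]
      have h1 : Φ =ᶠ[𝓝 z] sourcePotential F c := by
        filter_upwards [hV.mem_nhds hz] with y hy using hΦeq y hy
      have h2 : gradient Φ z = gradient (sourcePotential F c) z := by
        rw [gradient, gradient, h1.fderiv_eq]
      rw [← h2]
      rfl
    · rw [mul_assoc, hgn n hn]
      push_cast
      field_simp

end HeleShaw

namespace HeleShaw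
open Filter Set Metric ComplexConjugate Asymptotics InnerProductSpace

/-! ### The boundary correspondence -/

theorem tendsto_fderiv_of_tendsto_deriv {f : ℂ → ℂ} {l : Filter ℂ} {e : ℂ}
    (hf : ∀ᶠ z in l, DifferentiableAt ℂ f z) (he : Tendsto (deriv f) l (𝓝 e)) :
    Tendsto (fderiv ℝ f) l (𝓝 (ContinuousLinearMap.mul ℝ ℂ e)) := by
  have := ((ContinuousLinearMap.mul ℝ ℂ).continuous.tendsto e).comp he
  refine this.congr' ?_
  filter_upwards [hf] with z hz
  rw [(hz.hasDerivAt.hasFDerivAt.restrictScalars ℝ).fderiv]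
  ext
  simp [mul_comm]

theorem inv_sub_im (w : ℂ) : (w⁻¹ - w).im = -(w.im * ((‖w‖ ^ 2)⁻¹ + 1)) := by
  rw [Complex.sub_im, Complex.inv_im, Complex.normSq_eq_norm_sq]; ring

/-- When `‖ψ‖ → 1` the imaginary part of `ψ⁻¹ - ψ` behaves like `-2 Im ψ`. This gives the limit of
`Im ψ`, and the modulus with `Re ψ > 0` gives the rest. -/
theorem tendsto_of_tendsto_inv_sub {α : Type*} {l : Filter α} {ψ : α → ℂ} {b : ℂ}
    (hre : ∀ᶠ z in l, 0 < (ψ z).re) (hn : Tendsto (fun z ↦ ‖ψ z‖) l (𝓝 1))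
    (hb : Tendsto (fun z ↦ (ψ z)⁻¹ - ψ z) l (𝓝 b)) :
    Tendsto ψ l (𝓝 ⟨√(1 - (b.im / 2) ^ 2), -(b.im / 2)⟩) := by
  have him : Tendsto (fun z ↦ (ψ z).im) l (𝓝 (-(b.im / 2))) := by
    have h1 := (Complex.continuous_im.tendsto b).comp hb
    have h2 : Tendsto (fun z ↦ -((‖ψ z‖ ^ 2)⁻¹ + 1)⁻¹) l (𝓝 (-((1 ^ 2)⁻¹ + 1)⁻¹)) :=
      ((((hn.pow 2).inv₀ (by norm_num)).add_const 1).inv₀ (by norm_num)).neg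
    have h3 := h1.mul h2
    rw [show b.im * -(((1 : ℝ) ^ 2)⁻¹ + 1)⁻¹ = -(b.im / 2) by norm_num; ring] at h3
    refine h3.congr fun z ↦ ?_
    have h4 : ((‖ψ z‖ ^ 2)⁻¹ + 1) ≠ 0 := by positivity
    simp only [Function.comp_apply, inv_sub_im]
    field_simp
  have hre' : Tendsto (fun z ↦ (ψ z).re) l (𝓝 √(1 - (b.im / 2) ^ 2)) := by
    have := (Real.continuous_sqrt.tendsto _).comp ((hn.pow 2).sub (him.pow 2))
    rw [neg_sq, one_pow] at this
    refine this.congr' ?_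
    filter_upwards [hre] with z hz
    rw [Function.comp_apply, ← Complex.normSq_eq_norm_sq, Complex.normSq_apply,
      show (ψ z).re * (ψ z).re + (ψ z).im * (ψ z).im - (ψ z).im ^ 2 = (ψ z).re ^ 2 by ring,
      Real.sqrt_sq hz.le]
  have := (Complex.continuous_ofReal.tendsto _).comp hre' |>.add
    (((Complex.continuous_ofReal.tendsto _).comp him).mul_const Complex.I)
  rw [← Complex.mk_eq_add_mul_I] at this
  refine this.congr fun z ↦ ?_
  simp [Complex.re_add_im]

/-- The boundary extension of the square root of the inverse conformal map. -/
noncomputable def boundaryRoot (F : ℂ → ℂ) : ℂ → ℂ := extendFrom (F '' ball 0 1) (sqrtInv F)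

namespace IsSelfSimilarFlow

variable {F : ℂ → ℂ} {ν a : ℝ}

theorem isOpen (h : IsSelfSimilarFlow F ν a) : IsOpen (F '' ball 0 1) := h.conformal.isOpen_image

theorem eventually_mem (p : ℂ) (hp : p ∈ frontier (F '' ball 0 1) ∩ Complex.slitPlane) :
    ∀ᶠ z in 𝓝[F '' ball 0 1] p, z ∈ F '' ball 0 1 ∩ Complex.slitPlane := by
  rw [← nhdsWithin_inter_slitPlane _ hp.2]
  exact self_mem_nhdsWithin

theorem neBot {p : ℂ} (hp : p ∈ frontier (F '' ball 0 1) ∩ Complex.slitPlane) :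
    (𝓝[F '' ball 0 1] p).NeBot :=
  mem_closure_iff_nhdsWithin_neBot.1 (frontier_subset_closure hp.1)

theorem exists_tendsto_complexPotential (h : IsSelfSimilarFlow F ν a) {p : ℂ}
    (hp : p ∈ frontier (F '' ball 0 1) ∩ Complex.slitPlane) :
    ∃ b, Tendsto (complexPotential F) (𝓝[F '' ball 0 1] p) (𝓝 b) := by
  obtain ⟨ρ, hρ⟩ := h.smooth p hp
  obtain ⟨e, -, he, -⟩ := h.deriv_limit p hp
  have hd : ∀ᶠ z in 𝓝[F '' ball 0 1] p, DifferentiableAt ℂ (complexPotential F) z :=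
    (eventually_mem p hp).mono fun z hz ↦ h.conformal.differentiableAt_complexPotential hz
  exact IsDefiningFunctionAt.exists_tendsto_of_isLittleO (frontier_subset_closure hp.1)
    (hρ.isLittleO_of_tendsto_fderiv (hd.mono fun z hz ↦ hz.restrictScalars ℝ)
      (tendsto_fderiv_of_tendsto_deriv hd he))

theorem tendsto_norm_sqrtInv (h : IsSelfSimilarFlow F ν a) {p : ℂ}
    (hp : p ∈ frontier (F '' ball 0 1) ∩ Complex.slitPlane) :
    Tendsto (fun z ↦ ‖sqrtInv F z‖) (𝓝[F '' ball 0 1] p) (𝓝 1) := by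
  rw [← nhdsWithin_inter_slitPlane _ hp.2]
  exact h.conformal.tendsto_norm_sqrtInv hp.1

theorem eventually_sqrtInv_mem (h : IsSelfSimilarFlow F ν a) {p : ℂ}
    (hp : p ∈ frontier (F '' ball 0 1) ∩ Complex.slitPlane) :
    ∀ᶠ z in 𝓝[F '' ball 0 1] p, sqrtInv F z ∈ rightHalfDisk :=
  (eventually_mem p hp).mono fun _ hz ↦ h.conformal.sqrtInv_mem hz

theorem tendsto_sqrtInv_of_tendsto (h : IsSelfSimilarFlow F ν a) {p b : ℂ}
    (hp : p ∈ frontier (F '' ball 0 1) ∩ Complex.slitPlane)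
    (hb : Tendsto (complexPotential F) (𝓝[F '' ball 0 1] p) (𝓝 b)) :
    Tendsto (sqrtInv F) (𝓝[F '' ball 0 1] p) (𝓝 ⟨√(1 - (b.im / 2) ^ 2), -(b.im / 2)⟩) :=
  tendsto_of_tendsto_inv_sub ((h.eventually_sqrtInv_mem hp).mono fun _ hz ↦ hz.2)
    (h.tendsto_norm_sqrtInv hp) hb

theorem abs_im_le (h : IsSelfSimilarFlow F ν a) {p b : ℂ}
    (hp : p ∈ frontier (F '' ball 0 1) ∩ Complex.slitPlane)
    (hb : Tendsto (complexPotential F) (𝓝[F '' ball 0 1] p) (𝓝 b)) : |b.im| ≤ 2 := by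
  have := neBot hp
  have h1 := (h.tendsto_sqrtInv_of_tendsto hp hb).norm
  have h2 := tendsto_nhds_unique h1 (h.tendsto_norm_sqrtInv hp)
  have h3 := Complex.abs_im_le_norm ⟨√(1 - (b.im / 2) ^ 2), -(b.im / 2)⟩
  rw [h2, abs_neg, abs_div, abs_two] at h3
  linarith

/-- If `|Im b| = 2`, the boundary values of `Im W` are extremal at `p`, so the tangential derivative
vanishes. This derivative is a nonzero multiple of the real number `e n`, and `e ≠ 0`. Consequently
no boundary point off the tip corresponds to `w = ±i`. -/
theorem abs_im_lt (h : IsSelfSimilarFlow F ν a) {p b : ℂ}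
    (hp : p ∈ frontier (F '' ball 0 1) ∩ Complex.slitPlane)
    (hb : Tendsto (complexPotential F) (𝓝[F '' ball 0 1] p) (𝓝 b)) : |b.im| < 2 := by
  have hex : ∀ q, ∃ c, q ∈ frontier (F '' ball 0 1) ∩ Complex.slitPlane →
      Tendsto (complexPotential F) (𝓝[F '' ball 0 1] q) (𝓝 c) := fun q ↦ by
    by_cases hq : q ∈ frontier (F '' ball 0 1) ∩ Complex.slitPlane
    · obtain ⟨c, hc⟩ := h.exists_tendsto_complexPotential hq
      exact ⟨c, fun _ ↦ hc⟩
    · exact ⟨0, fun hq' ↦ absurd hq' hq⟩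
  choose β hβ using hex
  have := neBot hp
  obtain rfl : b = β p := tendsto_nhds_unique hb (hβ p hp)
  refine lt_of_le_of_ne (h.abs_im_le hp hb) fun heq ↦ ?_
  obtain ⟨ρ, hρ⟩ := h.smooth p hp
  obtain ⟨e, he0, he, hen⟩ := h.deriv_limit p hp
  have hd : ∀ᶠ z in 𝓝[F '' ball 0 1] p, DifferentiableAt ℂ (complexPotential F) z :=
    (eventually_mem p hp).mono fun z hz ↦ h.conformal.differentiableAt_complexPotential hz
  have hA : ∀ᶠ q in 𝓝[frontier (F '' ball 0 1)] p,
      q ∈ frontier (F '' ball 0 1) ∩ Complex.slitPlane := by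
    filter_upwards [self_mem_nhdsWithin, mem_nhdsWithin_of_mem_nhds
      (Complex.isOpen_slitPlane.mem_nhds hp.2)] with q hq hqs using ⟨hq, hqs⟩
  have ho := IsDefiningFunctionAt.isLittleO_boundary
    (hρ.isLittleO_of_tendsto_fderiv (hd.mono fun z hz ↦ hz.restrictScalars ℝ)
      (tendsto_fderiv_of_tendsto_deriv hd he)) (hA.mono fun q hq ↦ hβ q hq)
  have hcurve : Tendsto hρ.boundaryCurve (𝓝 0) (𝓝[frontier (F '' ball 0 1)] p) :=
    tendsto_nhdsWithin_iff.2 ⟨hρ.tendsto_boundaryCurve, hρ.eventually_boundaryCurve_mem h.isOpen⟩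
  have hb' : HasDerivAt (fun t ↦ β (hρ.boundaryCurve t))
      (e * ((conj (gradient ρ p))⁻¹ * Complex.I)) 0 := by
    have hσ := hρ.hasDerivAt_boundaryCurve
    have h1 := (ho.comp_tendsto (hcurve.prodMk
      (tendsto_const_pure.mono_right (pure_le_nhdsWithin (hρ.mem_frontier h.isOpen))))).trans_isBigO
      (show (fun t ↦ hρ.boundaryCurve t - p) =O[𝓝 0] fun t : ℝ ↦ t by
        simpa [hρ.boundaryCurve_zero] using hσ.isBigO_sub)
    have h2 := (hasDerivAt_iff_isLittleO.1 hσ).const_mul_left e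
    rw [hasDerivAt_iff_isLittleO]
    simp only [sub_zero] at h2 ⊢
    refine (h1.add h2).congr_left fun t ↦ ?_
    simp only [Function.comp_apply, ContinuousLinearMap.mul_apply', hρ.boundaryCurve_zero,
      Complex.real_smul]
    ring
  have him : HasDerivAt (fun t ↦ (β (hρ.boundaryCurve t)).im)
      (e * ((conj (gradient ρ p))⁻¹ * Complex.I)).im 0 :=
    Complex.imCLM.hasFDerivAt.comp_hasDerivAt (0 : ℝ) hb'
  have hbd : ∀ᶠ t in 𝓝 (0 : ℝ), |(β (hρ.boundaryCurve t)).im| ≤ 2 :=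
    (hcurve.eventually hA).mono fun t ht ↦ h.abs_im_le ht (hβ _ ht)
  have hzero : (e * ((conj (gradient ρ p))⁻¹ * Complex.I)).im = 0 := by
    rcases abs_eq (by norm_num) |>.1 heq with h2 | h2
    · refine IsLocalMax.hasDerivAt_eq_zero ?_ him
      filter_upwards [hbd] with t ht
      rw [hρ.boundaryCurve_zero, h2]
      exact (abs_le.1 ht).2
    · refine IsLocalMin.hasDerivAt_eq_zero ?_ him
      filter_upwards [hbd] with t ht
      rw [hρ.boundaryCurve_zero, h2]
      exact (abs_le.1 ht).1
  have hN := hρ.gradient_ne_zero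
  have hen' := hen _ ⟨ρ, hρ, rfl⟩
  set N := gradient ρ p with hNdef
  have hNn : ‖N‖ ≠ 0 := norm_ne_zero_iff.2 hN
  have hn0 : ‖N‖⁻¹ • N ≠ 0 := smul_ne_zero (inv_ne_zero hNn) hN
  have hfac : (conj N)⁻¹ = (‖N‖⁻¹ : ℝ) * (‖N‖⁻¹ • N) := by
    have h1 : (‖N‖ : ℂ) ≠ 0 := by exact_mod_cast hNn
    have h2 : conj N ≠ 0 := by simpa using hN
    have h3 : N * conj N = (‖N‖ : ℂ) ^ 2 := by
      rw [Complex.mul_conj, Complex.normSq_eq_norm_sq]; push_cast; ring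
    rw [Complex.real_smul]
    push_cast
    field_simp
    rw [← h3, mul_comm]
  rw [hfac, show e * ((‖N‖⁻¹ : ℝ) * (‖N‖⁻¹ • N) * Complex.I) =
    (‖N‖⁻¹ : ℝ) * ((e * (‖N‖⁻¹ • N)) * Complex.I) by ring, hen', Complex.im_ofReal_mul] at hzero
  simp only [Complex.mul_I_im, Complex.ofReal_re] at hzero
  rw [(mul_eq_zero.1 hzero).resolve_left (inv_ne_zero hNn), Complex.ofReal_zero] at hen'
  exact (mul_ne_zero he0 hn0) hen'

theorem exists_tendsto_sqrtInv (h : IsSelfSimilarFlow F ν a) {p : ℂ}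
    (hp : p ∈ frontier (F '' ball 0 1) ∩ Complex.slitPlane) :
    ∃ ω : ℂ, Tendsto (sqrtInv F) (𝓝[F '' ball 0 1] p) (𝓝 ω) ∧ ‖ω‖ = 1 ∧ 0 < ω.re := by
  obtain ⟨b, hb⟩ := h.exists_tendsto_complexPotential hp
  have := neBot hp
  have h1 := h.tendsto_sqrtInv_of_tendsto hp hb
  refine ⟨_, h1, tendsto_nhds_unique h1.norm (h.tendsto_norm_sqrtInv hp), Real.sqrt_pos.2 ?_⟩
  have h2 := abs_lt.1 (h.abs_im_lt hp hb)
  nlinarith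

theorem tendsto_sqrtInv (h : IsSelfSimilarFlow F ν a) {p : ℂ}
    (hp : p ∈ frontier (F '' ball 0 1) ∩ Complex.slitPlane) :
    Tendsto (sqrtInv F) (𝓝[F '' ball 0 1] p) (𝓝 (boundaryRoot F p)) := by
  obtain ⟨ω, hω, -⟩ := h.exists_tendsto_sqrtInv hp
  exact tendsto_extendFrom ⟨ω, hω⟩

theorem norm_boundaryRoot (h : IsSelfSimilarFlow F ν a) {p : ℂ}
    (hp : p ∈ frontier (F '' ball 0 1) ∩ Complex.slitPlane) : ‖boundaryRoot F p‖ = 1 := by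
  have := neBot hp
  exact tendsto_nhds_unique (h.tendsto_sqrtInv hp).norm (h.tendsto_norm_sqrtInv hp)

theorem boundaryRoot_re_pos (h : IsSelfSimilarFlow F ν a) {p : ℂ}
    (hp : p ∈ frontier (F '' ball 0 1) ∩ Complex.slitPlane) : 0 < (boundaryRoot F p).re := by
  have := neBot hp
  obtain ⟨ω, hω, -, hpos⟩ := h.exists_tendsto_sqrtInv hp
  rwa [tendsto_nhds_unique (h.tendsto_sqrtInv hp) hω]

theorem continuousOn_boundaryRoot (h : IsSelfSimilarFlow F ν a) :
    ContinuousOn (boundaryRoot F) (frontier (F '' ball 0 1) ∩ Complex.slitPlane) :=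
  continuousOn_extendFrom (fun _ hp ↦ frontier_subset_closure hp.1) fun _ hp ↦
    ⟨_, h.tendsto_sqrtInv hp⟩

end IsSelfSimilarFlow

end HeleShaw

namespace HeleShaw
open Filter Set Metric ComplexConjugate Asymptotics InnerProductSpace

/-! ### The boundary correspondence near the tip -/

theorem inner_eq_one_sub_of_norm_eq_one {ξ ζ : ℂ} (hξ : ‖ξ‖ = 1) (hζ : ‖ζ‖ = 1) :
    inner ℝ ξ ζ = 1 - dist ζ ξ ^ 2 / 2 := by
  rw [dist_eq_norm, norm_sub_sq_real, hξ, hζ, real_inner_comm]; ring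

/-- A bounded holomorphic function without zeros on the disk does not tend to zero on a boundary
arc. -/
theorem not_forall_tendsto_zero_on_arc {f : ℂ → ℂ} (hf : DifferentiableOn ℂ f (ball 0 1))
    (hne : ∀ z ∈ ball (0 : ℂ) 1, f z ≠ 0) {M : ℝ} (hM : ∀ z ∈ ball (0 : ℂ) 1, ‖f z‖ ≤ M) {ξ : ℂ}
    (hξ : ‖ξ‖ = 1) {δ : ℝ} (hδ : 0 < δ) :
    ∃ ζ ∈ ball ξ δ, ‖ζ‖ = 1 ∧ ¬ Tendsto f (𝓝[ball 0 1] ζ) (𝓝 0) := by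
  by_contra! hcon
  -- For unit vectors `⟪ξ, ζ⟫ = 1 - |ζ - ξ|² / 2`, so `c` is the value at distance `δ` from `ξ`.
  set c := 1 - δ ^ 2 / 2 with hc
  have hc1 : c < 1 := by have : 0 < δ ^ 2 := by positivity
                         linarith
  obtain ⟨t, ht, ht1⟩ := exists_between (max_lt hc1 zero_lt_one)
  have htc : c < t := (le_max_left _ _).trans_lt ht
  have ht0 : 0 < t := (le_max_right _ _).trans_lt ht
  have htξ : (t : ℂ) * ξ ∈ ball (0 : ℂ) 1 := by
    rw [mem_ball_zero_iff, norm_mul, hξ, mul_one, Complex.norm_real, Real.norm_of_nonneg ht0.le]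
    exact ht1
  have hfr : frontier (ball (0 : ℂ) 1) = sphere 0 1 := frontier_ball _ one_ne_zero
  have hin : ∀ z : ℂ, inner ℝ ξ z = (conj ξ * z).re := fun z ↦ by rw [Complex.inner, mul_comm]
  -- Add `n (⟪ξ, z⟫ - c)` to `log ‖f‖`: it is nonpositive off the arc and swallowed by `log ‖f‖ →
  -- -∞` on it. At `t ξ` it equals `n (t - c)`, which is unbounded in `n`.
  have key : ∀ n : ℕ, Real.log ‖f (t * ξ)‖ + n * (t - c) ≤ Real.log M := by
    intro n
    have hv : HarmonicOnNhd (fun z ↦ (n * (conj ξ * z - c) - Real.log M : ℂ).re) (ball (0 : ℂ) 1) :=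
      fun z _ ↦ AnalyticAt.harmonicAt_re (by fun_prop)
    have hu : HarmonicOnNhd (fun z ↦ Real.log ‖f z‖) (ball (0 : ℂ) 1) := fun z hz ↦
      (hf.analyticAt (isOpen_ball.mem_nhds hz)).harmonicAt_log_norm (hne z hz)
    have hval : ∀ z : ℂ, (n * (conj ξ * z - c) - Real.log M : ℂ).re =
        n * (inner ℝ ξ z - c) - Real.log M := fun z ↦ by
      rw [hin, Complex.sub_re, Complex.ofReal_re, ← Complex.ofReal_natCast, Complex.re_ofReal_mul,
        Complex.sub_re, Complex.ofReal_re]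
    have := harmonic_nonpos_of_frontier isOpen_ball isBounded_ball (hu.add hv)
      (fun ζ hζ ε hε ↦ ?_) _ htξ
    · simp only [Pi.add_apply, hval] at this
      have h1 : inner ℝ ξ (t * ξ) = t := by
        rw [← Complex.real_smul, inner_smul_right, real_inner_self_eq_norm_sq, hξ]; ring
      rw [h1] at this
      linarith
    · rw [hfr, mem_sphere_zero_iff_norm] at hζ
      have hcont : Tendsto (fun z ↦ n * (inner ℝ ξ z - c) - Real.log M) (𝓝[ball (0 : ℂ) 1] ζ)
          (𝓝 (n * (inner ℝ ξ ζ - c) - Real.log M)) := by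
        have : Continuous fun z : ℂ ↦ n * (inner ℝ ξ z - c) - Real.log M := by fun_prop
        exact (this.tendsto ζ).mono_left nhdsWithin_le_nhds
      rcases le_or_gt (inner ℝ ξ ζ) c with hle | hlt
      · have h1 : n * (inner ℝ ξ ζ - c) - Real.log M < ε - Real.log M := by
          have := mul_nonpos_of_nonneg_of_nonpos n.cast_nonneg (α := ℝ) (sub_nonpos.2 hle)
          linarith
        filter_upwards [hcont.eventually (gt_mem_nhds h1), self_mem_nhdsWithin] with z hz hzb
        have h2 : Real.log ‖f z‖ ≤ Real.log M :=
          Real.log_le_log (norm_pos_iff.2 (hne z hzb)) (hM z hzb)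
        simp only [Pi.add_apply, hval]
        linarith
      · have hζδ : ζ ∈ ball ξ δ := by
          rw [inner_eq_one_sub_of_norm_eq_one hξ hζ, hc] at hlt
          rw [mem_ball]
          nlinarith [dist_nonneg (x := ζ) (y := ξ)]
        have h0 := (hcon ζ hζδ hζ).norm
        rw [norm_zero] at h0
        have hlog : Tendsto (fun z ↦ Real.log ‖f z‖) (𝓝[ball 0 1] ζ) atBot := by
          refine Real.tendsto_log_nhdsGT_zero.comp (tendsto_nhdsWithin_iff.2 ⟨h0, ?_⟩)
          filter_upwards [self_mem_nhdsWithin] with z hz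
          exact norm_pos_iff.2 (hne z hz)
        filter_upwards [(hlog.atBot_add hcont).eventually_le_atBot ε] with z hz
        simp only [Pi.add_apply, hval]
        linarith
  obtain ⟨n, hn⟩ := exists_nat_gt ((Real.log M - Real.log ‖f (t * ξ)‖) / (t - c))
  rw [div_lt_iff₀ (sub_pos.2 htc)] at hn
  linarith [key n]

namespace IsSelfSimilarFlow

variable {F : ℂ → ℂ} {ν a : ℝ}

theorem tip_mem (h : IsSelfSimilarFlow F ν a) : -(a : ℂ) ∈ frontier (F '' ball 0 1) :=
  (h.tip.ge rfl).1

theorem mem_boundary (h : IsSelfSimilarFlow F ν a) {p : ℂ} (hp : p ∈ frontier (F '' ball 0 1))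
    (hne : p ≠ -(a : ℂ)) : p ∈ frontier (F '' ball 0 1) ∩ Complex.slitPlane := by
  refine ⟨hp, ?_⟩
  by_contra hs
  exact hne (h.tip.le ⟨hp, hs⟩)

theorem add_tip_ne_zero (h : IsSelfSimilarFlow F ν a) {z : ℂ} (hz : z ∈ ball (0 : ℂ) 1) :
    F z + a ≠ 0 := fun h0 ↦ by
  have h1 := h.tip_mem
  rw [h.isOpen.frontier_eq] at h1
  exact h1.2 ⟨z, hz, eq_neg_of_add_eq_zero_left h0⟩

theorem exists_norm_le (h : IsSelfSimilarFlow F ν a) :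
    ∃ M, 0 < M ∧ ∀ z ∈ ball (0 : ℂ) 1, ‖F z‖ ≤ M := by
  obtain ⟨M, hM, hsub⟩ := h.isBounded.exists_pos_norm_le
  exact ⟨M, hM, fun z hz ↦ hsub _ (mem_image_of_mem _ hz)⟩

/-- Otherwise compactness gives `d > 0` below all boundary roots' real parts. On an arc of the
circle whose roots have real part less than `d`, the only possible limit of `F` is then the tip, so
`F + a`, bounded and without zeros, would tend to zero along an arc. -/
theorem exists_boundaryRoot_re_lt (h : IsSelfSimilarFlow F ν a) {U : Set ℂ} (hU : IsOpen U)
    (haU : -(a : ℂ) ∈ U) {δ : ℝ} (hδ : 0 < δ) :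
    ∃ p ∈ frontier (F '' ball 0 1) ∩ Complex.slitPlane, p ∈ U ∧ (boundaryRoot F p).re < δ := by
  by_contra! hcon
  set A := frontier (F '' ball 0 1) ∩ Complex.slitPlane with hA
  have hK : IsCompact (frontier (F '' ball 0 1) \ U) := by
    have : IsCompact (frontier (F '' ball 0 1)) :=
      h.isBounded.isCompact_closure.of_isClosed_subset isClosed_frontier frontier_subset_closure
    exact this.inter_right hU.isClosed_compl
  have hKA : frontier (F '' ball 0 1) \ U ⊆ A := fun p hp ↦
    h.mem_boundary hp.1 fun hpa ↦ hp.2 (hpa ▸ haU)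
  obtain ⟨d, hd, hdA⟩ : ∃ d, 0 < d ∧ ∀ p ∈ A, d ≤ (boundaryRoot F p).re := by
    rcases (frontier (F '' ball 0 1) \ U).eq_empty_or_nonempty with hemp | hne
    · refine ⟨δ, hδ, fun p hp ↦ hcon p hp ?_⟩
      by_contra hpU
      exact (hemp.le ⟨hp.1, hpU⟩)
    · obtain ⟨q, hq, hmin⟩ := hK.exists_isMinOn hne
        (Complex.continuous_re.comp_continuousOn (h.continuousOn_boundaryRoot.mono hKA))
      refine ⟨min δ (boundaryRoot F q).re, lt_min hδ (h.boundaryRoot_re_pos (hKA hq)),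
        fun p hp ↦ ?_⟩
      by_cases hpU : p ∈ U
      · exact (min_le_left _ _).trans (hcon p hp hpU)
      · exact (min_le_right _ _).trans (hmin ⟨hp.1, hpU⟩)
  set c := min (d / 2) (1 / 2) with hc
  have hc0 : 0 < c := lt_min (by linarith) (by norm_num)
  have hc1 : c ≤ 1 / 2 := min_le_right _ _
  have hcd : c < d := (min_le_left _ _).trans_lt (by linarith)
  -- The square of this unit vector lies in the interior of such an arc, because `c < d`.
  set w : ℂ := ⟨c, √(1 - c ^ 2)⟩ with hw
  have hwre : 0 < w.re := hc0
  have hwn : ‖w‖ = 1 := by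
    rw [← sq_eq_sq₀ (norm_nonneg _) zero_le_one, ← Complex.normSq_eq_norm_sq, Complex.normSq_apply]
    simp only [hw]
    rw [Real.mul_self_sqrt (by nlinarith)]
    ring
  have hnear : ∀ᶠ ζ in 𝓝 (w ^ 2), ζ ∈ Complex.slitPlane ∧ (ζ ^ (1 / 2 : ℂ)).re < d := by
    have hs := sq_mem_slitPlane hwre
    refine (Complex.isOpen_slitPlane.eventually_mem hs).and ?_
    have hcont : ContinuousAt (fun ζ : ℂ ↦ (ζ ^ (1 / 2 : ℂ)).re) (w ^ 2) :=
      Complex.continuous_re.continuousAt.comp (continuousAt_id.cpow continuousAt_const hs)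
    refine hcont.eventually (gt_mem_nhds ?_)
    beta_reduce
    rw [sq_cpow_half hwre]
    exact hcd
  obtain ⟨r, hr, hball⟩ := Metric.eventually_nhds_iff_ball.1 hnear
  obtain ⟨M, -, hM⟩ := h.exists_norm_le
  obtain ⟨ζ, hζr, hζ1, hnot⟩ := not_forall_tendsto_zero_on_arc
    (h.conformal.diff.add_const (a : ℂ)) (fun z hz ↦ h.add_tip_ne_zero hz)
    (fun z hz ↦ (norm_add_le _ _).trans (add_le_add_left (hM z hz) _))
    (show ‖w ^ 2‖ = 1 by rw [norm_pow, hwn, one_pow]) hr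
  obtain ⟨hζs, hζd⟩ := hball ζ hζr
  refine hnot ?_
  have hlim : Tendsto F (𝓝[ball 0 1] ζ) (𝓝 (-a)) := by
    rw [tendsto_iff_ultrafilter]
    intro 𝒰 h𝒰
    have hcl : closure (F '' ball 0 1) ∈ (𝒰.map F : Ultrafilter ℂ) := by
      rw [Ultrafilter.mem_map]
      filter_upwards [h𝒰 self_mem_nhdsWithin] with z hz
      exact subset_closure (mem_image_of_mem _ hz)
    obtain ⟨p, hp, hle⟩ := h.isBounded.isCompact_closure.ultrafilter_le_nhds' _ hcl
    have hpΩ : p ∉ F '' ball 0 1 := fun hpΩ ↦ by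
      obtain ⟨K, hK, hKΩ, hKc⟩ := local_compact_nhds (h.isOpen.mem_nhds hpΩ)
      have h1 : ∀ᶠ z in (𝒰 : Filter ℂ), F z ∉ K :=
        h𝒰 (h.conformal.eventually_notMem hKΩ hKc hζ1)
      have h2 : ∀ᶠ z in (𝒰 : Filter ℂ), F z ∈ K := hle hK
      obtain ⟨z, hz1, hz2⟩ := (h1.and h2).exists
      exact hz1 hz2
    have hpf : p ∈ frontier (F '' ball 0 1) := by rw [h.isOpen.frontier_eq]; exact ⟨hp, hpΩ⟩
    by_cases hpa : p = -a
    · rw [← hpa]; exact hle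
    · exfalso
      have hpA := h.mem_boundary hpf hpa
      have hF : Tendsto F 𝒰 (𝓝[F '' ball 0 1] p) := by
        refine tendsto_nhdsWithin_iff.2 ⟨hle, ?_⟩
        filter_upwards [h𝒰 self_mem_nhdsWithin] with z hz using mem_image_of_mem _ hz
      have h1 := (h.tendsto_sqrtInv hpA).comp hF
      have h2 : Tendsto (fun z : ℂ ↦ z ^ (1 / 2 : ℂ)) 𝒰 (𝓝 (ζ ^ (1 / 2 : ℂ))) :=
        ((continuousAt_id.cpow continuousAt_const hζs).tendsto).mono_left (h𝒰.trans nhdsWithin_le_nhds)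
      have h3 : boundaryRoot F p = ζ ^ (1 / 2 : ℂ) := by
        refine tendsto_nhds_unique (h1.congr' ?_) h2
        filter_upwards [h𝒰 self_mem_nhdsWithin] with z hz
        rw [Function.comp_apply, sqrtInv, h.conformal.invFunOn_apply hz]
      have := hdA p hpA
      rw [h3] at this
      exact absurd hζd (not_lt.2 this)
  have := hlim.add_const (a : ℂ)
  rwa [neg_add_cancel] at this

/-- The boundary points approach the tip along a sequence on which the conformal coordinate
approaches the end of the unit semicircle. -/
theorem exists_seq_tendsto_tip (h : IsSelfSimilarFlow F ν a) : ∃ p : ℕ → ℂ,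
    (∀ n, p n ∈ frontier (F '' ball 0 1) ∩ Complex.slitPlane) ∧ Tendsto p atTop (𝓝 (-a)) ∧
    Tendsto (fun n ↦ (boundaryRoot F (p n)).re) atTop (𝓝 0) := by
  have hpos : ∀ n : ℕ, 0 < 1 / ((n : ℝ) + 1) := fun n ↦ by positivity
  choose p hpA hpU hpr using fun n : ℕ ↦
    h.exists_boundaryRoot_re_lt isOpen_ball (mem_ball_self (hpos n)) (hpos n)
  have hlim := tendsto_one_div_add_atTop_nhds_zero_nat (𝕜 := ℝ)
  refine ⟨p, hpA, ?_, ?_⟩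
  · rw [tendsto_iff_dist_tendsto_zero]
    exact squeeze_zero (fun _ ↦ dist_nonneg) (fun n ↦ (hpU n).le) hlim
  · exact squeeze_zero (fun n ↦ (h.boundaryRoot_re_pos (hpA n)).le) (fun n ↦ (hpr n).le) hlim

end IsSelfSimilarFlow

end HeleShaw

namespace HeleShaw
open Filter Set Metric ComplexConjugate Asymptotics InnerProductSpace

/-! ### A primitive with controlled singularity -/

/-- Holomorphic functions on the unit disk that commute with complex conjugation. -/
structure IsSelfConj (h : ℂ → ℂ) : Prop where
  diff : DifferentiableOn ℂ h (ball 0 1)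
  conj_map : ∀ z ∈ ball (0 : ℂ) 1, h (conj z) = conj (h z)

theorem IsSelfConj.exists_eq_add_mul {h : ℂ → ℂ} (hh : IsSelfConj h) :
    ∃ (m : ℝ) (N : ℂ → ℂ), IsSelfConj N ∧ ∀ z, h z = m + z * N z := by
  have h0 : (0 : ℂ) ∈ ball (0 : ℂ) 1 := mem_ball_self one_pos
  refine ⟨(h 0).re, dslope h 0, ⟨(Complex.differentiableOn_dslope (isOpen_ball.mem_nhds h0)).2
    hh.diff, fun z hz ↦ dslope_conj hh.diff hh.conj_map hz⟩, fun z ↦ ?_⟩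
  have h1 : ((h 0).re : ℂ) = h 0 := by
    rw [← Complex.conj_eq_iff_re, ← hh.conj_map 0 h0, map_zero]
  have := sub_smul_dslope h 0 z
  rw [sub_zero, smul_eq_mul] at this
  rw [h1, this]
  ring

theorem eqOn_ball_of_hasDerivAt {f g f' : ℂ → ℂ} (hf : ∀ z ∈ ball (0 : ℂ) 1, HasDerivAt f (f' z) z)
    (hg : ∀ z ∈ ball (0 : ℂ) 1, HasDerivAt g (f' z) z) (h0 : f 0 = g 0) :
    EqOn f g (ball 0 1) :=
  isOpen_ball.eqOn_of_deriv_eq (convex_ball _ _).isPreconnected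
    (fun z hz ↦ (hf z hz).differentiableAt.differentiableWithinAt)
    (fun z hz ↦ (hg z hz).differentiableAt.differentiableWithinAt)
    (fun z hz ↦ (hf z hz).deriv.trans (hg z hz).deriv.symm) (mem_ball_self one_pos) h0

theorem IsSelfConj.exists_odd_primitive {N : ℂ → ℂ} (hN : IsSelfConj N) : ∃ S, IsSelfConj S ∧
    (∀ w ∈ ball (0 : ℂ) 1, HasDerivAt S (N (w ^ 2)) w) ∧ ∀ w ∈ ball (0 : ℂ) 1, S (-w) = -S w := by
  have hsq : ∀ w ∈ ball (0 : ℂ) 1, w ^ 2 ∈ ball (0 : ℂ) 1 := fun w hw ↦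
    sq_mem_ball (mem_ball_zero_iff.1 hw)
  have hd : DifferentiableOn ℂ (fun w ↦ N (w ^ 2)) (ball 0 1) :=
    hN.diff.comp (by fun_prop) hsq
  obtain ⟨S, hS0, hS⟩ := (hd.isExactOn_ball).with_val_at 0 0
  have hneg : ∀ w ∈ ball (0 : ℂ) 1, -w ∈ ball (0 : ℂ) 1 := fun w hw ↦ by
    rw [mem_ball_zero_iff] at hw ⊢; rwa [norm_neg]
  refine ⟨S, ⟨fun w hw ↦ (hS w hw).differentiableAt.differentiableWithinAt, fun w hw ↦ ?_⟩, hS,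
    fun w hw ↦ ?_⟩
  · have := eqOn_ball_of_hasDerivAt (f := fun z ↦ conj (S (conj z))) (g := S)
      (f' := fun w ↦ N (w ^ 2)) (fun z hz ↦ ?_) hS (by simp [hS0]) hw
    · rw [← this]; simp
    · have h1 := (hS _ (conj_mem_ball hz)).conj_conj
      rw [Complex.conj_conj, ← map_pow, hN.conj_map _ (hsq z hz), Complex.conj_conj] at h1
      exact h1
  · have := eqOn_ball_of_hasDerivAt (f := fun z ↦ -S (-z)) (g := S)
      (f' := fun w ↦ N (w ^ 2)) (fun z hz ↦ ?_) hS (by simp [hS0]) hw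
    · rw [← this]; simp
    · have h1 := ((hS _ (hneg z hz)).scomp z (hasDerivAt_neg z)).neg
      simp only [neg_smul, one_smul, neg_neg, neg_sq] at h1
      exact h1

/-- `P` is the primitive in the variable `w = z ^ (1/2)` of the right-hand side of the linearized
free boundary condition, and `J` is the regular part of `F (w²) P w`. -/
structure IsSingularPrimitive (F : ℂ → ℂ) (κ α β : ℝ) (P J : ℂ → ℂ) : Prop where
  hasDerivAt : ∀ w ∈ ball (0 : ℂ) 1, w ≠ 0 →
    HasDerivAt P (-κ * (1 + w ^ 2) / (w ^ 2 * F (w ^ 2) ^ 2)) w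
  conj_map : ∀ w ∈ ball (0 : ℂ) 1, P (conj w) = conj (P w)
  neg_map : ∀ w ∈ ball (0 : ℂ) 1, P (-w) = -P w
  diff_regular : DifferentiableOn ℂ J (ball 0 1)
  regular_zero : J 0 = 0
  regular_re : ∀ w ∈ ball (0 : ℂ) 1, w.re = 0 → (J w).re = 0
  mul_eq : ∀ w ∈ ball (0 : ℂ) 1, w ≠ 0 →
    F (w ^ 2) * P w = α * ((w⁻¹) ^ 3 - w ^ 3) + β * (w⁻¹ - w) + J w

theorem re_eq_zero_of_odd {f : ℂ → ℂ} {w : ℂ} (hc : f (conj w) = conj (f w)) (hn : f (-w) = -f w)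
    (hw : w.re = 0) : (f w).re = 0 := by
  have h1 : conj w = -w := Complex.ext (by simp [hw]) (by simp)
  rw [h1, hn] at hc
  have := congrArg Complex.re hc
  simp only [Complex.neg_re, Complex.conj_re] at this
  linarith

/-- Since `F (w²) = w² g (w²)`, the integrand is `w⁻⁶` times a function of `w²`: even powers only,
so no residue, and the primitive is single-valued and odd. Multiplying by `F` leaves poles `w⁻³` and
`w⁻¹`. The terms `w³` and `w` are subtracted with them, and restored in `J`, to make the singular
part imaginary on the unit circle. -/
theorem IsSymmetricConformal.exists_isSingularPrimitive {F : ℂ → ℂ} (hF : IsSymmetricConformal F)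
    (κ : ℝ) : ∃ α β P J, IsSingularPrimitive F κ α β P J := by
  set g := dslope F 0 with hg
  have hgc : IsSelfConj g := ⟨hF.dslope_diff, fun z hz ↦ hF.dslope_conj hz⟩
  have hMc : IsSelfConj fun z ↦ -κ * (1 + z) / g z ^ 2 :=
    ⟨DifferentiableOn.div (by fun_prop) (hgc.diff.pow 2)
      fun z hz ↦ pow_ne_zero 2 (hF.dslope_ne_zero hz), fun z hz ↦ by
        rw [hgc.conj_map z hz]; simp⟩
  obtain ⟨m₀, M₁, hM₁, hM₁e⟩ := hMc.exists_eq_add_mul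
  obtain ⟨m₁, M₂, hM₂, hM₂e⟩ := hM₁.exists_eq_add_mul
  obtain ⟨m₂, N, hN, hNe⟩ := hM₂.exists_eq_add_mul
  -- Scaled so that `m₀ w⁻⁶` and `m₁ w⁻⁴` integrate to `k₀ w⁻⁵` and `-k₁ w⁻³`.
  obtain ⟨k₀, rfl⟩ : ∃ k, m₀ = -5 * k := ⟨-m₀ / 5, by ring⟩
  obtain ⟨k₁, rfl⟩ : ∃ k, m₁ = 3 * k := ⟨m₁ / 3, by ring⟩
  obtain ⟨g₀, G₁, hG₁, hG₁e⟩ := hgc.exists_eq_add_mul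
  obtain ⟨g₁, G, hG, hGe⟩ := hG₁.exists_eq_add_mul
  obtain ⟨S, hSc, hS, hSn⟩ := hN.exists_odd_primitive
  have hsq : ∀ w ∈ ball (0 : ℂ) 1, w ^ 2 ∈ ball (0 : ℂ) 1 := fun w hw ↦
    sq_mem_ball (mem_ball_zero_iff.1 hw)
  have hcomp : ∀ {h : ℂ → ℂ}, IsSelfConj h → DifferentiableOn ℂ (fun w ↦ h (w ^ 2)) (ball 0 1) :=
    fun hh ↦ hh.diff.comp (by fun_prop) hsq
  have hconj : ∀ {h : ℂ → ℂ}, IsSelfConj h → ∀ w ∈ ball (0 : ℂ) 1,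
      h (conj w ^ 2) = conj (h (w ^ 2)) := fun hh w hw ↦ by
    rw [← map_pow, hh.conj_map _ (hsq w hw)]
  have dG := hcomp hG
  have dG₁ := hcomp hG₁
  have dg := hcomp hgc
  have dS := hSc.diff
  set J : ℂ → ℂ := fun w ↦ k₀ * (w * G (w ^ 2)) - k₁ * (w * G₁ (w ^ 2)) - m₂ * (w * g (w ^ 2))
    + w ^ 2 * g (w ^ 2) * S w + (k₀ * g₀ : ℝ) * w ^ 3 + (k₀ * g₁ - k₁ * g₀ : ℝ) * w with hJ
  have dw : DifferentiableOn ℂ (fun w : ℂ ↦ w) (ball 0 1) := differentiableOn_id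
  refine ⟨k₀ * g₀, k₀ * g₁ - k₁ * g₀,
    fun w ↦ k₀ * (w⁻¹) ^ 5 - k₁ * (w⁻¹) ^ 3 - m₂ * w⁻¹ + S w, J, ⟨fun w hw hw0 ↦ ?_, fun w hw ↦ ?_,
    fun w hw ↦ ?_, ?_, by simp [hJ], fun w hw hre ↦ re_eq_zero_of_odd (f := J) ?_ ?_ hre,
    fun w hw hw0 ↦ ?_⟩⟩
  · have hi := hasDerivAt_inv hw0
    have h1 := ((((hi.pow 5).const_mul (k₀ : ℂ)).sub ((hi.pow 3).const_mul (k₁ : ℂ))).sub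
      (hi.const_mul (m₂ : ℂ))).add (hS w hw)
    convert! h1 using 1
    have e1 : -κ * (1 + w ^ 2) / g (w ^ 2) ^ 2 =
        (-5 * k₀ : ℝ) + w ^ 2 * ((3 * k₁ : ℝ) + w ^ 2 * (m₂ + w ^ 2 * N (w ^ 2))) := by
      rw [← hNe, ← hM₂e, ← hM₁e]
    rw [hF.eq_mul_dslope (w ^ 2), ← hg, show -κ * (1 + w ^ 2) / (w ^ 2 * (w ^ 2 * g (w ^ 2)) ^ 2) =
      -κ * (1 + w ^ 2) / g (w ^ 2) ^ 2 * (w⁻¹) ^ 6 by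
        have := hF.dslope_ne_zero (hsq w hw); field_simp, e1]
    push_cast
    field_simp
    ring
  · simp [hSc.conj_map w hw]
  · simp only [inv_neg, hSn w hw]
    ring
  · exact (((((dw.mul dG).const_mul _).sub ((dw.mul dG₁).const_mul _)).sub
      ((dw.mul dg).const_mul _)).add (((dw.pow 2).mul dg).mul dS)).add
        ((dw.pow 3).const_mul _) |>.add (dw.const_mul _)
  · simp only [hJ, hconj hG w hw, hconj hG₁ w hw, hconj hgc w hw, hSc.conj_map w hw, map_add,
      map_sub, map_mul, map_pow, Complex.conj_ofReal]
  · simp only [hJ, neg_sq, hSn w hw]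
    ring
  · have e2 : g (w ^ 2) = g₀ + w ^ 2 * (g₁ + w ^ 2 * G (w ^ 2)) := by rw [← hGe, ← hG₁e]
    rw [hF.eq_mul_dslope (w ^ 2), ← hg]
    simp only [hJ]
    rw [hGe (w ^ 2), e2]
    push_cast
    field_simp
    ring

end HeleShaw

namespace HeleShaw
open Filter Set Metric ComplexConjugate Asymptotics InnerProductSpace

/-! ### Integration of the free boundary condition -/

theorem conj_mem_slitPlane {z : ℂ} (hz : z ∈ Complex.slitPlane) : conj z ∈ Complex.slitPlane := by
  rw [Complex.mem_slitPlane_iff] at hz ⊢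
  simpa using hz

theorem conj_mem_rightHalfDisk {w : ℂ} (hw : w ∈ rightHalfDisk) : conj w ∈ rightHalfDisk :=
  ⟨by rw [Complex.norm_conj]; exact hw.1, hw.2⟩

theorem rightHalfDisk_subset_ball : rightHalfDisk ⊆ ball 0 1 := fun _ hw ↦
  mem_ball_zero_iff.2 hw.1

namespace IsSymmetricConformal

variable {F : ℂ → ℂ}

theorem sqrtInv_conj (hF : IsSymmetricConformal F) {z : ℂ}
    (hz : z ∈ F '' ball 0 1 ∩ Complex.slitPlane) : sqrtInv F (conj z) = conj (sqrtInv F z) := by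
  obtain ⟨w, hw, rfl⟩ := hF.exists_sq hz
  rw [← hF.conj_map _ (sq_mem_ball hw.1), map_pow, hF.sqrtInv_apply hw,
    hF.sqrtInv_apply (conj_mem_rightHalfDisk hw)]

theorem conj_mem_image (hF : IsSymmetricConformal F) {z : ℂ} (hz : z ∈ F '' ball 0 1) :
    conj z ∈ F '' ball 0 1 := by
  obtain ⟨ζ, hζ, rfl⟩ := hz
  exact ⟨conj ζ, conj_mem_ball hζ, hF.conj_map ζ hζ⟩

theorem tendsto_conj_image (hF : IsSymmetricConformal F) (p : ℂ) :
    Tendsto (fun z ↦ conj z) (𝓝[F '' ball 0 1] p) (𝓝[F '' ball 0 1] (conj p)) :=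
  tendsto_nhdsWithin_iff.2 ⟨(Complex.continuous_conj.tendsto p).mono_left nhdsWithin_le_nhds,
    eventually_mem_nhdsWithin.mono fun _ hz ↦ hF.conj_mem_image hz⟩

theorem conj_mem_boundary (hF : IsSymmetricConformal F) {p : ℂ}
    (hp : p ∈ frontier (F '' ball 0 1) ∩ Complex.slitPlane) :
    conj p ∈ frontier (F '' ball 0 1) ∩ Complex.slitPlane := by
  refine ⟨?_, conj_mem_slitPlane hp.2⟩
  have h1 := hp.1
  rw [hF.isOpen_image.frontier_eq] at h1 ⊢
  refine ⟨?_, fun h ↦ h1.2 ?_⟩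
  · have n1 := mem_closure_iff_nhdsWithin_neBot.1 h1.1
    exact mem_closure_iff_nhdsWithin_neBot.2 ((n1.map _).mono (hF.tendsto_conj_image p))
  · simpa using hF.conj_mem_image h

/-- The image of the smaller disk contains a ball about `0`, and injectivity keeps all other values
out of that ball. -/
theorem exists_le_norm (hF : IsSymmetricConformal F) {r : ℝ} (hr : 0 < r) (hr1 : r ≤ 1) :
    ∃ c, 0 < c ∧ ∀ ζ ∈ ball (0 : ℂ) 1, r ≤ ‖ζ‖ → c ≤ ‖F ζ‖ := by
  have hsub : ball (0 : ℂ) r ⊆ ball 0 1 := ball_subset_ball hr1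
  have ho := isOpen_image_of_deriv_ne_zero isOpen_ball (hF.diff.mono hsub)
    (fun z hz ↦ hF.deriv_ne_zero z (hsub hz))
  obtain ⟨c, hc, hball⟩ := Metric.isOpen_iff.1 ho 0 ⟨0, mem_ball_self hr, hF.zero⟩
  refine ⟨c, hc, fun ζ hζ hrζ ↦ ?_⟩
  by_contra! hlt
  obtain ⟨ζ', hζ', heq⟩ := hball (mem_ball_zero_iff.2 hlt)
  rw [hF.inj (hsub hζ') hζ heq, mem_ball_zero_iff] at hζ'
  exact absurd hrζ (not_le.2 hζ')

end IsSymmetricConformal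

namespace IsSingularPrimitive

variable {F P J : ℂ → ℂ} {κ α β : ℝ}

/-- For `‖w‖ ≥ 1/2` one has `‖w²‖ ≥ 1/4`, where `F` is bounded away from zero, so the derivative of
`P` is bounded. -/
theorem exists_lipschitz (hP : IsSingularPrimitive F κ α β P J) (hF : IsSymmetricConformal F) :
    ∃ C, 0 ≤ C ∧ ∀ x y, segment ℝ x y ⊆ ball 0 1 \ ball 0 (1 / 2) →
      ‖P y - P x‖ ≤ C * ‖y - x‖ := by
  obtain ⟨c, hc, hF'⟩ := hF.exists_le_norm (r := 1 / 4) (by norm_num) (by norm_num)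
  refine ⟨|κ| * 2 / ((1 / 2) ^ 2 * c ^ 2), by positivity, fun x y hseg ↦ ?_⟩
  refine (convex_segment x y).norm_image_sub_le_of_norm_hasDerivWithin_le
    (fun w hw ↦ (hP.hasDerivAt w (hseg hw).1 ?_).hasDerivWithinAt) (fun w hw ↦ ?_)
    (left_mem_segment ℝ x y) (right_mem_segment ℝ x y)
  · rintro rfl
    exact (hseg hw).2 (mem_ball_self (by norm_num))
  · have h1 := mem_ball_zero_iff.1 (hseg hw).1
    have h2 : 1 / 2 ≤ ‖w‖ := by
      have := (hseg hw).2
      rwa [mem_ball_zero_iff, not_lt] at this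
    have h3 := hF' (w ^ 2) (sq_mem_ball h1) (by rw [norm_pow]; nlinarith)
    rw [norm_div, norm_mul, norm_mul, norm_neg, norm_pow, norm_pow, Complex.norm_real,
      Real.norm_eq_abs]
    have h4 : ‖1 + w ^ 2‖ ≤ 2 := by
      refine (norm_add_le _ _).trans ?_
      rw [norm_one, norm_pow]
      nlinarith [norm_nonneg w]
    gcongr

/-- `P` is odd and commutes with conjugation, so `Re P = 0` on the imaginary axis; compare `w` with
`i Im w` along a horizontal segment, which stays in the annulus as `|Im w| ≥ 1/2`. -/
theorem abs_re_le (hP : IsSingularPrimitive F κ α β P J) (hF : IsSymmetricConformal F) :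
    ∃ C, ∀ w ∈ rightHalfDisk, 1 / 2 ≤ |w.im| → |(P w).re| ≤ C * w.re := by
  obtain ⟨C, hC, hlip⟩ := hP.exists_lipschitz hF
  refine ⟨C, fun w hw him ↦ ?_⟩
  set v : ℂ := w.im * Complex.I with hv
  have hvre : v.re = 0 := by simp [hv]
  have hvim : v.im = w.im := by simp [hv]
  have hvb : v ∈ ball (0 : ℂ) 1 := by
    rw [mem_ball_zero_iff, hv, norm_mul, Complex.norm_I, mul_one, Complex.norm_real]
    exact (Complex.abs_im_le_norm w).trans_lt hw.1
  have hseg : segment ℝ v w ⊆ ball 0 1 \ ball 0 (1 / 2) := fun u hu ↦ by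
    refine ⟨(convex_ball _ _).segment_subset hvb (rightHalfDisk_subset_ball hw) hu, ?_⟩
    obtain ⟨s, t, hs, ht, hst, rfl⟩ := hu
    have : (s • v + t • w).im = w.im := by
      simp only [Complex.add_im, Complex.smul_im, hvim, smul_eq_mul]
      rw [← add_mul, hst, one_mul]
    rw [mem_ball_zero_iff, not_lt]
    refine le_trans ?_ (Complex.abs_im_le_norm _)
    rwa [this]
  have h1 := hlip v w hseg
  have h2 : (P v).re = 0 := re_eq_zero_of_odd (hP.conj_map v hvb) (hP.neg_map v hvb) hvre
  have h3 : ‖w - v‖ = w.re := by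
    have : w - v = (w.re : ℂ) := Complex.ext (by simp [hvre]) (by simp [hvim])
    rw [this, Complex.norm_real, Real.norm_of_nonneg hw.2.le]
  rw [h3] at h1
  have h4 := Complex.abs_re_le_norm (P w - P v)
  rw [Complex.sub_re, h2, sub_zero] at h4
  exact h4.trans h1

/-- Compare `w` with the point of the circle of radius `1/2` on the same ray. -/
theorem exists_norm_le (hP : IsSingularPrimitive F κ α β P J) (hF : IsSymmetricConformal F) :
    ∃ B, ∀ w ∈ ball (0 : ℂ) 1, 1 / 2 ≤ ‖w‖ → ‖P w‖ ≤ B := by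
  obtain ⟨C, hC, hlip⟩ := hP.exists_lipschitz hF
  have hcont : ContinuousOn P (sphere 0 (1 / 2)) := fun w hw ↦ by
    have hw' : ‖w‖ = 1 / 2 := mem_sphere_zero_iff_norm.1 hw
    refine (hP.hasDerivAt w (mem_ball_zero_iff.2 (by rw [hw']; norm_num)) ?_).continuousAt
      |>.continuousWithinAt
    rintro rfl
    norm_num at hw'
  obtain ⟨B, hB⟩ := (isCompact_sphere (0 : ℂ) (1 / 2)).exists_bound_of_continuousOn hcont
  refine ⟨B + C, fun w hw hw2 ↦ ?_⟩
  have hw1 := mem_ball_zero_iff.1 hw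
  have hw0 : 0 < ‖w‖ := by linarith
  set s := (2 * ‖w‖)⁻¹ with hs
  have hs1 : s ≤ 1 := inv_le_one_of_one_le₀ (by linarith)
  have hs0 : 0 < s := by positivity
  have hsw : s * ‖w‖ = 1 / 2 := by rw [hs]; field_simp
  have hn : ∀ t : ℝ, 0 ≤ t → ‖t • w‖ = t * ‖w‖ := fun t ht ↦ by
    rw [norm_smul, Real.norm_of_nonneg ht]
  have hseg : segment ℝ (s • w) w ⊆ ball 0 1 \ ball 0 (1 / 2) := by
    rintro u ⟨x, y, hx, hy, hxy, rfl⟩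
    have h1 : x • s • w + y • w = (x * s + y) • w := by rw [add_smul, smul_smul]
    have h2 : s ≤ x * s + y := by nlinarith
    have h3 : x * s + y ≤ 1 := by nlinarith
    rw [h1]
    refine ⟨?_, ?_⟩
    · rw [mem_ball_zero_iff, hn _ (hs0.le.trans h2)]
      nlinarith
    · rw [mem_ball_zero_iff, hn _ (hs0.le.trans h2), not_lt, ← hsw]
      gcongr
  have h1 := hlip _ _ hseg
  have h2 := hB (s • w) (by rw [mem_sphere_zero_iff_norm, hn s hs0.le, hsw])
  have h3 : ‖w - s • w‖ ≤ 1 := by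
    rw [show w - s • w = (1 - s) • w by rw [sub_smul, one_smul], hn _ (sub_nonneg.2 hs1)]
    nlinarith
  have h4 := norm_le_insert' (P w) (P (s • w))
  nlinarith

end IsSingularPrimitive

/-- The boundary derivative of `z ↦ Q z - conj z / z`. -/
theorem hasFDerivAt_sub_conj_div {Q : ℂ → ℂ} {Q' z : ℂ} (hQ : HasDerivAt Q Q' z) (hz : z ≠ 0) :
    HasFDerivAt (fun z ↦ Q z - conj z / z)
      (ContinuousLinearMap.mul ℝ ℂ (Q' + conj z / z ^ 2) - z⁻¹ • (Complex.conjCLE : ℂ →L[ℝ] ℂ)) z := by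
  have h1 := hQ.hasFDerivAt.restrictScalars ℝ
  have h2 := (hasDerivAt_inv hz).hasFDerivAt.restrictScalars ℝ
  have h3 := (Complex.conjCLE : ℂ →L[ℝ] ℂ).hasFDerivAt (x := z) |>.mul h2
  refine ((h1.sub h3).congr_fderiv ?_)
  refine ContinuousLinearMap.ext fun v ↦ ?_
  simp
  field_simp
  ring

namespace IsSelfSimilarFlow

variable {F P J : ℂ → ℂ} {ν a α β : ℝ}

theorem hasDerivAt_comp_sqrtInv (h : IsSelfSimilarFlow F ν a) {κ : ℝ}
    (hP : IsSingularPrimitive F κ α β P J) {z : ℂ} (hz : z ∈ F '' ball 0 1 ∩ Complex.slitPlane) :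
    HasDerivAt (fun z ↦ P (sqrtInv F z)) (κ * deriv (complexPotential F) z / z ^ 2) z := by
  obtain ⟨w, hw, rfl⟩ := h.conformal.exists_sq hz
  have hw0 := ne_zero_of_mem_rightHalfDisk hw
  have hF0 := h.conformal.ne_zero (sq_mem_ball hw.1) (pow_ne_zero 2 hw0)
  have hd := h.conformal.deriv_ne_zero _ (sq_mem_ball hw.1)
  have h1 := hP.hasDerivAt w (rightHalfDisk_subset_ball hw) hw0
  rw [← h.conformal.sqrtInv_apply hw] at h1
  have h2 := h1.comp _ (h.conformal.hasDerivAt_sqrtInv hw)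
  convert! h2 using 1
  rw [(h.conformal.hasDerivAt_complexPotential hw).deriv, h.conformal.sqrtInv_apply hw]
  field_simp

/-- In the tangential direction `i n` the derivative of `P` is `κ e i n / p²` and that of `conj p /
p` is `-2 i Re (conj p n) / p²`. They agree because `e n = ν Re (conj p n)` and `κ = -2 / ν`, and
the boundary without the tip is connected. -/
theorem exists_tendsto_sub_conj_div (h : IsSelfSimilarFlow F ν a)
    (hP : IsSingularPrimitive F (-2 / ν) α β P J) :
    ∃ k : ℂ, ∀ p ∈ frontier (F '' ball 0 1) ∩ Complex.slitPlane,
      Tendsto (fun z ↦ P (sqrtInv F z) - conj z / z) (𝓝[F '' ball 0 1] p) (𝓝 k) := by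
  have hex : ∀ q, ∃ e, q ∈ frontier (F '' ball 0 1) ∩ Complex.slitPlane →
      Tendsto (deriv (complexPotential F)) (𝓝[F '' ball 0 1] q) (𝓝 e) ∧
      ∀ n, IsOutwardUnitNormal (F '' ball 0 1) q n → e * n = (ν * (conj q * n).re : ℝ) := fun q ↦ by
    by_cases hq : q ∈ frontier (F '' ball 0 1) ∩ Complex.slitPlane
    · obtain ⟨e, -, he⟩ := h.deriv_limit q hq
      exact ⟨e, fun _ ↦ he⟩
    · exact ⟨0, fun hq' ↦ absurd hq' hq⟩
  choose e he using hex
  have hfd : ∀ z ∈ F '' ball 0 1 ∩ Complex.slitPlane, _ := fun z hz ↦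
    hasFDerivAt_sub_conj_div (h.hasDerivAt_comp_sqrtInv hP hz) (Complex.slitPlane_ne_zero hz.2)
  refine exists_boundary_const h.isOpen Complex.isOpen_slitPlane h.isPreconnected h.smooth
    (L := fun p ↦ ContinuousLinearMap.mul ℝ ℂ ((-2 / ν : ℝ) * e p / p ^ 2 + conj p / p ^ 2) -
      p⁻¹ • (Complex.conjCLE : ℂ →L[ℝ] ℂ))
    (fun z hz ↦ (hfd z hz).differentiableAt) (fun p hp ↦ ?_) fun p hp n hn ↦ ?_
  · have hp0 := Complex.slitPlane_ne_zero hp.2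
    have hid : Tendsto (fun z : ℂ ↦ z) (𝓝[F '' ball 0 1] p) (𝓝 p) := nhdsWithin_le_nhds
    have hcj : Tendsto (fun z : ℂ ↦ conj z) (𝓝[F '' ball 0 1] p) (𝓝 (conj p)) :=
      (Complex.continuous_conj.tendsto p).mono_left nhdsWithin_le_nhds
    have h1 := ((((he p hp).1.const_mul ((-2 / ν : ℝ) : ℂ)).div (hid.pow 2)
      (pow_ne_zero 2 hp0)).add (hcj.div (hid.pow 2) (pow_ne_zero 2 hp0)))
    have h2 := ((ContinuousLinearMap.mul ℝ ℂ).continuous.tendsto _).comp h1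
    have h3 := (hid.inv₀ hp0).smul_const (Complex.conjCLE : ℂ →L[ℝ] ℂ)
    refine (h2.sub h3).congr' ?_
    filter_upwards [eventually_mem p hp] with z hz
    exact (hfd z hz).fderiv.symm
  · have hp0 := Complex.slitPlane_ne_zero hp.2
    have h1 := (he p hp).2 n hn
    have h2 : conj p * n + p * conj n = (2 * (conj p * n).re : ℝ) := by
      have := Complex.add_conj (conj p * n)
      rwa [map_mul, Complex.conj_conj] at this
    have hν : (ν : ℂ) ≠ 0 := by exact_mod_cast h.rate_ne_zero
    simp only [sub_apply, ContinuousLinearMap.mul_apply',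
      smul_apply, ContinuousLinearEquiv.coe_coe, Complex.conjCLE_apply,
      map_mul, Complex.conj_I, smul_eq_mul]
    have h3 : ((-2 / ν : ℝ) * e p / p ^ 2 + conj p / p ^ 2) * (Complex.I * n) -
        p⁻¹ * (-Complex.I * conj n) = Complex.I / p ^ 2 * ((-2 / ν : ℝ) * (e p * n) +
          (conj p * n + p * conj n)) := by
      field_simp
      ring
    rw [h3, h1, h2]
    push_cast
    field_simp
    ring

/-- The constant is real by symmetry. For its real part follow boundary points to the tip: `conj p /
p → 1`, while `Re P → 0` because `|Re P| ≤ C Re w` and the boundary roots approach the imaginary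
axis. -/
theorem tendsto_sub_conj_div (h : IsSelfSimilarFlow F ν a)
    (hP : IsSingularPrimitive F (-2 / ν) α β P J) {p : ℂ}
    (hp : p ∈ frontier (F '' ball 0 1) ∩ Complex.slitPlane) :
    Tendsto (fun z ↦ P (sqrtInv F z) - conj z / z) (𝓝[F '' ball 0 1] p) (𝓝 (-1)) := by
  obtain ⟨k, hk⟩ := h.exists_tendsto_sub_conj_div hP
  suffices k = -1 from this ▸ hk p hp
  apply Complex.ext
  · obtain ⟨C, hC⟩ := hP.abs_re_le h.conformal
    obtain ⟨q, hq, hqa, hq0⟩ := h.exists_seq_tendsto_tip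
    have hac : (-(a : ℂ)) ≠ 0 := by
      have := h.tip_pos.ne'
      simpa using this
    have hdiv : Tendsto (fun n ↦ (k + conj (q n) / q n).re) atTop (𝓝 (k.re + 1)) := by
      have h1 := ((Complex.continuous_conj.tendsto _).comp hqa).div hqa hac
      rw [map_neg, Complex.conj_ofReal, div_self hac] at h1
      have := (Complex.continuous_re.tendsto _).comp (h1.const_add k)
      rwa [Complex.add_re, Complex.one_re] at this
    have him : ∀ᶠ n in atTop, 1 / 2 < |(boundaryRoot F (q n)).im| := by
      filter_upwards [hq0.eventually (gt_mem_nhds (show (0 : ℝ) < 1 / 2 by norm_num))] with n hn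
      have h1 := h.norm_boundaryRoot (hq n)
      have h2 := h.boundaryRoot_re_pos (hq n)
      rw [← sq_eq_sq₀ (norm_nonneg _) zero_le_one, ← Complex.normSq_eq_norm_sq,
        Complex.normSq_apply] at h1
      refine lt_of_pow_lt_pow_left₀ 2 (abs_nonneg _) ?_
      rw [sq_abs]
      nlinarith
    have hle : ∀ᶠ n in atTop, |(k + conj (q n) / q n).re| ≤ C * (boundaryRoot F (q n)).re := by
      filter_upwards [him] with n hn
      have := neBot (hq n)
      have hψ := h.tendsto_sqrtInv (hq n)
      have hq0 := Complex.slitPlane_ne_zero (hq n).2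
      have hcd : Tendsto (fun z : ℂ ↦ conj z / z) (𝓝[F '' ball 0 1] (q n))
          (𝓝 (conj (q n) / q n)) :=
        (((Complex.continuous_conj.tendsto _).div tendsto_id hq0)).mono_left nhdsWithin_le_nhds
      have h1 := (((Complex.continuous_re.tendsto _).comp ((hk _ (hq n)).add hcd))).abs
      have h2 := ((Complex.continuous_re.tendsto _).comp hψ).const_mul C
      refine le_of_tendsto_of_tendsto h1 h2 ?_
      filter_upwards [h.eventually_sqrtInv_mem (hq n),
        ((Complex.continuous_im.tendsto _).comp hψ).abs.eventually (lt_mem_nhds hn)] with z hz hz'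
      simp only [Function.comp_apply, sub_add_cancel]
      exact hC _ hz hz'.le
    have h1 := le_of_tendsto_of_tendsto hdiv.abs (hq0.const_mul C) hle
    rw [mul_zero] at h1
    have := abs_nonpos_iff.1 h1
    rw [Complex.neg_re, Complex.one_re]
    linarith
  · have n1 := neBot hp
    have h1 := (hk _ (h.conformal.conj_mem_boundary hp)).comp (h.conformal.tendsto_conj_image p)
    have h2 := (Complex.continuous_conj.tendsto _).comp (hk p hp)
    have h3 : conj k = k := by
      refine tendsto_nhds_unique h2 (h1.congr' ?_)
      filter_upwards [eventually_mem p hp] with z hz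
      simp only [Function.comp_apply, map_sub, map_div₀, h.conformal.sqrtInv_conj hz]
      rw [hP.conj_map _ (rightHalfDisk_subset_ball (h.conformal.sqrtInv_mem hz))]
    rw [Complex.conj_eq_iff_im.1 h3, Complex.neg_im, Complex.one_im, neg_zero]

end IsSelfSimilarFlow

end HeleShaw

namespace HeleShaw
open Filter Set Metric ComplexConjugate Asymptotics InnerProductSpace

/-! ### Uniqueness -/

/-- The gradient of `Re f` is the conjugate of `f'`, so `f' = 0` on the half disk; the identity
theorem spreads this to the whole disk. -/
theorem eqOn_const_of_re_eq_zero {f : ℂ → ℂ} (hf : DifferentiableOn ℂ f (ball 0 1))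
    (h0 : ∀ w ∈ rightHalfDisk, (f w).re = 0) : ∀ w ∈ ball (0 : ℂ) 1, f w = f 0 := by
  have hder : ∀ w ∈ rightHalfDisk, deriv f w = 0 := fun w hw ↦ by
    have h1 := (hasGradientAt_re (hf.differentiableAt (isOpen_ball.mem_nhds
      (rightHalfDisk_subset_ball hw))).hasDerivAt)
    have h2 : (fun z ↦ (f z).re) =ᶠ[𝓝 w] fun _ ↦ 0 := by
      filter_upwards [isOpen_rightHalfDisk.mem_nhds hw] with z hz using h0 z hz
    have h3 := h1.unique ((hasGradientAt_const w (0 : ℝ)).congr_of_eventuallyEq h2)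
    simpa using h3
  have hhalf : (1 / 2 : ℂ) ∈ rightHalfDisk := ⟨by norm_num, by norm_num⟩
  have hev : f =ᶠ[𝓝 (1 / 2 : ℂ)] fun _ ↦ f (1 / 2) := by
    obtain ⟨r, hr, hsub⟩ := Metric.isOpen_iff.1 isOpen_rightHalfDisk _ hhalf
    filter_upwards [ball_mem_nhds _ hr] with z hz
    exact isOpen_ball.is_const_of_deriv_eq_zero (convex_ball _ _).isPreconnected
      (hf.mono (hsub.trans rightHalfDisk_subset_ball)) (fun w hw ↦ hder w (hsub hw)) hz
      (mem_ball_self hr)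
  have heq := (hf.analyticOnNhd isOpen_ball).eqOn_of_preconnected_of_eventuallyEq
    analyticOnNhd_const (convex_ball _ _).isPreconnected (rightHalfDisk_subset_ball hhalf) hev
  intro w hw
  exact (heq hw).trans (heq (mem_ball_self one_pos)).symm

namespace IsSelfSimilarFlow

variable {F P J : ℂ → ℂ} {ν a α β : ℝ}

/-- The barrier `log (R + a) - log |F (w²) + a|` is nonnegative and blows up wherever `F` tends to
the tip. Boundedness of `u` thus suffices there, however large the set of circle points at which `F`
accumulates at the tip. -/
theorem nonpos_of_boundary (h : IsSelfSimilarFlow F ν a) {u : ℂ → ℝ} {M : ℝ}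
    (hu : HarmonicOnNhd u rightHalfDisk)
    (haxis : ∀ w₀ : ℂ, ‖w₀‖ < 1 → w₀.re = 0 → ∀ ε > 0, ∀ᶠ w in 𝓝[rightHalfDisk] w₀, u w ≤ ε)
    (hM : ∀ w ∈ rightHalfDisk, 1 / 2 ≤ ‖w‖ → u w ≤ M)
    (hA : ∀ p ∈ frontier (F '' ball 0 1) ∩ Complex.slitPlane,
      Tendsto (fun z ↦ u (sqrtInv F z)) (𝓝[F '' ball 0 1] p) (𝓝 0)) :
    ∀ w ∈ rightHalfDisk, u w ≤ 0 := by
  obtain ⟨R, hR, hFR⟩ := h.exists_norm_le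
  have hmaps : ∀ w ∈ rightHalfDisk, w ^ 2 ∈ ball (0 : ℂ) 1 := fun w hw ↦ sq_mem_ball hw.1
  have hpos : ∀ w ∈ rightHalfDisk, 0 < ‖F (w ^ 2) + a‖ := fun w hw ↦
    norm_pos_iff.2 (h.add_tip_ne_zero (hmaps w hw))
  have hB : HarmonicOnNhd (fun w ↦ (Real.log (R + a) : ℂ).re - Real.log ‖F (w ^ 2) + a‖)
      rightHalfDisk := by
    refine HarmonicOnNhd.sub (fun w hw ↦ AnalyticAt.harmonicAt_re analyticAt_const)
      fun w hw ↦ ?_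
    have hd : DifferentiableOn ℂ (fun w ↦ F (w ^ 2) + a) rightHalfDisk :=
      (h.conformal.diff.comp (by fun_prop) hmaps).add_const _
    exact (hd.analyticAt (isOpen_rightHalfDisk.mem_nhds hw)).harmonicAt_log_norm
      (h.add_tip_ne_zero (hmaps w hw))
  have hB₀ : ∀ w ∈ rightHalfDisk,
      0 ≤ (Real.log (R + a) : ℂ).re - Real.log ‖F (w ^ 2) + a‖ := fun w hw ↦ by
    rw [Complex.ofReal_re, sub_nonneg]
    refine Real.log_le_log (hpos w hw) ((norm_add_le _ _).trans ?_)
    rw [Complex.norm_real, Real.norm_of_nonneg h.tip_pos.le]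
    exact add_le_add_left (hFR _ (hmaps w hw)) _
  refine harmonic_nonpos_of_barrier isOpen_rightHalfDisk isBounded_rightHalfDisk hu hB
    fun w₀ hw₀ ε hε η hη ↦ ?_
  rw [isOpen_rightHalfDisk.frontier_eq] at hw₀
  have hcl : ‖w₀‖ ≤ 1 ∧ 0 ≤ w₀.re := by
    have hc : IsClosed {w : ℂ | ‖w‖ ≤ 1 ∧ 0 ≤ w.re} :=
      (isClosed_le continuous_norm continuous_const).inter
        (isClosed_le continuous_const Complex.continuous_re)
    exact hc.closure_subset_iff.2 (fun w hw ↦ ⟨hw.1.le, hw.2.le⟩) hw₀.1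
  rcases hcl.1.lt_or_eq with hlt | heq
  · have hre : w₀.re = 0 := by
      by_contra hne
      exact hw₀.2 ⟨hlt, lt_of_le_of_ne hcl.2 (Ne.symm hne)⟩
    filter_upwards [haxis w₀ hlt hre ε hε, self_mem_nhdsWithin] with w hw hwD
    have := mul_nonneg hη.le (hB₀ w hwD)
    linarith
  · have hsq : Tendsto (fun w : ℂ ↦ w ^ 2) (𝓝[rightHalfDisk] w₀) (𝓝[ball 0 1] (w₀ ^ 2)) :=
      tendsto_nhdsWithin_iff.2 ⟨((continuous_pow 2).tendsto w₀).mono_left nhdsWithin_le_nhds,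
        eventually_mem_nhdsWithin.mono hmaps⟩
    refine eventually_le_barrier (h := fun w ↦ F (w ^ 2)) (Ω := F '' ball 0 1) (t := -a) (M := M)
      h.isOpen h.isBounded ?_ (fun K hK hKc ↦ ?_) ?_ (fun p hp hpt ε hε ↦ ?_) ?_ ?_ hε hη
    · filter_upwards [self_mem_nhdsWithin] with w hw using mem_image_of_mem _ (hmaps w hw)
    · exact hsq.eventually (h.conformal.eventually_notMem hK hKc (by rw [norm_pow, heq, one_pow]))
    · have hn : ∀ᶠ w in 𝓝[rightHalfDisk] w₀, 1 / 2 < ‖w‖ :=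
        (continuous_norm.tendsto w₀).mono_left nhdsWithin_le_nhds |>.eventually
          (lt_mem_nhds (by rw [heq]; norm_num))
      filter_upwards [hn, self_mem_nhdsWithin] with w hw hwD using hM w hwD hw.le
    · have hpA := h.mem_boundary hp hpt
      have hD : ∀ᶠ w in 𝓝[rightHalfDisk] w₀ ⊓ comap (fun w ↦ F (w ^ 2)) (𝓝 p),
          w ∈ rightHalfDisk := (eventually_mem_nhdsWithin).filter_mono inf_le_left
      have ht : Tendsto (fun w ↦ F (w ^ 2))
          (𝓝[rightHalfDisk] w₀ ⊓ comap (fun w ↦ F (w ^ 2)) (𝓝 p)) (𝓝[F '' ball 0 1] p) :=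
        tendsto_nhdsWithin_iff.2 ⟨tendsto_comap.mono_left inf_le_right,
          hD.mono fun w hw ↦ mem_image_of_mem _ (hmaps w hw)⟩
      filter_upwards [((hA p hpA).comp ht).eventually (gt_mem_nhds hε), hD] with w hw hwD
      rw [Function.comp_apply, h.conformal.sqrtInv_apply hwD] at hw
      exact hw.le
    · filter_upwards [self_mem_nhdsWithin] with w hw using hB₀ w hw
    · have hD : ∀ᶠ w in 𝓝[rightHalfDisk] w₀ ⊓ comap (fun w ↦ F (w ^ 2)) (𝓝 (-(a : ℂ))),
          w ∈ rightHalfDisk := (eventually_mem_nhdsWithin).filter_mono inf_le_left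
      have ht : Tendsto (fun w ↦ F (w ^ 2))
          (𝓝[rightHalfDisk] w₀ ⊓ comap (fun w ↦ F (w ^ 2)) (𝓝 (-(a : ℂ)))) (𝓝 (-a)) :=
        tendsto_comap.mono_left inf_le_right
      have h0 := (ht.add_const (a : ℂ)).norm
      rw [neg_add_cancel, norm_zero] at h0
      have hlog := Real.tendsto_log_nhdsGT_zero.comp
        (tendsto_nhdsWithin_iff.2 ⟨h0, hD.mono fun w hw ↦ hpos w hw⟩)
      exact tendsto_atTop_add_const_left _ _ (tendsto_neg_atBot_atTop.comp hlog)

/-- A holomorphic function with vanishing real part on the boundary arc and on the imaginary axis is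
constant. -/
theorem eq_const_of_boundary (h : IsSelfSimilarFlow F ν a) {G : ℂ → ℂ} {M : ℝ}
    (hG : DifferentiableOn ℂ G (ball 0 1)) (haxis : ∀ w ∈ ball (0 : ℂ) 1, w.re = 0 → (G w).re = 0)
    (hM : ∀ w ∈ rightHalfDisk, 1 / 2 ≤ ‖w‖ → ‖G w‖ ≤ M)
    (hA : ∀ p ∈ frontier (F '' ball 0 1) ∩ Complex.slitPlane,
      Tendsto (fun z ↦ (G (sqrtInv F z)).re) (𝓝[F '' ball 0 1] p) (𝓝 0)) :
    ∀ w ∈ ball (0 : ℂ) 1, G w = G 0 := by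
  have hlim : ∀ w₀ : ℂ, ‖w₀‖ < 1 → w₀.re = 0 →
      Tendsto (fun w ↦ (G w).re) (𝓝[rightHalfDisk] w₀) (𝓝 0) := fun w₀ hw₀ hre ↦ by
    have hmem := mem_ball_zero_iff.2 hw₀
    have := Complex.continuous_re.continuousAt.comp
      (hG.differentiableAt (isOpen_ball.mem_nhds hmem)).continuousAt
    have := this.tendsto
    rw [Function.comp_apply, haxis w₀ hmem hre] at this
    exact this.mono_left nhdsWithin_le_nhds
  have hharm : HarmonicOnNhd (fun w ↦ (G w).re) rightHalfDisk := fun w hw ↦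
    (hG.analyticAt (isOpen_ball.mem_nhds (rightHalfDisk_subset_ball hw))).harmonicAt_re
  refine eqOn_const_of_re_eq_zero hG fun w hw ↦ le_antisymm ?_ ?_
  · exact h.nonpos_of_boundary hharm (fun w₀ h1 h2 ε hε ↦
      ((hlim w₀ h1 h2).eventually (gt_mem_nhds hε)).mono fun _ hw ↦ hw.le)
      (fun w hw hw2 ↦ (Complex.re_le_norm _).trans (hM w hw hw2)) hA w hw
  · have := h.nonpos_of_boundary (u := fun w ↦ -(G w).re) (M := M) hharm.neg
      (fun w₀ h1 h2 ε hε ↦ by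
        have := (hlim w₀ h1 h2).neg
        rw [neg_zero] at this
        exact (this.eventually (gt_mem_nhds hε)).mono fun _ hw ↦ hw.le)
      (fun w hw hw2 ↦ (neg_le_abs _).trans ((Complex.abs_re_le_norm _).trans (hM w hw hw2)))
      (fun p hp ↦ by simpa using (hA p hp).neg) w hw
    linarith

theorem inv_eq_conj_of_norm_eq_one {ω : ℂ} (hω : ‖ω‖ = 1) : ω⁻¹ = conj ω := by
  rw [Complex.inv_def, Complex.normSq_eq_norm_sq, hω]; simp

theorem tendsto_mul_comp_sqrtInv (h : IsSelfSimilarFlow F ν a)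
    (hP : IsSingularPrimitive F (-2 / ν) α β P J) {p : ℂ}
    (hp : p ∈ frontier (F '' ball 0 1) ∩ Complex.slitPlane) :
    Tendsto (fun z ↦ z * P (sqrtInv F z)) (𝓝[F '' ball 0 1] p) (𝓝 (conj p - p)) := by
  have hp0 := Complex.slitPlane_ne_zero hp.2
  have hid : Tendsto (fun z : ℂ ↦ z) (𝓝[F '' ball 0 1] p) (𝓝 p) := nhdsWithin_le_nhds
  have hcj : Tendsto (fun z : ℂ ↦ conj z) (𝓝[F '' ball 0 1] p) (𝓝 (conj p)) :=
    (Complex.continuous_conj.tendsto p).mono_left nhdsWithin_le_nhds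
  have h1 := (hid.mul (h.tendsto_sub_conj_div hP hp)).add hcj
  rw [mul_neg_one, neg_add_eq_sub] at h1
  refine h1.congr' ?_
  filter_upwards [eventually_mem p hp] with z hz
  have := Complex.slitPlane_ne_zero hz.2
  field_simp
  ring

theorem tendsto_singularPart (h : IsSelfSimilarFlow F ν a) (α β : ℝ) {p : ℂ}
    (hp : p ∈ frontier (F '' ball 0 1) ∩ Complex.slitPlane) :
    Tendsto (fun z ↦ α * ((sqrtInv F z)⁻¹ ^ 3 - sqrtInv F z ^ 3) +
      β * ((sqrtInv F z)⁻¹ - sqrtInv F z)) (𝓝[F '' ball 0 1] p)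
      (𝓝 (((-2 * (α * (boundaryRoot F p ^ 3).im + β * (boundaryRoot F p).im) : ℝ) : ℂ) *
        Complex.I)) := by
  have hψ := h.tendsto_sqrtInv hp
  have hn := h.norm_boundaryRoot hp
  have h0 : boundaryRoot F p ≠ 0 := norm_ne_zero_iff.1 (by rw [hn]; exact one_ne_zero)
  have h1 := ((((hψ.inv₀ h0).pow 3).sub (hψ.pow 3)).const_mul (α : ℂ)).add
    (((hψ.inv₀ h0).sub hψ).const_mul (β : ℂ))
  convert! h1 using 2
  rw [inv_eq_conj_of_norm_eq_one hn, ← map_pow]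
  apply Complex.ext
  · simp only [Complex.mul_I_re, Complex.ofReal_im, Complex.add_re, Complex.re_ofReal_mul,
      Complex.sub_re, Complex.conj_re]
    ring
  · simp only [Complex.mul_I_im, Complex.ofReal_re, Complex.add_im, Complex.im_ofReal_mul,
      Complex.sub_im, Complex.conj_im]
    ring

theorem mul_eq_of_mem (h : IsSelfSimilarFlow F ν a) {κ : ℝ} (hP : IsSingularPrimitive F κ α β P J)
    {z : ℂ} (hz : z ∈ F '' ball 0 1 ∩ Complex.slitPlane) :
    z * P (sqrtInv F z) = α * ((sqrtInv F z)⁻¹ ^ 3 - sqrtInv F z ^ 3) +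
      β * ((sqrtInv F z)⁻¹ - sqrtInv F z) + J (sqrtInv F z) := by
  have hw := h.conformal.sqrtInv_mem hz
  rw [← hP.mul_eq _ (rightHalfDisk_subset_ball hw) (ne_zero_of_mem_rightHalfDisk hw),
    h.conformal.apply_sqrtInv hz]

/-- `z P` has boundary values `conj p - p` and the singular part is imaginary on `|w| = 1`, so `J`
has zero real boundary values on the arc, as it does on the imaginary axis. It is bounded near the
arc, hence constant, and `J 0 = 0`. -/
theorem regular_eq_zero (h : IsSelfSimilarFlow F ν a)
    (hP : IsSingularPrimitive F (-2 / ν) α β P J) : ∀ w ∈ ball (0 : ℂ) 1, J w = 0 := by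
  obtain ⟨R, hR, hFR⟩ := h.exists_norm_le
  obtain ⟨B, hB⟩ := hP.exists_norm_le h.conformal
  intro w hw
  rw [← hP.regular_zero]
  refine h.eq_const_of_boundary (M := R * B + (|α| * (2 ^ 3 + 1) + |β| * (2 + 1))) hP.diff_regular
    hP.regular_re (fun w hw hw2 ↦ ?_) (fun p hp ↦ ?_) w hw
  · have hwb := rightHalfDisk_subset_ball hw
    have h1 := hP.mul_eq w hwb (ne_zero_of_mem_rightHalfDisk hw)
    have h2 : J w = F (w ^ 2) * P w - (α * ((w⁻¹) ^ 3 - w ^ 3) + β * (w⁻¹ - w)) := by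
      rw [h1]; ring
    have hi : ‖w⁻¹‖ ≤ 2 := by
      rw [norm_inv]
      exact inv_le_of_inv_le₀ two_pos (by linarith)
    have hw1 : ‖w‖ ≤ 1 := hw.1.le
    rw [h2]
    refine (norm_sub_le _ _).trans (add_le_add ?_ ((norm_add_le _ _).trans (add_le_add ?_ ?_)))
    · rw [norm_mul]
      exact mul_le_mul (hFR _ (sq_mem_ball hw.1)) (hB w hwb hw2) (norm_nonneg _) hR.le
    · rw [norm_mul, Complex.norm_real, Real.norm_eq_abs]
      refine mul_le_mul_of_nonneg_left ((norm_sub_le _ _).trans ?_) (abs_nonneg _)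
      rw [norm_pow, norm_pow]
      exact add_le_add (pow_le_pow_left₀ (norm_nonneg _) hi 3) (pow_le_one₀ (norm_nonneg _) hw1)
    · rw [norm_mul, Complex.norm_real, Real.norm_eq_abs]
      exact mul_le_mul_of_nonneg_left ((norm_sub_le _ _).trans (add_le_add hi hw1)) (abs_nonneg _)
  · have h1 := (Complex.continuous_re.tendsto _).comp
      ((h.tendsto_mul_comp_sqrtInv hP hp).sub (h.tendsto_singularPart α β hp))
    have h2 : (conj p - p - ((-2 * (α * (boundaryRoot F p ^ 3).im + β * (boundaryRoot F p).im) : ℝ)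
        : ℂ) * Complex.I).re = 0 := by simp
    rw [h2] at h1
    refine h1.congr' ?_
    filter_upwards [eventually_mem p hp] with z hz
    simp only [Function.comp_apply]
    rw [h.mul_eq_of_mem hP hz, add_sub_cancel_left]

/-- With `J = 0`, compare the imaginary parts of the two boundary limits, using `Im ω³ = Im ω (4 (Re
ω)² - 1)` on the unit circle. -/
theorem im_boundary_eq (h : IsSelfSimilarFlow F ν a)
    (hP : IsSingularPrimitive F (-2 / ν) α β P J) {p : ℂ}
    (hp : p ∈ frontier (F '' ball 0 1) ∩ Complex.slitPlane) :
    p.im = (boundaryRoot F p).im * (4 * α * (boundaryRoot F p).re ^ 2 + (β - α)) := by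
  have n1 := neBot hp
  have h1 := tendsto_nhds_unique (h.tendsto_mul_comp_sqrtInv hP hp)
    ((h.tendsto_singularPart α β hp).congr' (by
      filter_upwards [eventually_mem p hp] with z hz
      rw [h.mul_eq_of_mem hP hz, h.regular_eq_zero hP _
        (rightHalfDisk_subset_ball (h.conformal.sqrtInv_mem hz)), add_zero]))
  have h2 := congrArg Complex.im h1
  have hn := h.norm_boundaryRoot hp
  rw [← sq_eq_sq₀ (norm_nonneg _) zero_le_one, ← Complex.normSq_eq_norm_sq,
    Complex.normSq_apply] at hn
  set ω := boundaryRoot F p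
  have h3 : (ω ^ 3).im = ω.im * (4 * ω.re ^ 2 - 1) := by
    have : (ω ^ 3).im = 3 * ω.re ^ 2 * ω.im - ω.im ^ 3 := by
      rw [pow_succ, pow_two]
      simp only [Complex.mul_re, Complex.mul_im]
      ring
    rw [this]
    linear_combination -ω.im * hn
  rw [h3] at h2
  simp only [Complex.sub_im, Complex.conj_im, Complex.mul_I_im, Complex.ofReal_re] at h2
  linarith

/-- Along boundary points tending to the tip `Im p → 0` and `Re ω → 0`, so `(Im ω)² → 1` and the
remaining factor `β - α` must vanish. Squares are used since the sign of `Im ω` may vary along the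
sequence. -/
theorem coeff_eq (h : IsSelfSimilarFlow F ν a) (hP : IsSingularPrimitive F (-2 / ν) α β P J) :
    β = α := by
  obtain ⟨q, hq, hqa, hq0⟩ := h.exists_seq_tendsto_tip
  have h1 := ((Complex.continuous_im.tendsto _).comp hqa).pow 2
  rw [Complex.neg_im, Complex.ofReal_im, neg_zero, zero_pow two_ne_zero] at h1
  have h2 : Tendsto (fun n ↦ (1 - (boundaryRoot F (q n)).re ^ 2) *
      (4 * α * (boundaryRoot F (q n)).re ^ 2 + (β - α)) ^ 2) atTop
      (𝓝 ((1 - 0 ^ 2) * (4 * α * 0 ^ 2 + (β - α)) ^ 2)) :=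
    ((hq0.pow 2).const_sub 1).mul ((((hq0.pow 2).const_mul (4 * α)).add_const (β - α)).pow 2)
  have h3 := tendsto_nhds_unique (h1.congr fun n ↦ ?_) h2
  · rw [zero_pow two_ne_zero, sub_zero, one_mul, mul_zero, zero_add] at h3
    have := pow_eq_zero_iff two_ne_zero |>.1 h3.symm
    linarith
  · have hn := h.norm_boundaryRoot (hq n)
    rw [← sq_eq_sq₀ (norm_nonneg _) zero_le_one, ← Complex.normSq_eq_norm_sq,
      Complex.normSq_apply] at hn
    rw [Function.comp_apply, h.im_boundary_eq hP (hq n), mul_pow]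
    congr 1
    linear_combination hn

/-- The difference `F - c f` is bounded, with zero imaginary part on the imaginary `w`-axis by
symmetry and on the arc by `im_boundary_eq`. The factor `-i` turns imaginary into real parts for
`eq_const_of_boundary`. -/
theorem exists_eq_mul_killingMap (h : IsSelfSimilarFlow F ν a) :
    ∃ c : ℝ, ∀ ζ ∈ ball (0 : ℂ) 1, F ζ = c * killingMap ζ := by
  obtain ⟨α, β, P, J, hP⟩ := h.conformal.exists_isSingularPrimitive (-2 / ν)
  obtain rfl := h.coeff_eq hP
  -- The ratio of `Im p = 4 β x² y` to `Im f = (15 π / 16) x² y`, for `ω = x + i y`.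
  set c := 64 * β / (15 * Real.pi) with hc
  refine ⟨c, fun ζ hζ ↦ ?_⟩
  obtain ⟨R, hR, hFR⟩ := h.exists_norm_le
  obtain ⟨B, hB⟩ := (isCompact_closedBall (0 : ℂ) 1).exists_bound_of_continuousOn
    continuousOn_killingMap
  have hsq : ∀ w ∈ ball (0 : ℂ) 1, w ^ 2 ∈ ball (0 : ℂ) 1 := fun w hw ↦
    sq_mem_ball (mem_ball_zero_iff.1 hw)
  have hreal : ∀ w : ℂ, w.re = 0 → conj (w ^ 2) = w ^ 2 := fun w hw ↦ by
    have h1 : conj w = -w := Complex.ext (by simp [hw]) (by simp)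
    rw [map_pow, h1, neg_sq]
  have key := h.eq_const_of_boundary (G := fun w ↦ -Complex.I * (F (w ^ 2) - c * killingMap (w ^ 2)))
    (M := R + |c| * B)
    (((h.conformal.diff.comp (by fun_prop) hsq).sub
      ((differentiableOn_killingMap.comp (by fun_prop) hsq).const_mul _)).const_mul _)
    (fun w hw hre ↦ ?_) (fun w hw _ ↦ ?_) (fun p hp ↦ ?_)
  · have hr : ‖ζ ^ (1 / 2 : ℂ)‖ < 1 := by
      have h1 := congrArg norm (cpow_half_sq ζ)
      rw [norm_pow] at h1
      have h2 := mem_ball_zero_iff.1 hζ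
      by_contra! hcon
      nlinarith
    have h1 := key _ (mem_ball_zero_iff.2 hr)
    simp only [cpow_half_sq, zero_pow two_ne_zero, h.conformal.zero, killingMap_zero, mul_zero,
      sub_zero, mul_eq_zero, neg_eq_zero, Complex.I_ne_zero, false_or] at h1
    exact sub_eq_zero.1 h1
  · have h1 : (F (w ^ 2)).im = 0 := by
      rw [← Complex.conj_eq_iff_im, ← h.conformal.conj_map _ (hsq w hw), hreal w hre]
    have h2 : (killingMap (w ^ 2)).im = 0 := by
      rw [← Complex.conj_eq_iff_im, ← killingMap_conj (hsq w hw), hreal w hre]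
    simp [h1, h2]
  · rw [norm_mul, norm_neg, Complex.norm_I, one_mul]
    have hmem := sq_mem_ball hw.1
    refine (norm_sub_le _ _).trans (add_le_add (hFR _ hmem) ?_)
    rw [norm_mul, Complex.norm_real, Real.norm_eq_abs]
    exact mul_le_mul_of_nonneg_left (hB _ (ball_subset_closedBall hmem)) (abs_nonneg _)
  · have hψ := h.tendsto_sqrtInv hp
    have hn := h.norm_boundaryRoot hp
    have hpos := h.boundaryRoot_re_pos hp
    have him := h.im_boundary_eq hP hp
    set ω := boundaryRoot F p
    have hK : Tendsto (fun z ↦ killingMap (sqrtInv F z ^ 2)) (𝓝[F '' ball 0 1] p)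
        (𝓝 (killingMap (ω ^ 2))) := by
      have hω : ω ^ 2 ∈ closedBall (0 : ℂ) 1 := by
        rw [mem_closedBall_zero_iff, norm_pow, hn, one_pow]
      refine (continuousOn_killingMap _ hω).tendsto.comp (tendsto_nhdsWithin_iff.2
        ⟨hψ.pow 2, (h.eventually_sqrtInv_mem hp).mono fun z hz ↦
          ball_subset_closedBall (sq_mem_ball hz.1)⟩)
    have hid : Tendsto (fun z : ℂ ↦ z) (𝓝[F '' ball 0 1] p) (𝓝 p) := nhdsWithin_le_nhds
    have h1 := (Complex.continuous_re.tendsto _).comp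
      ((hid.sub (hK.const_mul (c : ℂ))).const_mul (-Complex.I))
    have h2 : (-Complex.I * (p - c * killingMap (ω ^ 2))).re = 0 := by
      rw [← sq_eq_sq₀ (norm_nonneg _) zero_le_one, ← Complex.normSq_eq_norm_sq,
        Complex.normSq_apply] at hn
      have h3 := killingMap_circle (c := ω.re) (s := ω.im) (by linarith) hpos
      rw [Complex.re_add_im] at h3
      have h4 : (killingMap (ω ^ 2)).im = 15 * Real.pi / 16 * ω.re ^ 2 * ω.im := by
        rw [h3, Complex.add_im, Complex.ofReal_im, Complex.mul_I_im, Complex.ofReal_re, zero_add]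
      have h5 : (-Complex.I * (p - c * killingMap (ω ^ 2))).re =
          p.im - c * (killingMap (ω ^ 2)).im := by simp
      have hπ := Real.pi_ne_zero
      rw [h5, h4, him, hc]
      field_simp
      ring
    rw [h2] at h1
    refine h1.congr' ?_
    filter_upwards [eventually_mem p hp] with z hz
    simp only [Function.comp_apply, h.conformal.apply_sqrtInv hz]

end IsSelfSimilarFlow

/-- Every solution of the self-similar problem is a dilate of the explicit one. -/
theorem exists_eq_of_isSolution {Ω : Set ℂ} (h : IsSolution Ω) :
    ∃ c : ℝ, 0 < c ∧ Ω = (fun ζ : ℂ ↦ (c : ℂ) * killingMap ζ) '' ball 0 1 := by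
  obtain ⟨F, ν, a, hF, rfl⟩ := h.exists_isSelfSimilarFlow
  obtain ⟨c, hc⟩ := hF.exists_eq_mul_killingMap
  refine ⟨c, ?_, image_congr hc⟩
  -- The sign of `c` is read off at the origin: `F' 0 > 0` and `f' 0 = 1`.
  obtain ⟨d, hd, hd'⟩ := hF.conformal.deriv_zero
  have h0 : (0 : ℂ) ∈ ball (0 : ℂ) 1 := mem_ball_self one_pos
  have h1 : F =ᶠ[𝓝 0] fun ζ ↦ c * killingMap ζ := by
    filter_upwards [isOpen_ball.mem_nhds h0] with ζ hζ using hc ζ hζ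
  have h2 := h1.deriv_eq
  rw [deriv_const_mul _ (differentiableOn_killingMap.differentiableAt (isOpen_ball.mem_nhds h0)),
    deriv_killingMap_zero, mul_one, hd'] at h2
  have h3 : d = c := by exact_mod_cast h2
  rwa [← h3]

end HeleShaw


theorem proposition1 :
    -- the solutions are exactly the dilates of the image of the unit disk
    (∀ Ω : Set ℂ, HeleShaw.IsSolution Ω ↔
      ∃ c : ℝ, 0 < c ∧ Ω = (fun ζ : ℂ ↦ (c : ℂ) * HeleShaw.killingMap ζ) '' Metric.ball 0 1) ∧
    -- the map is conformal on the unit disk, normalized at the origin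
    DifferentiableOn ℂ HeleShaw.killingMap (Metric.ball 0 1) ∧
    Set.InjOn HeleShaw.killingMap (Metric.ball 0 1) ∧
    HeleShaw.killingMap 0 = 0 ∧ deriv HeleShaw.killingMap 0 = 1 ∧
    -- its power series (the term with index zero vanishes)
    (∀ ζ ∈ Metric.ball (0 : ℂ) 1,
      HasSum (fun k : ℕ ↦ (15 / 16 : ℂ) *
        ((k : ℂ) / (((k : ℂ) ^ 2 - 1 / 4) * ((k : ℂ) ^ 2 - 9 / 4))) * (-ζ) ^ k)
        (HeleShaw.killingMap ζ)) ∧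
    -- the logarithmic cusp at the boundary point -1
    (fun u : ℂ ↦ HeleShaw.killingMap (-1 + u) - HeleShaw.killingMap (-1))
      ~[𝓝[{u : ℂ | -1 + u ∈ Metric.closedBall (0 : ℂ) 1}] 0]
      (fun u : ℂ ↦ -(15 / 32) * u ^ 2 * Complex.log u) := by
  refine ⟨fun Ω ↦ ⟨HeleShaw.exists_eq_of_isSolution, ?_⟩, HeleShaw.differentiableOn_killingMap,
    HeleShaw.injOn_killingMap, HeleShaw.killingMap_zero, HeleShaw.deriv_killingMap_zero,
    fun ζ hζ ↦ HeleShaw.hasSum_killingMap (mem_ball_zero_iff.1 hζ),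
    HeleShaw.killingMap_isEquivalent_cusp⟩
  rintro ⟨c, hc, rfl⟩
  exact HeleShaw.isSolution_killingMap hc
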